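/- Let $M$ be a compact (Hausdorff) smooth manifold of dimension $2n+s$ with an almost $\mathcal K$-structure: a $(1,1)$-tensor field $f$ with $f^3+f=0$, vector fields $\xi_1,\dots,\xi_s$ and $1$-forms $\eta_1,\dots,\eta_s$ with $\eta_i(\xi_j)=\delta_{ij}$, $f\xi_i=0$, $\eta_i\circ f=0$, $f^2=-I+\sum_k \xi_k\otimes\eta_k$, and a Riemannian metric $g$ with $g(X,Y)=g(fX,fY)+\sum_k\eta_k(X)\eta_k(Y)$, such that the $2$-form $F(X,Y):=g(X,fY)$ is closed and all $\xi_i$ are Killing. Suppose that either $d\eta_i=F$ for all $i$ (almost $\mathcal S$-manifold), or, more generally, every $d\eta_i$ is basic. Here a form $\alpha$ is basic if $i_X\alpha=i_Xd\alpha=0$ for all $X$ tangent to the foliation $\mathcal F$ with tangent bundle $T\mathcal F=\ker f=\langle\xi_1,\dots,\xi_s\rangle$; $H^\bullet(M/\mathcal F)$ denotes the cohomology of the complex of smooth basic forms with differential $d$. Let $\overline G$ be the closure of the group $G$ of diffeomorphisms of $M$ generated by the flows of the vector fields in $\mathrm{span}_{\mathbb R}(\xi_1,\dots,\xi_s)$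 (a torus of isometries), let $\Omega^m_{\overline G}(M)$ be the space of $\overline G$-invariant smooth $m$-forms, and let $$F^k\Omega^m_{\overline G}(M)=\{\alpha\in\Omega^m_{\overline G}(M) : i_{X_{m-k+1}}\cdots i_{X_1}\alpha=0 \text{ for all } X_1,\dots,X_{m-k+1}\in\Gamma(T\mathcal F)\}$$ (all of $\Omega^m_{\overline G}(M)$ for $k\le 0$, and $0$ for $k>m$). Then each $F^k\Omega^\bullet_{\overline G}(M)$ is a subcomplex. Let $(E_r^{p,q},d_r)$ be the spectral sequence of this filtered complex, i.e. $$E_r^{p,q}=Z_r^{p,q}\big/\bigl(Z_r^{p,q}\cap(F^{p+1}\Omega^{p+q}_{\overline G}(M)+d(F^{p-r+1}\Omega^{p+q-1}_{\overline G}(M)))\bigr),\qquad Z_r^{p,q}=\{\alpha\in F^p\Omega^{p+q}_{\overline G}(M): d\alpha\in F^{p+r}\Omega^{p+q+1}_{\overline G}(M)\},$$ with $d_r:E_r^{p,q}\to E_r^{p+r,q-r+1}$ induced by $d$. Then $d_0=0$, and for all $p,q\ge 0$ there is a linear isomorphism $$E_2^{p,q}\cong H^p(M/\mathcal F)\otimes\textstyle\bigwedge^q\langle\eta_1,\dots,\eta_s\rangle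 .$$ Under it the class $[a]\otimes(\eta_{i_1}\wedge\cdots\wedge\eta_{i_q})$, for a closed basic $p$-form $a$, corresponds to the class of $\eta_{i_1}\wedge\cdots\wedge\eta_{i_q}\wedge a$. -/

import Mathlib

open Set Filter Topology Manifold ContDiff
open scoped TensorProduct
noncomputable section

namespace AlmostK

section Forms
variable {E : Type*} [NormedAddCommGroup E] [NormedSpace ℝ E]
  {M : Type*} [TopologicalSpace M] [ChartedSpace E M]
  {N : Type*} [TopologicalSpace N] [ChartedSpace E N]

/-- A (not necessarily smooth) differential `k`-form on a manifold `M` modelled on `E`: an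
alternating `k`-linear form on each tangent space. In Mathlib the tangent space `TangentSpace 𝓘(ℝ, E) x`
is by definition `E` (through the preferred chart at `x`). -/
abbrev Form (E M : Type*) [NormedAddCommGroup E] [NormedSpace ℝ E] (k : ℕ) : Type _ :=
  M → E [⋀^Fin k]→L[ℝ] ℝ

variable (E) in
/-- The differential `T_x M → T_{φ(x)} N` of a map of manifolds. -/
def diffAt (φ : M → N) (x : M) : E →L[ℝ] E :=
  mfderiv 𝓘(ℝ, E) 𝓘(ℝ, E) φ x

namespace Form

/-- The pullback `φ^* α`. -/
def pullback {k : ℕ} (φ : M → N) (α : Form E N k) : Form E M k :=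
  fun x => (α (φ x)).compContinuousLinearMap (diffAt E φ x)

/-- The expression of `α` in the preferred chart at `x₀`, a form on the model space. -/
def inChart {k : ℕ} (α : Form E M k) (x₀ : M) : Form E E k :=
  pullback (extChartAt 𝓘(ℝ, E) x₀).symm α

/-- The form is smooth in all charts. -/
def Smooth {k : ℕ} (α : Form E M k) : Prop :=
  ∀ x₀ : M, ContDiffOn ℝ ∞ (α.inChart x₀) (extChartAt 𝓘(ℝ, E) x₀).target

/-- The exterior derivative: at `x` it is computed in the preferred chart at `x`
(`inChart_d` shows that any other chart gives the same result). -/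
def d {k : ℕ} (α : Form E M k) : Form E M (k + 1) := fun x =>
  pullback (extChartAt 𝓘(ℝ, E) x) (extDeriv (α.inChart x) : Form E E (k + 1)) x

/-- The exterior product `η ∧ β` of a one-form with a `k`-form, see `wedge_apply`. -/
def wedge {k : ℕ} (η : Form E M 1) (β : Form E M k) : Form E M (k + 1) := fun x =>
  ContinuousAlternatingMap.alternatizeUncurryFin
    (((ContinuousAlternatingMap.ofSubsingleton ℝ E ℝ (0 : Fin 1)).symm (η x)).smulRight (β x))

/-- The product `η₁ ∧ (η₂ ∧ (⋯ ∧ (η_q ∧ α)))` of one-forms with a `p`-form. -/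
def wedgeProd {p : ℕ} (α : Form E M p) : ∀ {q : ℕ}, (Fin q → Form E M 1) → Form E M (p + q)
  | 0, _ => α
  | _ + 1, η => wedge (η 0) (wedgeProd α fun i => η i.succ)

theorem wedge_apply {k : ℕ} (η : Form E M 1) (β : Form E M k) (x : M) (v : Fin (k + 1) → E) :
    wedge η β x v =
      ∑ i : Fin (k + 1), (-1 : ℝ) ^ (i : ℕ) * (η x (fun _ => v i) * β x (i.removeNth v)) := by
  simp [wedge, ContinuousAlternatingMap.alternatizeUncurryFin_apply]

theorem diffAt_comp {P : Type*} [TopologicalSpace P] [ChartedSpace E P] {g : N → P} {f : M → N}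
    {x : M} (hg : MDifferentiableAt 𝓘(ℝ, E) 𝓘(ℝ, E) g (f x))
    (hf : MDifferentiableAt 𝓘(ℝ, E) 𝓘(ℝ, E) f x) :
    diffAt E (g ∘ f) x = (diffAt E g (f x)).comp (diffAt E f x) :=
  mfderiv_comp x hg hf

theorem pullback_id {k : ℕ} (α : Form E M k) : pullback id α = α := by
  funext x
  have : diffAt E (id : M → M) x = ContinuousLinearMap.id ℝ E := mfderiv_id
  simp only [pullback, this]
  rfl

theorem pullback_comp_apply {k : ℕ} {P : Type*} [TopologicalSpace P] [ChartedSpace E P]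
    {g : N → P} {f : M → N} {x : M} (hg : MDifferentiableAt 𝓘(ℝ, E) 𝓘(ℝ, E) g (f x))
    (hf : MDifferentiableAt 𝓘(ℝ, E) 𝓘(ℝ, E) f x) (α : Form E P k) :
    pullback (g ∘ f) α x = pullback f (pullback g α) x := by
  simp only [pullback, diffAt_comp hg hf]
  rfl

theorem Smooth.differentiableAt {k : ℕ} {α : Form E M k} (hα : α.Smooth) (x₀ : M) {y : E}
    (hy : y ∈ (extChartAt 𝓘(ℝ, E) x₀).target) : DifferentiableAt ℝ (α.inChart x₀) y :=
  ((hα x₀).contDiffAt ((isOpen_extChartAt_target x₀).mem_nhds hy)).differentiableAt (by norm_num)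

theorem Smooth.add {k : ℕ} {α β : Form E M k} (hα : α.Smooth) (hβ : β.Smooth) : (α + β).Smooth :=
  fun x₀ => (hα x₀).add (hβ x₀)

theorem Smooth.smul {k : ℕ} {α : Form E M k} (c : ℝ) (hα : α.Smooth) : (c • α).Smooth :=
  fun x₀ => (hα x₀).const_smul c

theorem smooth_zero {k : ℕ} : (0 : Form E M k).Smooth := fun _ =>
  (contDiffOn_const (c := (0 : E [⋀^Fin k]→L[ℝ] ℝ))).congr fun _ _ => rfl

theorem d_smul {k : ℕ} (c : ℝ) (α : Form E M k) : (c • α).d = c • α.d := by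
  funext x
  have := extDeriv_smul c (α.inChart x) (x := extChartAt 𝓘(ℝ, E) x x)
  change ContinuousAlternatingMap.compContinuousLinearMap (extDeriv (c • α.inChart x) _) _ = _
  rw [this]
  rfl
variable [IsManifold 𝓘(ℝ, E) ∞ M] [IsManifold 𝓘(ℝ, E) ∞ N]

theorem two_le_infty : minSmoothness ℝ 2 ≤ (∞ : WithTop ℕ∞) := by
  rw [minSmoothness_of_isRCLikeNormedField]
  exact WithTop.coe_le_coe.2 (le_top : (2 : ℕ∞) ≤ ⊤)

theorem mdiffAt_chart (x₀ : M) {x : M} (hx : x ∈ (extChartAt 𝓘(ℝ, E) x₀).source) :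
    MDifferentiableAt 𝓘(ℝ, E) 𝓘(ℝ, E) (extChartAt 𝓘(ℝ, E) x₀) x := by
  have : IsManifold 𝓘(ℝ, E) 1 M := IsManifold.of_le (n := ∞) (by norm_num)
  exact mdifferentiableAt_extChartAt (by simpa using hx)

theorem contMDiffAt_symm (x₀ : M) {y : E} (hy : y ∈ (extChartAt 𝓘(ℝ, E) x₀).target) :
    ContMDiffAt 𝓘(ℝ, E) 𝓘(ℝ, E) ∞ (extChartAt 𝓘(ℝ, E) x₀).symm y :=
  (contMDiffOn_extChartAt_symm (n := ∞) x₀).contMDiffAt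
    ((isOpen_extChartAt_target x₀).mem_nhds hy)

theorem mdiffAt_symm (x₀ : M) {y : E} (hy : y ∈ (extChartAt 𝓘(ℝ, E) x₀).target) :
    MDifferentiableAt 𝓘(ℝ, E) 𝓘(ℝ, E) (extChartAt 𝓘(ℝ, E) x₀).symm y :=
  (contMDiffAt_symm x₀ hy).mdifferentiableAt (by norm_num)

theorem eventually_inChart_pullback {k : ℕ} {φ : M → N}
    (hφ : ContMDiff 𝓘(ℝ, E) 𝓘(ℝ, E) ∞ φ) (α : Form E N k) (x₀ : M) (z₀ : N) {y : E}
    (hy : y ∈ (extChartAt 𝓘(ℝ, E) x₀).target)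
    (hz : φ ((extChartAt 𝓘(ℝ, E) x₀).symm y) ∈ (extChartAt 𝓘(ℝ, E) z₀).source) :
    ContDiffAt ℝ ∞ (extChartAt 𝓘(ℝ, E) z₀ ∘ φ ∘ (extChartAt 𝓘(ℝ, E) x₀).symm) y ∧
    (pullback φ α).inChart x₀ =ᶠ[𝓝 y]
      pullback (extChartAt 𝓘(ℝ, E) z₀ ∘ φ ∘ (extChartAt 𝓘(ℝ, E) x₀).symm) (α.inChart z₀) := by
  have hcont : ContinuousAt (φ ∘ (extChartAt 𝓘(ℝ, E) x₀).symm) y :=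
    hφ.continuous.continuousAt.comp (contMDiffAt_symm x₀ hy).continuousAt
  have hev : ∀ᶠ y' in 𝓝 y, y' ∈ (extChartAt 𝓘(ℝ, E) x₀).target ∧
      φ ((extChartAt 𝓘(ℝ, E) x₀).symm y') ∈ (extChartAt 𝓘(ℝ, E) z₀).source :=
    (eventually_mem_set.2 ((isOpen_extChartAt_target x₀).mem_nhds hy)).and
      (hcont.preimage_mem_nhds ((isOpen_extChartAt_source z₀).mem_nhds hz))
  have hτ : ∀ y', y' ∈ (extChartAt 𝓘(ℝ, E) x₀).target ∧
      φ ((extChartAt 𝓘(ℝ, E) x₀).symm y') ∈ (extChartAt 𝓘(ℝ, E) z₀).source →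
      ContMDiffAt 𝓘(ℝ, E) 𝓘(ℝ, E) ∞
        (extChartAt 𝓘(ℝ, E) z₀ ∘ φ ∘ (extChartAt 𝓘(ℝ, E) x₀).symm) y' := by
    rintro y' ⟨h1, h2⟩
    refine ContMDiffAt.comp y' ?_ ((hφ _).comp y' (contMDiffAt_symm x₀ h1))
    exact contMDiffAt_extChartAt' (by simpa using h2)
  refine ⟨(hτ y ⟨hy, hz⟩).contDiffAt, ?_⟩
  filter_upwards [hev, eventually_eventually_nhds.2 hev] with y' hy' hev'
  have hτ' := (hτ y' hy').mdifferentiableAt (by norm_num)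
  have hmem : (extChartAt 𝓘(ℝ, E) z₀) (φ ((extChartAt 𝓘(ℝ, E) x₀).symm y')) ∈
      (extChartAt 𝓘(ℝ, E) z₀).target := (extChartAt 𝓘(ℝ, E) z₀).map_source hy'.2
  unfold inChart
  rw [← pullback_comp_apply (hφ.mdifferentiableAt (by norm_num)) (mdiffAt_symm x₀ hy'.1),
    ← pullback_comp_apply (mdiffAt_symm z₀ (by exact hmem)) hτ']
  have heq : (φ ∘ (extChartAt 𝓘(ℝ, E) x₀).symm) =ᶠ[𝓝 y']
      ((extChartAt 𝓘(ℝ, E) z₀).symm ∘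
        (extChartAt 𝓘(ℝ, E) z₀ ∘ φ ∘ (extChartAt 𝓘(ℝ, E) x₀).symm)) := by
    filter_upwards [hev'] with w hw
    exact ((extChartAt 𝓘(ℝ, E) z₀).left_inv hw.2).symm
  have hd : diffAt E (φ ∘ (extChartAt 𝓘(ℝ, E) x₀).symm) y' =
      diffAt E ((extChartAt 𝓘(ℝ, E) z₀).symm ∘
        (extChartAt 𝓘(ℝ, E) z₀ ∘ φ ∘ (extChartAt 𝓘(ℝ, E) x₀).symm)) y' := heq.mfderiv_eq
  simp only [pullback]
  rw [hd, heq.eq_of_nhds]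

theorem extDeriv_inChart_pullback {k : ℕ} {φ : M → N}
    (hφ : ContMDiff 𝓘(ℝ, E) 𝓘(ℝ, E) ∞ φ) {α : Form E N k} (hα : α.Smooth) (x₀ : M) (z₀ : N) {y : E}
    (hy : y ∈ (extChartAt 𝓘(ℝ, E) x₀).target)
    (hz : φ ((extChartAt 𝓘(ℝ, E) x₀).symm y) ∈ (extChartAt 𝓘(ℝ, E) z₀).source) :
    extDeriv ((pullback φ α).inChart x₀) y =
      pullback (extChartAt 𝓘(ℝ, E) z₀ ∘ φ ∘ (extChartAt 𝓘(ℝ, E) x₀).symm)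
        (extDeriv (α.inChart z₀) : Form E E (k + 1)) y := by
  obtain ⟨hτ, hev⟩ := eventually_inChart_pullback hφ α x₀ z₀ hy hz
  rw [hev.extDeriv_eq]
  have hdf : ∀ (f : E → E) (w : E), diffAt E f w = fderiv ℝ f w := fun f w => mfderiv_eq_fderiv
  have hα' := hα.differentiableAt z₀ ((extChartAt 𝓘(ℝ, E) z₀).map_source hz)
  generalize hτ_eq : (extChartAt 𝓘(ℝ, E) z₀ ∘ φ ∘ (extChartAt 𝓘(ℝ, E) x₀).symm : E → E) = τ at hτ
  have hα'' : DifferentiableAt ℝ (α.inChart z₀) (τ y) := by rw [← hτ_eq]; exact hα'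
  have := extDeriv_pullback hα'' hτ two_le_infty
  unfold pullback
  simp only [hdf]
  exact this

theorem inChart_d {k : ℕ} {α : Form E M k} (hα : α.Smooth) (x₀ : M) {y : E}
    (hy : y ∈ (extChartAt 𝓘(ℝ, E) x₀).target) :
    α.d.inChart x₀ y = extDeriv (α.inChart x₀) y := by
  have hz := mem_extChartAt_source (I := 𝓘(ℝ, E)) ((extChartAt 𝓘(ℝ, E) x₀).symm y)
  have h := extDeriv_inChart_pullback contMDiff_id hα x₀ ((extChartAt 𝓘(ℝ, E) x₀).symm y) hy hz
  rw [pullback_id, Function.id_comp, pullback_comp_apply (mdiffAt_chart _ hz) (mdiffAt_symm x₀ hy)]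
    at h
  rw [h]
  rfl

theorem d_pullback {k : ℕ} {φ : M → N} (hφ : ContMDiff 𝓘(ℝ, E) 𝓘(ℝ, E) ∞ φ) {α : Form E N k}
    (hα : α.Smooth) : (pullback φ α).d = pullback φ α.d := by
  funext x
  have hx := mem_extChartAt_source (I := 𝓘(ℝ, E)) x
  have hy := mem_extChartAt_target (I := 𝓘(ℝ, E)) x
  have hz := mem_extChartAt_source (I := 𝓘(ℝ, E)) (φ x)
  have hxx := (extChartAt 𝓘(ℝ, E) x).left_inv hx
  have h := extDeriv_inChart_pullback hφ hα x (φ x) hy (by rw [hxx]; exact hz)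
  have hev : (extChartAt 𝓘(ℝ, E) (φ x) ∘ φ ∘ (extChartAt 𝓘(ℝ, E) x).symm) ∘ extChartAt 𝓘(ℝ, E) x
      =ᶠ[𝓝 x] extChartAt 𝓘(ℝ, E) (φ x) ∘ φ := by
    filter_upwards [(isOpen_extChartAt_source x).mem_nhds hx] with w hw
    simp only [Function.comp_apply, (extChartAt 𝓘(ℝ, E) x).left_inv hw]
  have hτ := ((eventually_inChart_pullback hφ α x (φ x) hy (by rw [hxx]; exact hz)).1).differentiableAt
    (by norm_num)
  have hd : diffAt E ((extChartAt 𝓘(ℝ, E) (φ x) ∘ φ ∘ (extChartAt 𝓘(ℝ, E) x).symm) ∘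
      extChartAt 𝓘(ℝ, E) x) x = diffAt E (extChartAt 𝓘(ℝ, E) (φ x) ∘ φ) x := hev.mfderiv_eq
  calc (pullback φ α).d x = pullback (extChartAt 𝓘(ℝ, E) x) (pullback
        (extChartAt 𝓘(ℝ, E) (φ x) ∘ φ ∘ (extChartAt 𝓘(ℝ, E) x).symm)
        (extDeriv (α.inChart (φ x)) : Form E E (k + 1))) x := by
        simp only [d]
        change ContinuousAlternatingMap.compContinuousLinearMap
          (extDeriv ((pullback φ α).inChart x) (extChartAt 𝓘(ℝ, E) x x)) _ = _
        rw [h]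
        rfl
    _ = pullback (extChartAt 𝓘(ℝ, E) (φ x) ∘ φ) (extDeriv (α.inChart (φ x)) : Form E E (k + 1)) x := by
        rw [← pullback_comp_apply hτ.mdifferentiableAt (mdiffAt_chart x hx)]
        simp only [pullback]
        rw [hd, hev.eq_of_nhds]
    _ = pullback φ α.d x := by
        rw [pullback_comp_apply (mdiffAt_chart _ hz) (hφ.mdifferentiableAt (by norm_num))]
        rfl

theorem Smooth.d {k : ℕ} {α : Form E M k} (hα : α.Smooth) : α.d.Smooth := by
  intro x₀
  refine ContDiffOn.congr ?_ (fun y hy => inChart_d hα x₀ hy)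
  have h : ContDiffOn ℝ ∞ (fderiv ℝ (α.inChart x₀)) (extChartAt 𝓘(ℝ, E) x₀).target :=
    (hα x₀).fderiv_of_isOpen (isOpen_extChartAt_target x₀) (by simp)
  exact (ContinuousAlternatingMap.alternatizeUncurryFinCLM (n := k) ℝ E ℝ).contDiff.comp_contDiffOn h

theorem d_d {k : ℕ} {α : Form E M k} (hα : α.Smooth) : α.d.d = 0 := by
  funext x
  have hy := mem_extChartAt_target (I := 𝓘(ℝ, E)) x
  have hev : α.d.inChart x =ᶠ[𝓝 (extChartAt 𝓘(ℝ, E) x x)] extDeriv (α.inChart x) := by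
    filter_upwards [(isOpen_extChartAt_target x).mem_nhds hy] with y hy' using inChart_d hα x hy'
  have h0 : extDeriv (α.d.inChart x) (extChartAt 𝓘(ℝ, E) x x) = 0 := by
    rw [hev.extDeriv_eq]
    exact extDeriv_extDeriv_apply
      ((hα x).contDiffAt ((isOpen_extChartAt_target x).mem_nhds hy)) two_le_infty
  simp only [Form.d] at h0 ⊢
  simp only [pullback] at h0 ⊢
  rw [h0]
  rfl

theorem d_add {k : ℕ} {α β : Form E M k} (hα : α.Smooth) (hβ : β.Smooth) :
    (α + β).d = α.d + β.d := by
  funext x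
  have hy := mem_extChartAt_target (I := 𝓘(ℝ, E)) x
  have := extDeriv_add (hα.differentiableAt x hy) (hβ.differentiableAt x hy)
  change ContinuousAlternatingMap.compContinuousLinearMap
    (extDeriv (α.inChart x + β.inChart x) _) _ = _
  rw [this]
  rfl

end Form
end Forms

section SpectralSequence
universe u

/-- A cochain complex of real vector spaces in non-negative degrees. -/
structure RealComplex where
  /-- the cochains of degree `m` -/
  C : ℕ → Type u
  [group : ∀ m, AddCommGroup (C m)]
  [module : ∀ m, Module ℝ (C m)]
  /-- the coboundary operator -/
  d : ∀ m, C m →ₗ[ℝ] C (m + 1)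
  d_d : ∀ m a, d (m + 1) (d m a) = 0

attribute [instance] RealComplex.group RealComplex.module

namespace RealComplex
variable (K : RealComplex.{u})

/-- The cocycles of degree `m`. -/
abbrev cocycles (m : ℕ) : Submodule ℝ (K.C m) := LinearMap.ker (K.d m)

/-- The coboundaries of degree `m`. -/
def coboundaries : ∀ m, Submodule ℝ (K.C m)
  | 0 => ⊥
  | m + 1 => LinearMap.range (K.d m)

/-- The cohomology `ker d / im d` in degree `m`. -/
abbrev Cohomology (m : ℕ) : Type u := K.cocycles m ⧸ (K.coboundaries m).submoduleOf (K.cocycles m)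

/-- The cohomology class of a cocycle. -/
def classOf (m : ℕ) : K.cocycles m →ₗ[ℝ] K.Cohomology m := Submodule.mkQ _

end RealComplex

/-- A cochain complex with a decreasing sequence of graded subspaces `F^p C^m`. -/
structure FilteredComplex extends RealComplex.{u} where
  /-- the term `F^p C^m` of the filtration -/
  F : ℤ → ∀ m, Submodule ℝ (C m)
  F_succ_le : ∀ p m, F (p + 1) m ≤ F p m

namespace FilteredComplex
variable (K : FilteredComplex.{u})

/-- `{a ∈ F^p C^m | d a ∈ F^{p+r} C^{m+1}}`. -/
def cycles (r : ℕ) (p : ℤ) (m : ℕ) : Submodule ℝ (K.C m) :=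
  K.F p m ⊓ (K.F (p + r) (m + 1)).comap (K.d m)

/-- The subspace `d (F^k C^{m-1})` of `C^m` (which is zero for `m = 0`). -/
def exactPart (k : ℤ) : ∀ m, Submodule ℝ (K.C m)
  | 0 => ⊥
  | m + 1 => (K.F k m).map (K.d m)

/-- `F^{p+1} C^m + d (F^{p-r+1} C^{m-1})`. -/
def boundaries (r : ℕ) (p : ℤ) (m : ℕ) : Submodule ℝ (K.C m) :=
  K.F (p + 1) m ⊔ K.exactPart (p - r + 1) m

/-- The term `E_r^{p,q}`, with `m = p + q`, of the spectral sequence of a filtered complex: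
`cycles r p m` modulo those of its elements which lie in `boundaries r p m`. -/
abbrev Page (r : ℕ) (p : ℤ) (m : ℕ) : Type u :=
  K.cycles r p m ⧸ (K.boundaries r p m).submoduleOf (K.cycles r p m)

/-- The class in `E_r^{p,q}` of an element of `cycles`. -/
def pageMk (r : ℕ) (p : ℤ) (m : ℕ) : K.cycles r p m →ₗ[ℝ] K.Page r p m :=
  Submodule.mkQ _

/-- `d` as a map `cycles r p m → cycles r (p + r) (m + 1)`. -/
def cyclesMap (r : ℕ) (p : ℤ) (m : ℕ) : K.cycles r p m →ₗ[ℝ] K.cycles r (p + r) (m + 1) :=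
  (K.d m).restrict fun a ha => ⟨ha.2, by
    change K.d (m + 1) (K.d m a) ∈ K.F (p + r + r) (m + 1 + 1)
    rw [K.d_d]
    exact Submodule.zero_mem _⟩

/-- The coboundary operator `d_r : E_r^{p,q} → E_r^{p+r,q-r+1}` induced by `d`, where
`m = p + q`. -/
def pageD (r : ℕ) (p : ℤ) (m : ℕ) : K.Page r p m →ₗ[ℝ] K.Page r (p + r) (m + 1) :=
  Submodule.mapQ _ _ (K.cyclesMap r p m) <| by
    rintro ⟨x, hx⟩ hxB
    obtain ⟨a, ha, b, hb, hab⟩ := Submodule.mem_sup.1 (hxB : x ∈ K.boundaries r p m)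
    have hdb : K.d m b = 0 := by
      cases m with
      | zero =>
        have hb0 : b = 0 := (Submodule.mem_bot ℝ).1 hb
        rw [hb0, map_zero]
      | succ m =>
        obtain ⟨c, -, rfl⟩ := hb
        exact K.d_d m c
    have hdx : K.d m x = K.d m a := by
      rw [show x = a + b from hab.symm, map_add, hdb, add_zero]
    refine Submodule.mem_sup_right ⟨a, ?_, hdx.symm⟩
    have : p + (r : ℤ) - r + 1 = p + 1 := by ring
    rw [this]
    exact ha

end FilteredComplex

end SpectralSequence

section Flows
variable {E : Type*} [NormedAddCommGroup E] [NormedSpace ℝ E]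
  {M : Type*} [TopologicalSpace M] [ChartedSpace E M]

/-- `φ` is the time-one map of the (complete) flow of the vector field `X`. -/
def IsTimeOneMap (X : ∀ x : M, TangentSpace 𝓘(ℝ, E) x) (φ : M → M) : Prop :=
  ∀ x, ∃ γ : ℝ → M, IsMIntegralCurve (I := 𝓘(ℝ, E)) γ X ∧ γ 0 = x ∧ γ 1 = φ x

/-- The group `G` of diffeomorphisms of `M` generated by the flows of the vector fields in the
real span of `ξ₁, …, ξₛ`. (The flow at time `-1` of `X` is the flow at time `1` of `-X`, so
closing up under composition yields inverses as well.) -/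
inductive FlowGroup {s : ℕ} (ξ : Fin s → ∀ x : M, TangentSpace 𝓘(ℝ, E) x) :
    (M ≃ₘ⟮𝓘(ℝ, E), 𝓘(ℝ, E)⟯ M) → Prop
  | flow (c : Fin s → ℝ) (φ : M ≃ₘ⟮𝓘(ℝ, E), 𝓘(ℝ, E)⟯ M)
      (h : IsTimeOneMap (fun x => ∑ i, c i • ξ i x) φ) : FlowGroup ξ φ
  | comp (φ ψ : M ≃ₘ⟮𝓘(ℝ, E), 𝓘(ℝ, E)⟯ M) (hφ : FlowGroup ξ φ) (hψ : FlowGroup ξ ψ) :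
      FlowGroup ξ (φ.trans ψ)

variable [IsManifold 𝓘(ℝ, E) ∞ M]

/-- The differential of a diffeomorphism, as a continuous self-map of the tangent bundle. -/
def bundleMap (φ : M ≃ₘ⟮𝓘(ℝ, E), 𝓘(ℝ, E)⟯ M) :
    C(TangentBundle 𝓘(ℝ, E) M, TangentBundle 𝓘(ℝ, E) M) :=
  ⟨tangentMap 𝓘(ℝ, E) 𝓘(ℝ, E) φ, by
    have : IsManifold 𝓘(ℝ, E) 1 M := IsManifold.of_le (n := ∞) (by norm_num)
    exact φ.contMDiff_toFun.continuous_tangentMap (by norm_num)⟩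

/-- The `C¹` topology on the group of diffeomorphisms: the compact-open topology on differentials.
On the isometry group of a compact Riemannian manifold it is the usual topology. -/
@[reducible]
def diffeoTopology : TopologicalSpace (M ≃ₘ⟮𝓘(ℝ, E), 𝓘(ℝ, E)⟯ M) :=
  TopologicalSpace.induced bundleMap inferInstance

/-- The closure of the group generated by the flows of `ξ₁, …, ξₛ`. For commuting Killing fields on a
compact manifold this is a torus in the group of isometries, which is closed in the group of
diffeomorphisms. -/
def closedFlowGroup {s : ℕ} (ξ : Fin s → ∀ x : M, TangentSpace 𝓘(ℝ, E) x) :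
    Set (M ≃ₘ⟮𝓘(ℝ, E), 𝓘(ℝ, E)⟯ M) :=
  closure[diffeoTopology] {φ | FlowGroup ξ φ}

end Flows

section Structures
variable {E : Type*} [NormedAddCommGroup E] [NormedSpace ℝ E]

/-- A smooth vector field on `M`. -/
def SmoothField {M : Type*} [TopologicalSpace M] [ChartedSpace E M] [IsManifold 𝓘(ℝ, E) ∞ M]
    (X : ∀ x : M, TangentSpace 𝓘(ℝ, E) x) : Prop :=
  ContMDiff 𝓘(ℝ, E) 𝓘(ℝ, E).tangent ∞ fun x => (⟨x, X x⟩ : TangentBundle 𝓘(ℝ, E) M)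

/-- An `f`-structure on `M` with a complemented frame `ξ₁, …, ξₛ, η₁, …, ηₛ` and a compatible
Riemannian metric `g`. -/
structure MetricFStructure (E : Type*) [NormedAddCommGroup E] [NormedSpace ℝ E] (s : ℕ)
    (M : Type*) [TopologicalSpace M] [ChartedSpace E M] [IsManifold 𝓘(ℝ, E) ∞ M] where
  /-- the `f`-structure, a `(1,1)` tensor field -/
  f : ∀ x : M, TangentSpace 𝓘(ℝ, E) x →L[ℝ] TangentSpace 𝓘(ℝ, E) x
  f_smooth : ContMDiff 𝓘(ℝ, E) (𝓘(ℝ, E).prod 𝓘(ℝ, E →L[ℝ] E)) ∞ fun x =>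
    (Bundle.TotalSpace.mk' (E →L[ℝ] E) x (f x) : Bundle.TotalSpace (E →L[ℝ] E) fun x : M =>
      TangentSpace 𝓘(ℝ, E) x →L[ℝ] TangentSpace 𝓘(ℝ, E) x)
  f_cube : ∀ (x : M) (v : TangentSpace 𝓘(ℝ, E) x), f x (f x (f x v)) + f x v = 0
  /-- the vector fields of the complemented frame -/
  ξ : Fin s → ∀ x : M, TangentSpace 𝓘(ℝ, E) x
  ξ_smooth : ∀ i, SmoothField (ξ i)
  /-- the one-forms of the complemented frame -/
  η : Fin s → Form E M 1
  η_smooth : ∀ i, (η i).Smooth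
  η_ξ : ∀ i j x, η i x (fun _ => ξ j x) = if i = j then 1 else 0
  f_ξ : ∀ i x, f x (ξ i x) = 0
  η_f : ∀ i (x : M) (v : TangentSpace 𝓘(ℝ, E) x), η i x (fun _ => f x v) = 0
  f_sq : ∀ (x : M) (v : TangentSpace 𝓘(ℝ, E) x),
    f x (f x v) = -v + ∑ k, η k x (fun _ => v) • ξ k x
  /-- the compatible metric -/
  g : Bundle.ContMDiffRiemannianMetric 𝓘(ℝ, E) ∞ E fun x : M => TangentSpace 𝓘(ℝ, E) x
  compatible : ∀ (x : M) (v w : TangentSpace 𝓘(ℝ, E) x),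
    g.inner x v w = g.inner x (f x v) (f x w) + ∑ k, η k x (fun _ => v) * η k x (fun _ => w)

namespace MetricFStructure
variable {M : Type*} [TopologicalSpace M] [ChartedSpace E M] [IsManifold 𝓘(ℝ, E) ∞ M]
  {s : ℕ} (A : MetricFStructure E s M)

theorem inner_f_self (x : M) (v : TangentSpace 𝓘(ℝ, E) x) : A.g.inner x v (A.f x v) = 0 := by
  have hξ : ∀ (w : TangentSpace 𝓘(ℝ, E) x) k, A.g.inner x (A.f x w) (A.ξ k x) = 0 := by
    intro w k
    rw [A.compatible, A.f_ξ]
    simp [A.η_f]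
  have h := A.compatible x v (A.f x v)
  rw [A.f_sq] at h
  simp only [A.η_f, mul_zero, Finset.sum_const_zero, add_zero, map_add, map_neg, map_sum, map_smul,
    hξ, smul_zero] at h
  rw [A.g.symm x (A.f x v) v] at h
  linarith

/-- The fundamental 2-form `F(X, Y) = g(X, f Y)`. -/
def fundamentalForm : Form E M 2 := fun x =>
  let B : E →L[ℝ] E →L[ℝ] ℝ := A.g.inner x
  let φ : E →L[ℝ] E := A.f x
  { toFun := fun v => B (v 0) (φ (v 1))
    map_update_add' := by
      intro _ v i a b
      fin_cases i <;> simp [Function.update]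
    map_update_smul' := by
      intro _ v i c a
      fin_cases i <;> simp [Function.update]
    map_eq_zero_of_eq' := by
      intro v i j hij hne
      have h01 : v 0 = v 1 := by
        fin_cases i <;> fin_cases j <;> simp_all
      have := A.inner_f_self x (v 1)
      change B (v 0) (φ (v 1)) = 0
      rw [h01]
      exact this
    cont := by fun_prop }

/-- `ξ` is a Killing field, `L_ξ g = 0`: for all smooth vector fields `X`, `Y` one has
`ξ (g(X, Y)) = g([ξ, X], Y) + g(X, [ξ, Y])`. -/
def IsKilling (ξ : ∀ x : M, TangentSpace 𝓘(ℝ, E) x) : Prop :=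
  ∀ X Y : ∀ x : M, TangentSpace 𝓘(ℝ, E) x, SmoothField X → SmoothField Y → ∀ x,
    (mfderiv 𝓘(ℝ, E) 𝓘(ℝ, ℝ) (fun y => A.g.inner y (X y) (Y y)) x (ξ x) : ℝ) =
      A.g.inner x (VectorField.mlieBracket 𝓘(ℝ, E) ξ X x) (Y x) +
        A.g.inner x (X x) (VectorField.mlieBracket 𝓘(ℝ, E) ξ Y x)

/-- Almost `K`-structures: `F` is closed and the fields `ξᵢ` are Killing. -/
structure IsAlmostK : Prop where
  closed : A.fundamentalForm.d = 0
  killing : ∀ i, A.IsKilling (A.ξ i)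

/-- Almost `S`-structures: almost `K`-structures with `dηᵢ = F` for all `i`. -/
structure IsAlmostS : Prop extends A.IsAlmostK where
  d_η : ∀ i, (A.η i).d = A.fundamentalForm

/-- The form `α` vanishes as soon as one argument is tangent to the foliation `ker f`, that is,
`i_X α = 0` for all `X` tangent to the leaves. -/
def Horizontal {k : ℕ} (α : Form E M k) : Prop :=
  ∀ (x : M) (v : Fin k → E) (i : Fin k), A.f x (v i) = 0 → α x v = 0

/-- `i_X α = i_X dα = 0` for all `X` tangent to the leaves. -/
def IsBasic {k : ℕ} (α : Form E M k) : Prop :=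
  A.Horizontal α ∧ A.Horizontal α.d

/-- The space of smooth basic `k`-forms. -/
def basicForms (k : ℕ) : Submodule ℝ (Form E M k) where
  carrier := {α | α.Smooth ∧ A.IsBasic α}
  zero_mem' := by
    refine ⟨Form.smooth_zero, fun _ _ _ _ => rfl, fun x v i _ => ?_⟩
    have h : (0 : Form E M k).d = 0 := by
      simpa using Form.d_smul (0 : ℝ) (0 : Form E M k)
    rw [h]
    rfl
  add_mem' := by
    rintro α β ⟨hα, hα1, hα2⟩ ⟨hβ, hβ1, hβ2⟩
    refine ⟨hα.add hβ, fun x v i hv => ?_, fun x v i hv => ?_⟩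
    · simp [hα1 x v i hv, hβ1 x v i hv]
    · simp [Form.d_add hα hβ, hα2 x v i hv, hβ2 x v i hv]
  smul_mem' := by
    rintro c α ⟨hα, hα1, hα2⟩
    refine ⟨hα.smul c, fun x v i hv => ?_, fun x v i hv => ?_⟩
    · simp [hα1 x v i hv]
    · simp [Form.d_smul, hα2 x v i hv]

/-- The exterior derivative on basic forms. -/
def basicD (k : ℕ) : A.basicForms k →ₗ[ℝ] A.basicForms (k + 1) where
  toFun α := ⟨(α : Form E M k).d, α.2.1.d, α.2.2.2, fun x v i _ => by
    rw [Form.d_d α.2.1]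
    rfl⟩
  map_add' α β := Subtype.ext (Form.d_add α.2.1 β.2.1)
  map_smul' c α := Subtype.ext (Form.d_smul c _)

/-- The complex of basic forms; its cohomology is the basic cohomology `H^•(M/F)`. -/
def basicComplex : RealComplex where
  C k := A.basicForms k
  d := A.basicD
  d_d _ α := Subtype.ext (Form.d_d α.2.1)

/-- The space of smooth `k`-forms invariant under the closure of the group generated by the flows
of `ξ₁, …, ξₛ`. -/
def invariantForms (k : ℕ) : Submodule ℝ (Form E M k) where
  carrier := {α | α.Smooth ∧ ∀ φ ∈ closedFlowGroup A.ξ, Form.pullback φ α = α}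
  zero_mem' := ⟨Form.smooth_zero, fun _ _ => rfl⟩
  add_mem' := by
    rintro α β ⟨hα, hα'⟩ ⟨hβ, hβ'⟩
    refine ⟨hα.add hβ, fun φ hφ => ?_⟩
    conv_rhs => rw [← hα' φ hφ, ← hβ' φ hφ]
    rfl
  smul_mem' := by
    rintro c α ⟨hα, hα'⟩
    refine ⟨hα.smul c, fun φ hφ => ?_⟩
    conv_rhs => rw [← hα' φ hφ]
    rfl

/-- The exterior derivative on invariant forms. -/
def invariantD (k : ℕ) : A.invariantForms k →ₗ[ℝ] A.invariantForms (k + 1) where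
  toFun α := ⟨(α : Form E M k).d, α.2.1.d, fun φ hφ => by
    have h := Form.d_pullback φ.contMDiff_toFun α.2.1
    refine Eq.trans h.symm ?_
    exact congrArg Form.d (α.2.2 φ hφ)⟩
  map_add' α β := Subtype.ext (Form.d_add α.2.1 β.2.1)
  map_smul' c α := Subtype.ext (Form.d_smul c _)

/-- The invariant `r`-forms of filtration `k`: the contraction with any `r - k + 1` vectors tangent
to the leaves vanishes. For `k ≤ 0` there are more than `r` such vectors and the condition is void;
for `k > r` the form is zero. -/
def filtration (k : ℤ) (r : ℕ) : Submodule ℝ (A.invariantForms r) where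
  carrier := {α | 0 < k → ∀ (x : M) (v : Fin r → E),
    (∀ i : Fin r, ((i : ℕ) : ℤ) < r - k + 1 → A.f x (v i) = 0) → (α : Form E M r) x v = 0}
  zero_mem' := fun _ _ _ _ => rfl
  add_mem' := by
    intro α β hα hβ hk x v hv
    simp [hα hk x v hv, hβ hk x v hv]
  smul_mem' := by
    intro c α hα hk x v hv
    simp [hα hk x v hv]

/-- The complex of invariant forms with its filtration; its spectral sequence is the spectral
sequence of invariant forms. -/
def invariantComplex : FilteredComplex where
  C k := A.invariantForms k
  d := A.invariantD
  d_d _ α := Subtype.ext (Form.d_d α.2.1)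
  F := A.filtration
  F_succ_le := by
    intro k r α hα hk x v hv
    exact hα (by omega) x v fun i hi => hv i (by omega)

/-- The real vector space `⟨η₁, …, ηₛ⟩` of one-forms. -/
abbrev etaSpan : Submodule ℝ (Form E M 1) := Submodule.span ℝ (Set.range A.η)

/-- `ηᵢ` as an element of `⟨η₁, …, ηₛ⟩`. -/
def eta (i : Fin s) : A.etaSpan := ⟨A.η i, Submodule.subset_span ⟨i, rfl⟩⟩

end MetricFStructure
end Structures
end AlmostK

end

open AlmostK

/-! A form is invariant under the closed flow group exactly when its Lie derivatives along all `ξᵢ`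
vanish (`mem_invariantForms_iff`). On invariant forms Cartan's formula becomes `i_ξ d = -d i_ξ`, and
a smooth form is basic exactly when it is horizontal and invariant (`isBasic_iff`). The forms `η_k`,
whose differentials are horizontal, and the closed horizontal form `F` are invariant. Hence each
bracket `[ξᵢ, ξⱼ]` is annihilated by all `η_k` and by `F`, and it vanishes because `F` is
nondegenerate transversally to the leaves (`localField_bracket`). Contractions with `ξᵢ` and
products with `ηᵢ` therefore preserve invariant forms, and the rest is algebra with these operators
and `d`.

Induction on contractions shows how they act on the filtration. The operator `d` raises the degree
without allowing more vertical arguments, so it maps `F^p` to `F^{p+1}` and `d₀ = 0`. The product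
`ηᵢ ∧` preserves `F^p`, and `dηᵢ ∧` maps `F^p` to `F^{p+2}`. Consequently the cycles and the
boundaries of the second page are stable under contractions and under `ηᵢ ∧`.

Contracting a cycle of bidegree `(p, q)` with `q` of the fields gives a closed basic `p`-form. The
map `pageMap` collects the basic classes of these contractions, each tensored with the matching
product of the `ηᵢ`. It is surjective because it sends `η_I ∧ a` to `[a] ⊗ η_I`
(`exists_cycle_wedgeProd`). Its kernel consists of the boundaries, by induction on `q`
(`pageMap_eq_zero_iff`): the case `q = 0` is basic cohomology (`baseClass_eq_zero_iff`), and in the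
induction step the operator `∑ ηᵢ ∧ i_{ξᵢ}` is multiplication by `q` modulo `F^{p+1}`, so a cycle
whose contractions are boundaries is a boundary (`mem_boundaries_of_contr`).

The analytic input is a flow that depends smoothly on the initial value. It comes from the integral
equation in the Banach space of curves on `[-1, 1]`, solved by a global inverse function theorem,
and compactness of `M` makes the local estimates uniform. -/

/-! ### Smooth dependence of flows on the initial value -/

noncomputable section
namespace SmoothFlow
open scoped NNReal

/-- The Banach space of continuous maps from a compact space to `E`, with the supremum norm. -/
def Curve (K E : Type*) [TopologicalSpace K] [NormedAddCommGroup E] : Type _ :=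
  BoundedContinuousFunction K E

namespace Curve
variable {K : Type*} [TopologicalSpace K] {E : Type*} [NormedAddCommGroup E]

instance : NormedAddCommGroup (Curve K E) :=
  inferInstanceAs (NormedAddCommGroup (BoundedContinuousFunction K E))

instance [NormedSpace ℝ E] : NormedSpace ℝ (Curve K E) :=
  inferInstanceAs (NormedSpace ℝ (BoundedContinuousFunction K E))

instance [CompleteSpace E] : CompleteSpace (Curve K E) :=
  inferInstanceAs (CompleteSpace (BoundedContinuousFunction K E))

instance : FunLike (Curve K E) K E :=
  inferInstanceAs (FunLike (BoundedContinuousFunction K E) K E)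

@[ext] theorem ext {u w : Curve K E} (h : ∀ t, u t = w t) : u = w := DFunLike.ext _ _ h

@[simp] theorem add_apply (u w : Curve K E) (t : K) : (u + w) t = u t + w t := rfl
@[simp] theorem sub_apply (u w : Curve K E) (t : K) : (u - w) t = u t - w t := rfl
@[simp] theorem smul_apply [NormedSpace ℝ E] (c : ℝ) (u : Curve K E) (t : K) :
    (c • u) t = c • u t := rfl

protected theorem continuous (u : Curve K E) : Continuous u :=
  BoundedContinuousFunction.continuous u

theorem norm_coe_le_norm (u : Curve K E) (t : K) : ‖u t‖ ≤ ‖u‖ :=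
  BoundedContinuousFunction.norm_coe_le_norm u t

theorem norm_le {u : Curve K E} {C : ℝ} (hC : 0 ≤ C) : ‖u‖ ≤ C ↔ ∀ t, ‖u t‖ ≤ C :=
  BoundedContinuousFunction.norm_le hC

/-- A continuous map on a compact space as an element of `Curve`. -/
def mk' [CompactSpace K] (u : C(K, E)) : Curve K E := BoundedContinuousFunction.mkOfCompact u

@[simp] theorem mk'_apply [CompactSpace K] (u : C(K, E)) (t : K) : mk' u t = u t := rfl

/-- The constant curve. -/
def const [CompactSpace K] (y : E) : Curve K E := mk' (ContinuousMap.const K y)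

@[simp] theorem const_apply [CompactSpace K] (y : E) (t : K) : const y t = y := rfl

/-- Evaluation at a point. -/
def evalCLM [NormedSpace ℝ E] (t : K) : Curve K E →L[ℝ] E :=
  LinearMap.mkContinuous
    { toFun := fun u => u t
      map_add' := fun _ _ => rfl
      map_smul' := fun _ _ => rfl } 1 fun u => by
    rw [one_mul]
    exact u.norm_coe_le_norm t

end Curve

/-! ### Smoothness of superposition operators on spaces of curves. -/

section Nemytskii
universe u
variable {K : Type*} [TopologicalSpace K] [CompactSpace K]
  {E F : Type u} [NormedAddCommGroup E] [NormedSpace ℝ E] [NormedAddCommGroup F] [NormedSpace ℝ F]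

/-- Pointwise application of continuous families of linear maps. -/
def pointwiseApply : Curve K (E →L[ℝ] F) →L[ℝ] Curve K E →L[ℝ] Curve K F :=
  LinearMap.mkContinuous₂
    (LinearMap.mk₂ ℝ (fun (A : Curve K (E →L[ℝ] F)) (h : Curve K E) =>
        Curve.mk' ⟨fun t => A t (h t), A.continuous.clm_apply h.continuous⟩)
      (fun _ _ _ => by ext; simp) (fun _ _ _ => by ext; simp)
      (fun _ _ _ => by ext; simp) (fun _ _ _ => by ext; simp)) 1
    (fun A h => by
      rw [Curve.norm_le (by positivity)]
      intro t
      refine ((A t).le_opNorm (h t)).trans ?_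
      rw [one_mul]
      exact mul_le_mul (A.norm_coe_le_norm t) (h.norm_coe_le_norm t) (norm_nonneg _)
        (norm_nonneg A))

@[simp] theorem pointwiseApply_apply (A : Curve K (E →L[ℝ] F)) (h : Curve K E) (t : K) :
    pointwiseApply A h t = A t (h t) := rfl

theorem contDiff_pointwiseApply {n : WithTop ℕ∞} : ContDiff ℝ n
    (fun A : Curve K (E →L[ℝ] F) => (pointwiseApply A : Curve K E →L[ℝ] Curve K F)) :=
  ContinuousLinearMap.contDiff (pointwiseApply (K := K) (E := E) (F := F))

/-- The superposition operator `u ↦ v ∘ u`. -/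
def superposition {v : E → F} (hv : Continuous v) (u : Curve K E) : Curve K F :=
  Curve.mk' ⟨fun t => v (u t), hv.comp u.continuous⟩

omit [NormedSpace ℝ E] [NormedSpace ℝ F] in
@[simp] theorem superposition_apply {v : E → F} (hv : Continuous v) (u : Curve K E) (t : K) :
    superposition hv u t = v (u t) := rfl

omit [NormedSpace ℝ E] [NormedSpace ℝ F] in
theorem lipschitzWith_superposition {v : E → F} (hv : Continuous v) {L : ℝ≥0}
    (hL : LipschitzWith L v) : LipschitzWith L (superposition (K := K) hv) := by
  refine LipschitzWith.of_dist_le_mul fun u w => ?_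
  rw [dist_eq_norm, dist_eq_norm, Curve.norm_le (by positivity)]
  intro t
  have := hL.dist_le_mul (u t) (w t)
  rw [dist_eq_norm, dist_eq_norm] at this
  refine this.trans ?_
  gcongr
  exact (u - w).norm_coe_le_norm t

/-- Mean value inequality for `v - fderiv ℝ v x` on the ball of radius `‖h‖` about `x`, where the
derivative of this difference is at most `L * ‖h‖`. -/
theorem norm_sub_sub_fderiv_le {v : E → F} {L : ℝ≥0} (hv : Differentiable ℝ v)
    (hL : LipschitzWith L (fderiv ℝ v)) (x h : E) :
    ‖v (x + h) - v x - fderiv ℝ v x h‖ ≤ L * ‖h‖ * ‖h‖ := by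
  have := Convex.norm_image_sub_le_of_norm_hasFDerivWithin_le (𝕜 := ℝ)
    (f := fun y => v y - fderiv ℝ v x y)
    (f' := fun y => fderiv ℝ v y - fderiv ℝ v x) (s := Metric.closedBall x ‖h‖) (C := L * ‖h‖)
    (x := x) (y := x + h)
    (fun y _ => ((hv y).hasFDerivAt.sub (fderiv ℝ v x).hasFDerivAt).hasFDerivWithinAt)
    (fun y hy => by
      rw [← dist_eq_norm]
      refine (hL.dist_le_mul y x).trans ?_
      gcongr
      exact hy) (convex_closedBall _ _) (by simp) (by simp)
  rw [map_add, add_sub_cancel_left] at this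
  calc _ = _ := congrArg norm (by abel)
    _ ≤ _ := this

/-- The derivative of the superposition operator `u ↦ v ∘ u`. -/
theorem hasFDerivAt_superposition {v : E → F} (hv : ContDiff ℝ ∞ v) (hc : HasCompactSupport v)
    (u : Curve K E) :
    HasFDerivAt (fun u : Curve K E => superposition hv.continuous u)
      (pointwiseApply
        (superposition (hv.continuous_fderiv (by norm_num)) u)) u := by
  have hv' : ContDiff ℝ ∞ (fderiv ℝ v) := hv.fderiv_right (by simp)
  obtain ⟨L, hL⟩ := ContDiff.lipschitzWith_of_hasCompactSupport (hc.fderiv ℝ) hv' (by norm_num)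
  refine .of_isLittleO ?_
  have hO : (fun u' : Curve K E => superposition hv.continuous u' -
      superposition hv.continuous u - pointwiseApply
        (superposition (hv.continuous_fderiv (by norm_num)) u) (u' - u))
      =O[𝓝 u] fun u' => ‖u' - u‖ * ‖u' - u‖ := by
    -- The quadratic bound holds at each time with the same `L`, hence in the supremum norm.
    refine Asymptotics.IsBigO.of_bound L (Eventually.of_forall fun u' => ?_)
    rw [Curve.norm_le (by positivity)]
    intro t
    have := norm_sub_sub_fderiv_le (hv.differentiable (by norm_num)) hL (u t) ((u' - u) t)
    have h1 : u t + (u' - u) t = u' t := by simp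
    rw [h1] at this
    refine le_trans this ?_
    have := (u' - u).norm_coe_le_norm t
    rw [mul_assoc, norm_mul, norm_norm]
    gcongr
  refine hO.trans_isLittleO ?_
  have : (fun u' : Curve K E => ‖u' - u‖ * ‖u' - u‖) =o[𝓝 u] fun u' => 1 * ‖u' - u‖ := by
    refine Asymptotics.IsLittleO.mul_isBigO ?_ (Asymptotics.isBigO_refl _ _)
    rw [Asymptotics.isLittleO_one_iff]
    have : Continuous fun u' : Curve K E => ‖u' - u‖ := by fun_prop
    simpa using this.tendsto u
  simpa using this

/-- The derivative is pointwise multiplication by the superposition operator of `fderiv ℝ v`, which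
is again smooth with compact support. The induction therefore varies the target `F`; since `E` and
`F` share a universe, `E →L[ℝ] F` is an admissible target. -/
theorem contDiff_superposition_nat (n : ℕ) : ∀ {F : Type u} [NormedAddCommGroup F]
    [NormedSpace ℝ F] {v : E → F} (hv : ContDiff ℝ ∞ v) (_ : HasCompactSupport v),
    ContDiff ℝ n (fun u : Curve K E => superposition hv.continuous u) := by
  induction n with
  | zero =>
    intro F _ _ v hv hc
    obtain ⟨L, hL⟩ := ContDiff.lipschitzWith_of_hasCompactSupport hc hv (by norm_num)
    exact contDiff_zero.2 (lipschitzWith_superposition hv.continuous hL).continuous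
  | succ n ih =>
    intro F _ _ v hv hc
    rw [Nat.cast_succ, contDiff_succ_iff_hasFDerivAt]
    exact ⟨fun u => pointwiseApply
        (superposition (hv.continuous_fderiv (by norm_num)) u),
      contDiff_pointwiseApply.comp (ih (hv.fderiv_right (by simp)) (hc.fderiv ℝ)),
      fun u => hasFDerivAt_superposition hv hc u⟩

/-- The superposition operator `u ↦ v ∘ u` on continuous functions is smooth. -/
theorem contDiff_superposition {v : E → F} (hv : ContDiff ℝ ∞ v) (hc : HasCompactSupport v) :
    ContDiff ℝ ∞ (fun u : Curve K E => superposition hv.continuous u) :=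
  contDiff_infty.2 fun n => contDiff_superposition_nat n hv hc

end Nemytskii

/-! ### The integral form of a differential equation. -/

section Integral
variable {E : Type*} [NormedAddCommGroup E] [NormedSpace ℝ E]

/-- The time interval `[-1, 1]`. -/
abbrev Time : Type := Icc (-1 : ℝ) 1

/-- Continuous extension of a curve on `[-1, 1]` to the real line. -/
def extend (u : Curve Time E) (t : ℝ) : E := u (projIcc (-1) 1 (by norm_num) t)

omit [NormedSpace ℝ E] in
theorem continuous_extend (u : Curve Time E) : Continuous (extend u) :=
  u.continuous.comp continuous_projIcc

omit [NormedSpace ℝ E] in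
theorem extend_coe (u : Curve Time E) (t : Time) : extend u t = u t := by
  simp [extend]

/-- The integral operator `u ↦ ∫₀ᵗ u`. -/
def integral : Curve Time E →L[ℝ] Curve Time E :=
  LinearMap.mkContinuous
    { toFun := fun u => Curve.mk' ⟨fun t => ∫ τ in (0 : ℝ)..t, extend u τ,
        (intervalIntegral.continuous_primitive
          (fun a b => (continuous_extend u).intervalIntegrable a b) 0).comp continuous_subtype_val⟩
      map_add' := fun u w => by
        ext t
        exact intervalIntegral.integral_add ((continuous_extend u).intervalIntegrable _ _)
          ((continuous_extend w).intervalIntegrable _ _)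
      map_smul' := fun c u => by
        ext t
        exact intervalIntegral.integral_smul c _ } 1
    (fun u => by
      rw [Curve.norm_le (by positivity)]
      intro t
      have h := intervalIntegral.norm_integral_le_of_norm_le_const (a := 0) (b := (t : ℝ))
        (f := extend u) (C := ‖u‖) (fun τ _ => u.norm_coe_le_norm _)
      have ht : |(t : ℝ) - 0| ≤ 1 := by rw [sub_zero, abs_le]; exact t.2
      refine h.trans ?_
      rw [one_mul]
      exact mul_le_of_le_one_right (norm_nonneg _) ht)

theorem integral_apply (u : Curve Time E) (t : Time) :
    integral u t = ∫ τ in (0 : ℝ)..t, extend u τ := rfl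

theorem norm_integral_le : ‖(integral : Curve Time E →L[ℝ] Curve Time E)‖ ≤ 1 :=
  LinearMap.mkContinuous_norm_le _ zero_le_one _

variable [CompleteSpace E]

/-- The integrand `w` is left free so that the lemma serves twice: `w = v ∘ u` gives the flow
equation, and the linearized integrand gives the variational equation. -/
theorem hasDerivAt_extend {u w : Curve Time E} {y : E}
    (h : u - integral w = Curve.const y) {t : ℝ} (ht : t ∈ Ioo (-1 : ℝ) 1) :
    HasDerivAt (extend u) (extend w t) t := by
  have h1 : HasDerivAt (fun t : ℝ => y + ∫ τ in (0 : ℝ)..t, extend w τ) (extend w t) t :=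
    ((continuous_extend w).integral_hasStrictDerivAt 0 t).hasDerivAt.const_add y
  refine h1.congr_of_eventuallyEq ?_
  filter_upwards [isOpen_Ioo.mem_nhds ht] with s hs
  have hs' : s ∈ Icc (-1 : ℝ) 1 := ⟨hs.1.le, hs.2.le⟩
  have := congrArg (fun f : Curve Time E => f ⟨s, hs'⟩) h
  simp only [Curve.sub_apply, Curve.const_apply, integral_apply] at this
  rw [show extend u s = u ⟨s, hs'⟩ from extend_coe u ⟨s, hs'⟩, ← this]
  simp

omit [CompleteSpace E] in
theorem extend_zero_of_eq {u w : Curve Time E} {y : E}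
    (h : u - integral w = Curve.const y) : extend u 0 = y := by
  have hs' : (0 : ℝ) ∈ Icc (-1 : ℝ) 1 := by constructor <;> norm_num
  have := congrArg (fun f : Curve Time E => f ⟨0, hs'⟩) h
  simp only [Curve.sub_apply, Curve.const_apply, integral_apply] at this
  rw [show extend u 0 = u ⟨0, hs'⟩ from extend_coe u ⟨0, hs'⟩, ← this]
  simp

end Integral

/-! ### Flows on a Banach space by inversion of the integral equation. -/

section Flow
variable {E : Type*} [NormedAddCommGroup E] [NormedSpace ℝ E] [CompleteSpace E]

/-- The map `id - P` approximates the identity with constant `1/2`, which makes it a homeomorphism.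
Its derivative `1 - P' u` is invertible because `‖P' u‖ ≤ 1/2`, so the inverse is smooth. -/
theorem exists_homeomorph_sub {C : Type*} [NormedAddCommGroup C] [NormedSpace ℝ C]
    [CompleteSpace C] {P : C → C} {P' : C → C →L[ℝ] C} (hP : ContDiff ℝ ∞ P)
    (hP' : ∀ u, HasFDerivAt P (P' u) u) (hL : LipschitzWith (1 / 2) P) :
    ∃ H : C ≃ₜ C, (∀ u, H u = u - P u) ∧ ContDiff ℝ ∞ H.symm := by
  have happ : ApproximatesLinearOn (fun u => u - P u)
      ((ContinuousLinearEquiv.refl ℝ C : C ≃L[ℝ] C) : C →L[ℝ] C) univ (1 / 2) := by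
    refine LipschitzOnWith.approximatesLinearOn (LipschitzOnWith.of_dist_le_mul fun u _ w _ => ?_)
    have := hL.dist_le_mul u w
    rw [dist_eq_norm] at this ⊢
    refine le_trans (le_of_eq ?_) this
    rw [← norm_neg]
    congr 1
    simp
    abel
  have hcond : Subsingleton C ∨ (1 / 2 : ℝ≥0) <
      ‖((ContinuousLinearEquiv.refl ℝ C).symm : C →L[ℝ] C)‖₊⁻¹ := by
    rcases subsingleton_or_nontrivial C with h | h
    · exact Or.inl h
    · right
      have : ‖((ContinuousLinearEquiv.refl ℝ C).symm : C →L[ℝ] C)‖₊ = 1 := by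
        change ‖ContinuousLinearMap.id ℝ C‖₊ = 1
        exact ContinuousLinearMap.nnnorm_id
      rw [this, inv_one]
      exact NNReal.half_lt_self one_ne_zero
  have hn : ∀ u, ‖P' u‖ < 1 := fun u =>
    lt_of_le_of_lt ((hP' u).le_of_lipschitz hL) (by norm_num)
  refine ⟨happ.toHomeomorph _ hcond, fun _ => rfl, ?_⟩
  exact Homeomorph.contDiff_symm _ (f₀' := fun u => ContinuousLinearEquiv.unitsEquiv ℝ C
      (Units.oneSub (P' u) (hn u))) (fun u => (hasFDerivAt_id u).sub (hP' u)) (contDiff_id.sub hP)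

/-- An integral curve from `y` solves `u - ∫₀ᵗ v(u) = y`. Integration over `[-1, 1]` from `0` has
norm at most `1`, so the left side is the identity minus a `1/2`-contraction; `θ t y` is the value
at `t` of the solution, which depends smoothly on `y`. -/
theorem exists_flow_of_lipschitz {v : E → E} (hv : ContDiff ℝ ∞ v) (hc : HasCompactSupport v)
    (hL : LipschitzWith (1 / 2) v) :
    ∃ θ : ℝ → E → E, (∀ t, ContDiff ℝ ∞ (θ t)) ∧ (∀ y, θ 0 y = y) ∧
      ∀ t ∈ Ioo (-1 : ℝ) 1, ∀ y, HasDerivAt (fun t => θ t y) (v (θ t y)) t ∧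
        ∀ w, HasDerivAt (fun t => fderiv ℝ (θ t) y w)
          (fderiv ℝ v (θ t y) (fderiv ℝ (θ t) y w)) t := by
  set N : Curve Time E → Curve Time E := fun u => superposition hv.continuous u with hN
  have hNs : ContDiff ℝ ∞ N := contDiff_superposition hv hc
  set DN : Curve Time E → (Curve Time E →L[ℝ] Curve Time E) := fun u => pointwiseApply
        (superposition (hv.continuous_fderiv (by norm_num)) u) with hDN
  have hDNd : ∀ u, HasFDerivAt N (DN u) u := fun u => hasFDerivAt_superposition hv hc u
  have hPL : LipschitzWith (1 / 2) (fun u => integral (N u)) := by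
    refine LipschitzWith.of_dist_le_mul fun u w => ?_
    rw [dist_eq_norm, dist_eq_norm, ← map_sub]
    have hint : ‖integral (N u - N w)‖ ≤ ‖N u - N w‖ := by
      simpa using integral.le_of_opNorm_le norm_integral_le (N u - N w)
    refine hint.trans ?_
    rw [← dist_eq_norm, ← dist_eq_norm]
    exact (lipschitzWith_superposition hv.continuous hL).dist_le_mul u w
  have hPd : ∀ u, HasFDerivAt (fun u => integral (N u)) (integral ∘L DN u) u := fun u =>
    integral.hasFDerivAt.comp u (hDNd u)
  obtain ⟨H, hHΨ, hsymm⟩ := exists_homeomorph_sub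
    (P := fun u => integral (N u)) (integral.contDiff.comp hNs) hPd hPL
  set U : E → Curve Time E := fun y => H.symm (Curve.const y) with hU
  have hconst : ContDiff ℝ ∞ (fun y : E => (Curve.const (K := Time) y)) := by
    refine ContinuousLinearMap.contDiff (LinearMap.mkContinuous
      { toFun := fun y : E => Curve.const (K := Time) y
        map_add' := fun _ _ => rfl
        map_smul' := fun _ _ => rfl } 1 fun y => ?_)
    rw [Curve.norm_le (by positivity)]
    intro t
    rw [one_mul]
    exact le_rfl
  have hUs : ContDiff ℝ ∞ U := hsymm.comp hconst
  have hUeq : ∀ y, U y - integral (N (U y)) = Curve.const y := fun y => by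
    rw [← hHΨ]
    exact H.apply_symm_apply _
  -- Differentiating the integral equation in `y` gives the integral form of the variational
  -- equation.
  have hUd : ∀ y w, fderiv ℝ U y w - integral (DN (U y) (fderiv ℝ U y w)) =
      Curve.const w := by
    intro y w
    have hU' := (hUs.differentiable (by norm_num) y).hasFDerivAt
    have h1 : HasFDerivAt (fun y => U y - integral (N (U y)))
      (fderiv ℝ U y - (integral ∘L DN (U y)) ∘L fderiv ℝ U y) y :=
      hU'.sub ((hPd (U y)).comp y hU')
    have h2 : HasFDerivAt (fun y => U y - integral (N (U y))) (fderiv ℝ (fun y : E =>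
        (Curve.const (K := Time) y)) y) y := by
      rw [show (fun y => U y - integral (N (U y))) = (fun y : E => (Curve.const (K := Time) y)) from funext hUeq]
      exact (hconst.differentiable (by norm_num) y).hasFDerivAt
    have h3 : fderiv ℝ (fun y : E => (Curve.const (K := Time) y)) y w =
        Curve.const w := by
      ext t
      have h4 : HasFDerivAt (fun y : E => (Curve.const (K := Time) y) t)
          ((Curve.evalCLM t) ∘L fderiv ℝ (fun y : E => (Curve.const (K := Time) y)) y) y :=
        (Curve.evalCLM t).hasFDerivAt.comp y
          (hconst.differentiable (by norm_num) y).hasFDerivAt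
      have h5 : HasFDerivAt (fun y : E => (Curve.const (K := Time) y) t)
        (ContinuousLinearMap.id ℝ E) y := hasFDerivAt_id y
      exact congrArg (fun A : E →L[ℝ] E => A w) (h4.unique h5)
    rw [← h3, ← h1.unique h2]
    rfl
  have hθd : ∀ (t : ℝ) y w, fderiv ℝ (fun y => extend (U y) t) y w =
      extend (fderiv ℝ U y w) t := by
    intro t y w
    have h4 : HasFDerivAt (fun y : E => extend (U y) t)
          ((Curve.evalCLM (projIcc (-1 : ℝ) 1 (by norm_num) t)) ∘L fderiv ℝ U y) y :=
      (Curve.evalCLM _).hasFDerivAt.comp y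
          (hUs.differentiable (by norm_num) y).hasFDerivAt
    rw [h4.fderiv]
    rfl
  refine ⟨fun t y => extend (U y) t, fun t => ?_, fun y => extend_zero_of_eq (hUeq y),
    fun t ht y => ⟨hasDerivAt_extend (hUeq y) ht, fun w => ?_⟩⟩
  · exact (Curve.evalCLM (projIcc (-1 : ℝ) 1 (by norm_num) t)).contDiff.comp hUs
  · simp only [hθd]
    exact hasDerivAt_extend (hUd y w) ht

/-- A compactly supported smooth vector field on a Banach space has a flow for small times, which
is smooth in the initial value and whose derivative solves the variational equation. -/
theorem exists_flow {v : E → E} (hv : ContDiff ℝ ∞ v) (hc : HasCompactSupport v) :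
    ∃ ε > 0, ∃ θ : ℝ → E → E, (∀ t, ContDiff ℝ ∞ (θ t)) ∧ (∀ y, θ 0 y = y) ∧
      ∀ t ∈ Ioo (-ε) ε, ∀ y, HasDerivAt (fun t => θ t y) (v (θ t y)) t ∧
        ∀ w, HasDerivAt (fun t => fderiv ℝ (θ t) y w)
          (fderiv ℝ v (θ t y) (fderiv ℝ (θ t) y w)) t := by
  obtain ⟨L, hL⟩ := ContDiff.lipschitzWith_of_hasCompactSupport hc hv (by norm_num)
  -- The field `ε v` has Lipschitz constant `L / (2 (L + 1)) ≤ 1/2`, and its flow at time `t / ε` is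
  -- that of `v` at time `t`. Using `L + 1` covers the case `L = 0`.
  set ε : ℝ≥0 := (2 * (L + 1))⁻¹ with hε
  have hε0 : 0 < ε := by positivity
  obtain ⟨θ, h1, h2, h3⟩ := exists_flow_of_lipschitz (v := (ε : ℝ) • v) (hv.const_smul (ε : ℝ))
    hc.smul_left (by
      have := (lipschitzWith_smul (ε : ℝ)).comp hL
      refine this.weaken ?_
      rw [show ‖(ε : ℝ)‖₊ = ε from NNReal.nnnorm_eq ε]
      rw [hε, inv_mul_le_iff₀ (by positivity)]
      calc L ≤ L + 1 := by simp
        _ = 2 * (L + 1) * (1 / 2) := by field_simp)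
  have hd : ∀ x, fderiv ℝ ((ε : ℝ) • v) x = (ε : ℝ) • fderiv ℝ v x := fun x =>
    fderiv_const_smul (hv.differentiable (by norm_num) x) _
  have hε0' : (0 : ℝ) < ε := hε0
  have hsc : ∀ t : ℝ, HasDerivAt (fun t : ℝ => t / ε) (1 / (ε : ℝ)) t := fun t =>
    (hasDerivAt_id t).div_const _
  have hcomp : ∀ {f : ℝ → E} {f' : E} {t : ℝ}, HasDerivAt f ((ε : ℝ) • f') (t / ε) →
      HasDerivAt (fun t => f (t / ε)) f' t := by
    intro f f' t hf
    have := HasDerivAt.scomp t hf (hsc t)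
    rwa [smul_smul, one_div, inv_mul_cancel₀ hε0'.ne', one_smul] at this
  refine ⟨ε, hε0, fun t => θ (t / ε), fun t => h1 _, fun y => by simp [h2], fun t ht y => ?_⟩
  have ht' : t / ε ∈ Ioo (-1 : ℝ) 1 := by
    constructor
    · rw [lt_div_iff₀ hε0']; linarith [ht.1]
    · rw [div_lt_iff₀ hε0']; linarith [ht.2]
  obtain ⟨h4, h5⟩ := h3 _ ht' y
  refine ⟨hcomp h4, fun w => hcomp (f := fun t => fderiv ℝ (θ t) y w) ?_⟩
  have := h5 w
  rwa [hd] at this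

end Flow
end SmoothFlow
end

/-! ### Lie derivatives of forms on a normed space -/

noncomputable section
set_option maxSynthPendingDepth 3
namespace FormCalculus
variable {E : Type*} [NormedAddCommGroup E] [NormedSpace ℝ E]

/-- The Lie derivative `L_v α` of a form on a normed space. -/
def lieDeriv {k : ℕ} (v : E → E) (α : E → E [⋀^Fin k]→L[ℝ] ℝ) (y : E) (u : Fin k → E) : ℝ :=
  fderiv ℝ α y (v y) u + ∑ i, α y (Function.update u i (fderiv ℝ v y (u i)))

/-- The interior product `i_v α`. -/
def interior {k : ℕ} (v : E → E) (α : E → E [⋀^Fin (k + 1)]→L[ℝ] ℝ) : E → E [⋀^Fin k]→L[ℝ] ℝ :=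
  fun y => (α y).curryLeft (v y)

theorem interior_apply {k : ℕ} (v : E → E) (α : E → E [⋀^Fin (k + 1)]→L[ℝ] ℝ) (y : E)
    (u : Fin k → E) : interior v α y u = α y (Fin.cons (v y) u) := rfl

theorem lieDeriv_congr {k : ℕ} {v v' : E → E} {α α' : E → E [⋀^Fin k]→L[ℝ] ℝ} {y : E}
    (hv : v =ᶠ[𝓝 y] v') (hα : α =ᶠ[𝓝 y] α') (u : Fin k → E) :
    lieDeriv v α y u = lieDeriv v' α' y u := by
  simp only [lieDeriv, hv.fderiv_eq, hα.fderiv_eq, hv.eq_of_nhds, hα.eq_of_nhds]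

theorem lieDeriv_sum_smul {k s : ℕ} {v : Fin s → E → E} (c : Fin s → ℝ)
    (α : E → E [⋀^Fin k]→L[ℝ] ℝ) {y : E} (hv : ∀ j, DifferentiableAt ℝ (v j) y) (u : Fin k → E) :
    lieDeriv (fun y => ∑ j, c j • v j y) α y u = ∑ j, c j * lieDeriv (v j) α y u := by
  have hd : fderiv ℝ (fun y => ∑ j, c j • v j y) y = ∑ j, c j • fderiv ℝ (v j) y := by
    rw [fderiv_fun_sum (A := fun j y => c j • v j y) fun j _ => (hv j).const_smul (c j)]
    exact Finset.sum_congr rfl fun j _ => fderiv_fun_const_smul (hv j) _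
  have hu : ∀ (i : Fin k) (f : Fin s → E), α y (Function.update u i (∑ j, c j • f j)) =
      ∑ j, c j * α y (Function.update u i (f j)) := by
    intro i f
    have h1 : α y (Function.update u i (∑ j, c j • f j)) =
        (α y).toContinuousMultilinearMap.toContinuousLinearMap u i (∑ j, c j • f j) := rfl
    rw [h1, map_sum]
    refine Finset.sum_congr rfl fun j _ => ?_
    rw [map_smul]
    rfl
  simp only [lieDeriv, hd, _root_.sum_apply, _root_.smul_apply, hu,
    map_sum, map_smul, mul_add, Finset.sum_add_distrib, Finset.mul_sum]
  rw [Finset.sum_comm]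
  congr 1
  simp

/-- The derivative of a form along solutions of the variational equation. -/
theorem hasDerivAt_apply {k : ℕ} {v : E → E} {α : E → E [⋀^Fin k]→L[ℝ] ℝ} {c : ℝ → E}
    {W : Fin k → ℝ → E} {t : ℝ} (hα : DifferentiableAt ℝ α (c t)) (hc : HasDerivAt c (v (c t)) t)
    (hW : ∀ i, HasDerivAt (W i) (fderiv ℝ v (c t) (W i t)) t) :
    HasDerivAt (fun t => α (c t) fun i => W i t) (lieDeriv v α (c t) fun i => W i t) t := by
  have h1 : HasFDerivAt (fun t => (α (c t)).toContinuousMultilinearMap) _ t :=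
    ((ContinuousAlternatingMap.toContinuousMultilinearMapCLM (𝕜 := ℝ) (E := E) (F := ℝ)
      (ι := Fin k) ℝ).hasFDerivAt.comp (c t) hα.hasFDerivAt).comp t hc.hasFDerivAt
  have h2 := (h1.continuousMultilinearMap_apply fun i => (hW i).hasFDerivAt).hasDerivAt
  refine HasDerivAt.congr_deriv (f := fun t => α (c t) fun i => W i t) h2 ?_
  simp [lieDeriv]

omit [NormedAddCommGroup E] [NormedSpace ℝ E] in
theorem update_eq_insertNth {k : ℕ} (u : Fin (k + 1) → E) (i : Fin (k + 1)) (x : E) :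
    Function.update u i x = i.insertNth x (i.removeNth u) :=
  (Fin.insertNth_removeNth i x u).symm

theorem extDeriv_eq_sum {k : ℕ} (α : E → E [⋀^Fin k]→L[ℝ] ℝ) (y : E) (u : Fin (k + 1) → E) :
    extDeriv α y u = ∑ i : Fin (k + 1), (-1 : ℝ) ^ (i : ℕ) *
      fderiv ℝ α y (u i) (i.removeNth u) := by
  simp [extDeriv, ContinuousAlternatingMap.alternatizeUncurryFin_apply]

theorem extDeriv_cons {k : ℕ} {α : E → E [⋀^Fin k]→L[ℝ] ℝ} {y : E}
    (x : E) (u : Fin k → E) :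
    extDeriv α y (Fin.cons x u : Fin (k + 1) → E) = fderiv ℝ α y x u +
      ∑ i : Fin k, (-1 : ℝ) ^ ((i : ℕ) + 1) *
        fderiv ℝ α y (u i) (i.succ.removeNth (Fin.cons x u : Fin (k + 1) → E)) := by
  simp only [extDeriv_eq_sum, Fin.sum_univ_succ]
  have h0 : (0 : Fin (k + 1)).removeNth (Fin.cons x u : Fin (k + 1) → E) = u := by
    simp
  rw [h0]
  simp

/-- Cartan's formula in degree `0`, where the term `d i_v` is absent. -/
theorem extDeriv_cons_eq_lieDeriv (v : E → E) {α : E → E [⋀^Fin 0]→L[ℝ] ℝ} {y : E}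
    (u : Fin 0 → E) :
    extDeriv α y (Fin.cons (v y) u : Fin 1 → E) = lieDeriv v α y u := by
  rw [extDeriv_cons]
  simp [lieDeriv]

section CurryLeft
variable {F : Type*} [NormedAddCommGroup F] [NormedSpace ℝ F]

theorem contDiffOn_curryLeft {k : ℕ} {n : WithTop ℕ∞} {v : E → E}
    {α : E → E [⋀^Fin (k + 1)]→L[ℝ] F} {U : Set E} (hα : ContDiffOn ℝ n α U)
    (hv : ContDiffOn ℝ n v U) : ContDiffOn ℝ n (fun y => (α y).curryLeft (v y)) U :=
  ((ContinuousAlternatingMap.curryLeftLI (𝕜 := ℝ) (E := E) (F := F)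
    (n := k)).contDiff.comp_contDiffOn hα).clm_apply hv

theorem differentiableAt_curryLeft {k : ℕ} {v : E → E} {α : E → E [⋀^Fin (k + 1)]→L[ℝ] F} {y : E}
    (hα : DifferentiableAt ℝ α y) (hv : DifferentiableAt ℝ v y) :
    DifferentiableAt ℝ (fun y => (α y).curryLeft (v y)) y ∧
      ∀ w u, fderiv ℝ (fun y => (α y).curryLeft (v y)) y w u =
      fderiv ℝ α y w (Fin.cons (v y) u) + α y (Fin.cons (fderiv ℝ v y w) u) := by
  have h1 := ((ContinuousAlternatingMap.curryLeftLI (𝕜 := ℝ) (E := E) (F := F)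
      (n := k)).toContinuousLinearMap.hasFDerivAt.comp y hα.hasFDerivAt).clm_apply hv.hasFDerivAt
  refine ⟨h1.differentiableAt, fun w u => ?_⟩
  have h2 : fderiv ℝ (fun y => (α y).curryLeft (v y)) y = _ := h1.fderiv
  rw [h2]
  simp [Matrix.vecCons, add_comm]

end CurryLeft

theorem hasFDerivAt_interior {k : ℕ} {v : E → E} {α : E → E [⋀^Fin (k + 1)]→L[ℝ] ℝ} {y : E}
    (hα : DifferentiableAt ℝ α y) (hv : DifferentiableAt ℝ v y) :
    DifferentiableAt ℝ (interior v α) y ∧ ∀ w u, fderiv ℝ (interior v α) y w u =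
      fderiv ℝ α y w (Fin.cons (v y) u) + α y (Fin.cons (fderiv ℝ v y w) u) :=
  differentiableAt_curryLeft hα hv

theorem contDiffOn_interior {k : ℕ} {n : WithTop ℕ∞} {v : E → E}
    {α : E → E [⋀^Fin (k + 1)]→L[ℝ] ℝ} {U : Set E} (hα : ContDiffOn ℝ n α U)
    (hv : ContDiffOn ℝ n v U) : ContDiffOn ℝ n (interior v α) U :=
  contDiffOn_curryLeft hα hv

/-- Cartan's formula `L_v = i_v d + d i_v` in positive degrees. -/
theorem extDeriv_cons_add_extDeriv_interior {k : ℕ} {v : E → E}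
    {α : E → E [⋀^Fin (k + 1)]→L[ℝ] ℝ} {y : E} (hα : DifferentiableAt ℝ α y)
    (hv : DifferentiableAt ℝ v y) (u : Fin (k + 1) → E) :
    extDeriv α y (Fin.cons (v y) u : Fin (k + 2) → E) + extDeriv (interior v α) y u =
      lieDeriv v α y u := by
  rw [extDeriv_cons]
  simp only [extDeriv_eq_sum, (hasFDerivAt_interior hα hv).2, lieDeriv, mul_add, Finset.sum_add_distrib]
  have h1 : ∀ i : Fin (k + 1), i.succ.removeNth (Fin.cons (v y) u : Fin (k + 2) → E) =
      (Fin.cons (v y) (i.removeNth u) : Fin (k + 1) → E) := by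
    intro i
    funext j
    refine Fin.cases ?_ (fun j => ?_) j <;> simp [Fin.removeNth]
  -- Moving slot `i` to the front costs `(-1) ^ i`. This matches the sum in the Lie derivative with
  -- the terms of `d i_v α` in which `v` is differentiated.
  have h2 : ∀ i : Fin (k + 1), α y (Function.update u i (fderiv ℝ v y (u i))) =
      (-1 : ℝ) ^ (i : ℕ) * α y (Fin.cons (fderiv ℝ v y (u i)) (i.removeNth u)) := by
    intro i
    rw [update_eq_insertNth, ContinuousAlternatingMap.map_insertNth]
    simp [Matrix.vecCons]
  simp only [h1, h2]
  -- The terms that differentiate `α` along an argument occur in `i_v d` and in `d i_v` with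
  -- opposite signs.
  have h3 : ∑ i : Fin (k + 1), (-1 : ℝ) ^ ((i : ℕ) + 1) *
      fderiv ℝ α y (u i) (Fin.cons (v y) (i.removeNth u) : Fin (k + 1) → E) +
      ∑ i : Fin (k + 1), (-1 : ℝ) ^ (i : ℕ) *
        fderiv ℝ α y (u i) (Fin.cons (v y) (i.removeNth u) : Fin (k + 1) → E) = 0 := by
    rw [← Finset.sum_add_distrib]
    refine Finset.sum_eq_zero fun i _ => ?_
    rw [pow_succ]
    ring
  linarith

/-- The commutator of a Lie derivative and an interior product. -/
theorem lieDeriv_interior {k : ℕ} {v w : E → E} {α : E → E [⋀^Fin (k + 1)]→L[ℝ] ℝ} {y : E}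
    (hα : DifferentiableAt ℝ α y) (hw : DifferentiableAt ℝ w y) (u : Fin k → E) :
    lieDeriv v (interior w α) y u =
      α y (Fin.cons (fderiv ℝ w y (v y) - fderiv ℝ v y (w y)) u) +
        lieDeriv v α y (Fin.cons (w y) u) := by
  have h0 : α y (Fin.cons (fderiv ℝ w y (v y) - fderiv ℝ v y (w y)) u) =
      α y (Fin.cons (fderiv ℝ w y (v y)) u) - α y (Fin.cons (fderiv ℝ v y (w y)) u) := by
    exact congrArg (fun A : E [⋀^Fin k]→L[ℝ] ℝ => A u)
      (map_sub (α y).curryLeft (fderiv ℝ w y (v y)) (fderiv ℝ v y (w y)))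
  rw [h0]
  simp only [lieDeriv, (hasFDerivAt_interior hα hw).2, Fin.sum_univ_succ, interior_apply]
  have h1 : ∀ i : Fin k, Function.update (Fin.cons (w y) u : Fin (k + 1) → E) i.succ
      (fderiv ℝ v y ((Fin.cons (w y) u : Fin (k + 1) → E) i.succ)) =
      Fin.cons (w y) (Function.update u i (fderiv ℝ v y (u i))) := by
    intro i
    rw [Fin.cons_update, Fin.cons_succ]
  have h2 : Function.update (Fin.cons (w y) u : Fin (k + 1) → E) 0
      (fderiv ℝ v y ((Fin.cons (w y) u : Fin (k + 1) → E) 0)) =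
      Fin.cons (fderiv ℝ v y (w y)) u := by
    rw [Fin.cons_zero, Fin.update_cons_zero]
  simp only [h1, h2]
  ring

end FormCalculus
end

/-! ### Vector fields and forms in charts -/

noncomputable section
set_option maxSynthPendingDepth 3
namespace FormCalculus
variable {E : Type*} [NormedAddCommGroup E] [NormedSpace ℝ E]

/-- Smoothness of a form follows from smoothness of its coefficients. In the induction on the degree
`α` is recovered from `curryLeft`: alternatizing multiplies by `k + 1`. -/
theorem contDiffOn_of_apply [FiniteDimensional ℝ E] {n : WithTop ℕ∞} {U : Set E} {k : ℕ} :
    ∀ {α : E → E [⋀^Fin k]→L[ℝ] ℝ}, (∀ u, ContDiffOn ℝ n (fun y => α y u) U) →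
      ContDiffOn ℝ n α U := by
  induction k with
  | zero =>
    intro α h
    have h1 : ∀ y, α y = ContinuousAlternatingMap.constOfIsEmptyLIE ℝ E ℝ (Fin 0) (α y 0) := by
      intro y
      ext u
      rw [Subsingleton.elim u 0]
      rfl
    exact ((ContinuousAlternatingMap.constOfIsEmptyLIE ℝ E ℝ
      (Fin 0)).contDiff.comp_contDiffOn (h 0)).congr fun y _ => h1 y
  | succ k ih =>
    intro α h
    have h1 : ContDiffOn ℝ n (fun y => (α y).curryLeft) U :=
      contDiffOn_clm_apply.2 fun w => ih fun u => h (Fin.cons w u)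
    have h2 := (ContinuousAlternatingMap.alternatizeUncurryFinCLM
      (n := k) ℝ E ℝ).contDiff.comp_contDiffOn h1
    refine (h2.const_smul (((k : ℝ) + 1)⁻¹)).congr fun y _ => ?_
    have h3 : ContinuousAlternatingMap.alternatizeUncurryFinCLM (n := k) ℝ E ℝ (α y).curryLeft
        = (k + 1) • α y := ContinuousAlternatingMap.alternatizeUncurryFin_curryLeft (α y)
    have h4 : ((k : ℝ) + 1) ≠ 0 := by positivity
    have h5 : (k + 1) • α y = ((k : ℝ) + 1) • α y := by
      rw [← Nat.cast_smul_eq_nsmul ℝ]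
      push_cast
      rfl
    simp only [Function.comp_apply]
    change _ = ((k : ℝ) + 1)⁻¹ • ContinuousAlternatingMap.alternatizeUncurryFinCLM (n := k) ℝ E ℝ (α y).curryLeft
    rw [h3, h5, smul_smul, inv_mul_cancel₀ h4, one_smul]

end FormCalculus

namespace AlmostK
open FormCalculus
variable {E : Type*} [NormedAddCommGroup E] [NormedSpace ℝ E]
  {M : Type*} [TopologicalSpace M] [ChartedSpace E M]

/-- The expression of a vector field in the preferred chart at `x₀`. -/
def localField (X : ∀ x : M, TangentSpace 𝓘(ℝ, E) x) (x₀ : M) : E → E := fun y =>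
  diffAt E (extChartAt 𝓘(ℝ, E) x₀) ((extChartAt 𝓘(ℝ, E) x₀).symm y)
    (X ((extChartAt 𝓘(ℝ, E) x₀).symm y))

namespace Form

/-- The contraction `i_X α`. -/
def contract {k : ℕ} (X : ∀ x : M, TangentSpace 𝓘(ℝ, E) x) (α : Form E M (k + 1)) : Form E M k :=
  fun x => (α x).curryLeft (X x : E)

theorem contract_apply {k : ℕ} (X : ∀ x : M, TangentSpace 𝓘(ℝ, E) x) (α : Form E M (k + 1)) (x : M)
    (u : Fin k → E) : contract X α x u = α x (Fin.cons (X x : E) u) := rfl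

/-- The Lie derivative of `α` along `X` vanishes. -/
def LieInv {k : ℕ} (X : ∀ x : M, TangentSpace 𝓘(ℝ, E) x) (α : Form E M k) : Prop :=
  ∀ x₀ : M, ∀ y ∈ (extChartAt 𝓘(ℝ, E) x₀).target, ∀ u,
    lieDeriv (localField X x₀) (α.inChart x₀) y u = 0

end Form

variable [IsManifold 𝓘(ℝ, E) ∞ M]

theorem diffAt_chart_comp_symm (x₀ : M) {y : E} (hy : y ∈ (extChartAt 𝓘(ℝ, E) x₀).target) (w : E) :
    diffAt E (extChartAt 𝓘(ℝ, E) x₀) ((extChartAt 𝓘(ℝ, E) x₀).symm y)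
      (diffAt E (extChartAt 𝓘(ℝ, E) x₀).symm y w) = w := by
  have h := Form.diffAt_comp (Form.mdiffAt_chart x₀ ((extChartAt 𝓘(ℝ, E) x₀).map_target hy))
    (Form.mdiffAt_symm x₀ hy)
  have h2 : diffAt E (extChartAt 𝓘(ℝ, E) x₀ ∘ (extChartAt 𝓘(ℝ, E) x₀).symm) y =
      diffAt E (id : E → E) y := by
    refine Filter.EventuallyEq.mfderiv_eq ?_
    filter_upwards [(isOpen_extChartAt_target x₀).mem_nhds hy] with z hz
    exact (extChartAt 𝓘(ℝ, E) x₀).right_inv hz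
  have h3 : diffAt E (id : E → E) y = ContinuousLinearMap.id ℝ E := mfderiv_id
  rw [h2, h3] at h
  exact (DFunLike.congr_fun h w).symm

theorem diffAt_symm_comp_chart (x₀ : M) {x : M} (hx : x ∈ (extChartAt 𝓘(ℝ, E) x₀).source) (w : E) :
    diffAt E (extChartAt 𝓘(ℝ, E) x₀).symm (extChartAt 𝓘(ℝ, E) x₀ x)
      (diffAt E (extChartAt 𝓘(ℝ, E) x₀) x w) = w := by
  have h := Form.diffAt_comp (Form.mdiffAt_symm x₀ ((extChartAt 𝓘(ℝ, E) x₀).map_source hx))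
    (Form.mdiffAt_chart x₀ hx)
  have h2 : diffAt E ((extChartAt 𝓘(ℝ, E) x₀).symm ∘ extChartAt 𝓘(ℝ, E) x₀) x =
      diffAt E (id : M → M) x := by
    refine Filter.EventuallyEq.mfderiv_eq ?_
    filter_upwards [(isOpen_extChartAt_source x₀).mem_nhds hx] with z hz
    exact (extChartAt 𝓘(ℝ, E) x₀).left_inv hz
  have h3 : diffAt E (id : M → M) x = ContinuousLinearMap.id ℝ E := mfderiv_id
  rw [h2, h3] at h
  exact (DFunLike.congr_fun h w).symm

theorem diffAt_symm_localField (X : ∀ x : M, TangentSpace 𝓘(ℝ, E) x) (x₀ : M) {y : E}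
    (hy : y ∈ (extChartAt 𝓘(ℝ, E) x₀).target) :
    diffAt E (extChartAt 𝓘(ℝ, E) x₀).symm y (localField X x₀ y) =
      X ((extChartAt 𝓘(ℝ, E) x₀).symm y) := by
  have h := diffAt_symm_comp_chart x₀ ((extChartAt 𝓘(ℝ, E) x₀).map_target hy)
    (X ((extChartAt 𝓘(ℝ, E) x₀).symm y))
  rwa [(extChartAt 𝓘(ℝ, E) x₀).right_inv hy] at h

omit [IsManifold 𝓘(ℝ, E) ∞ M] in
theorem localField_sum_smul {s : ℕ} (ξ : Fin s → ∀ x : M, TangentSpace 𝓘(ℝ, E) x) (c : Fin s → ℝ)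
    (x₀ : M) : localField (fun x => ∑ i, c i • ξ i x) x₀ =
      fun y => ∑ i, c i • localField (ξ i) x₀ y := by
  funext y
  simp only [localField]
  have h : ∀ (L : E →L[ℝ] E) (f : Fin s → E), L (∑ i, c i • f i) = ∑ i, c i • L (f i) := by
    intro L f
    rw [map_sum]
    exact Finset.sum_congr rfl fun i _ => map_smul _ _ _
  exact h _ fun i => ξ i ((extChartAt 𝓘(ℝ, E) x₀).symm y)

/-- This links smoothness of sections of the tangent bundle with smoothness of `localField`. -/
theorem trivialization_snd (x₀ : M) {x : M} (hx : x ∈ (extChartAt 𝓘(ℝ, E) x₀).source)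
    (v : TangentSpace 𝓘(ℝ, E) x) :
    (trivializationAt E (TangentSpace 𝓘(ℝ, E)) x₀ ⟨x, v⟩).2 =
      diffAt E (extChartAt 𝓘(ℝ, E) x₀) x v := by
  have : IsManifold 𝓘(ℝ, E) 1 M := IsManifold.of_le (n := ∞) (by norm_num)
  have hx' : x ∈ (chartAt E x₀).source := by simpa using hx
  have h := TangentBundle.continuousLinearMapAt_trivializationAt (I := 𝓘(ℝ, E)) hx'
  have h2 := DFunLike.congr_fun h v
  refine Eq.trans ?_ h2
  exact (congrFun ((trivializationAt E (TangentSpace 𝓘(ℝ, E)) x₀).coe_linearMapAt_of_mem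
    (R := ℝ) (by simpa using hx')) v).symm

theorem SmoothField.contDiffOn_localField {X : ∀ x : M, TangentSpace 𝓘(ℝ, E) x} (hX : SmoothField X)
    (x₀ : M) : ContDiffOn ℝ ∞ (localField X x₀) (extChartAt 𝓘(ℝ, E) x₀).target := by
  intro y hy
  set x := (extChartAt 𝓘(ℝ, E) x₀).symm y with hxdef
  have hx : x ∈ (extChartAt 𝓘(ℝ, E) x₀).source := (extChartAt 𝓘(ℝ, E) x₀).map_target hy
  have h1 := ((trivializationAt E (TangentSpace 𝓘(ℝ, E)) x₀).contMDiffAt_section_iff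
    (n := ∞) (IB := 𝓘(ℝ, E)) (s := X) (x₀ := x) (by simpa using hx)).1 (hX x)
  have h2 : ContMDiffAt 𝓘(ℝ, E) 𝓘(ℝ, E) ∞ _ y := h1.comp y (Form.contMDiffAt_symm x₀ hy)
  refine (h2.contDiffAt.congr_of_eventuallyEq ?_).contDiffWithinAt
  filter_upwards [(isOpen_extChartAt_target x₀).mem_nhds hy] with z hz
  exact (trivialization_snd x₀ ((extChartAt 𝓘(ℝ, E) x₀).map_target hz) _).symm

theorem SmoothField.differentiableAt_localField {X : ∀ x : M, TangentSpace 𝓘(ℝ, E) x}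
    (hX : SmoothField X) (x₀ : M) {y : E} (hy : y ∈ (extChartAt 𝓘(ℝ, E) x₀).target) :
    DifferentiableAt ℝ (localField X x₀) y :=
  ((hX.contDiffOn_localField x₀).contDiffAt
    ((isOpen_extChartAt_target x₀).mem_nhds hy)).differentiableAt (by norm_num)

theorem SmoothField.sum_smul {s : ℕ} {ξ : Fin s → ∀ x : M, TangentSpace 𝓘(ℝ, E) x}
    (hξ : ∀ i, SmoothField (ξ i)) (c : Fin s → ℝ) :
    SmoothField (fun x => ∑ i, c i • ξ i x) :=
  ContMDiff.sum_section (s := Finset.univ) (t := fun i x => c i • ξ i x)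
    fun i _ => ContMDiff.const_smul_section (hξ i)

namespace Form

theorem apply_eq_inChart {k : ℕ} (α : Form E M k) (x₀ : M) {x : M}
    (hx : x ∈ (extChartAt 𝓘(ℝ, E) x₀).source) (v : Fin k → E) :
    α x v = α.inChart x₀ (extChartAt 𝓘(ℝ, E) x₀ x)
      fun i => diffAt E (extChartAt 𝓘(ℝ, E) x₀) x (v i) := by
  simp only [inChart, pullback]
  change _ = α _ fun i => _
  rw [(extChartAt 𝓘(ℝ, E) x₀).left_inv hx]
  exact congrArg (α x) (funext fun i => (diffAt_symm_comp_chart x₀ hx (v i)).symm)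

theorem ext_inChart {k : ℕ} {α β : Form E M k}
    (h : ∀ x : M, α.inChart x (extChartAt 𝓘(ℝ, E) x x) = β.inChart x (extChartAt 𝓘(ℝ, E) x x)) :
    α = β := by
  funext x
  ext v
  have hx := mem_extChartAt_source (I := 𝓘(ℝ, E)) x
  rw [apply_eq_inChart α x hx, apply_eq_inChart β x hx, h]

omit [IsManifold 𝓘(ℝ, E) ∞ M] in
theorem inChart_apply {k : ℕ} (α : Form E M k) (x₀ : M) (y : E) (u : Fin k → E) :
    α.inChart x₀ y u = α ((extChartAt 𝓘(ℝ, E) x₀).symm y)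
      fun i => diffAt E (extChartAt 𝓘(ℝ, E) x₀).symm y (u i) := rfl

theorem inChart_contract {k : ℕ} (X : ∀ x : M, TangentSpace 𝓘(ℝ, E) x) (α : Form E M (k + 1))
    (x₀ : M) {y : E} (hy : y ∈ (extChartAt 𝓘(ℝ, E) x₀).target) :
    (contract X α).inChart x₀ y = interior (localField X x₀) (α.inChart x₀) y := by
  ext u
  rw [interior_apply, inChart_apply, inChart_apply, contract_apply]
  congr 1
  funext i
  refine Fin.cases ?_ (fun i => ?_) i
  · exact (diffAt_symm_localField X x₀ hy).symm
  · rfl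

theorem eventuallyEq_inChart_contract {k : ℕ} (X : ∀ x : M, TangentSpace 𝓘(ℝ, E) x)
    (α : Form E M (k + 1)) (x₀ : M) {y : E} (hy : y ∈ (extChartAt 𝓘(ℝ, E) x₀).target) :
    (contract X α).inChart x₀ =ᶠ[𝓝 y] interior (localField X x₀) (α.inChart x₀) := by
  filter_upwards [(isOpen_extChartAt_target x₀).mem_nhds hy] with z hz
  exact inChart_contract X α x₀ hz

theorem Smooth.contract {k : ℕ} {X : ∀ x : M, TangentSpace 𝓘(ℝ, E) x} (hX : SmoothField X)
    {α : Form E M (k + 1)} (hα : α.Smooth) : (contract X α).Smooth := fun x₀ =>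
  (contDiffOn_interior (hα x₀) (hX.contDiffOn_localField x₀)).congr
    fun _ hy => inChart_contract X α x₀ hy

omit [IsManifold 𝓘(ℝ, E) ∞ M] in
theorem wedge_pullback_apply {k : ℕ} (η : Form E M 1) (β : Form E M k) {N : Type*}
    [TopologicalSpace N] [ChartedSpace E N] (φ : N → M) :
    pullback φ (wedge η β) = wedge (pullback φ η) (pullback φ β) := by
  funext x
  ext v
  rw [wedge_apply]
  exact wedge_apply η β (φ x) _

omit [IsManifold 𝓘(ℝ, E) ∞ M] in
theorem Smooth.wedge {k : ℕ} {η : Form E M 1} {β : Form E M k} (hη : η.Smooth) (hβ : β.Smooth) :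
    (wedge η β).Smooth := by
  intro x₀
  have h1 : ContDiffOn ℝ ∞ (fun y => (ContinuousAlternatingMap.ofSubsingleton ℝ E ℝ (0 : Fin 1)).symm
      (η.inChart x₀ y)) (extChartAt 𝓘(ℝ, E) x₀).target :=
    (ContinuousAlternatingMap.ofSubsingletonLIE (𝕜 := ℝ) (E := E) (F := ℝ)
      (0 : Fin 1)).symm.contDiff.comp_contDiffOn (hη x₀)
  have h2 := h1.smulRight (hβ x₀)
  have h3 := (ContinuousAlternatingMap.alternatizeUncurryFinCLM
      (n := k) ℝ E ℝ).contDiff.comp_contDiffOn h2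
  refine h3.congr fun y _ => ?_
  unfold inChart
  rw [wedge_pullback_apply]
  rfl

/-- The coefficients are constants, so no derivative of them appears. These combinations are the
fields whose flows generate the group. -/
theorem LieInv.congr_sum {k s : ℕ} {ξ : Fin s → ∀ x : M, TangentSpace 𝓘(ℝ, E) x}
    (hξ : ∀ i, SmoothField (ξ i)) {α : Form E M k} (h : ∀ i, LieInv (ξ i) α) (c : Fin s → ℝ) :
    LieInv (fun x => ∑ i, c i • ξ i x) α := by
  intro x₀ y hy u
  rw [localField_sum_smul, lieDeriv_sum_smul c _ fun j => (hξ j).differentiableAt_localField x₀ hy]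
  exact Finset.sum_eq_zero fun i _ => by rw [h i x₀ y hy u, mul_zero]

/-- Cartan's formula for a manifold, in positive degrees. -/
theorem lieInv_iff {k : ℕ} {X : ∀ x : M, TangentSpace 𝓘(ℝ, E) x} (hX : SmoothField X)
    {α : Form E M (k + 1)} (hα : α.Smooth) :
    LieInv X α ↔ Form.contract X α.d = -(Form.contract X α).d := by
  have key : ∀ x₀ : M, ∀ y ∈ (extChartAt 𝓘(ℝ, E) x₀).target, ∀ u,
      (Form.contract X α.d).inChart x₀ y u + (Form.contract X α).d.inChart x₀ y u =
        lieDeriv (localField X x₀) (α.inChart x₀) y u := by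
    intro x₀ y hy u
    rw [inChart_contract X _ x₀ hy, inChart_d (hα.contract hX) x₀ hy,
      (eventuallyEq_inChart_contract X α x₀ hy).extDeriv_eq, interior_apply, inChart_d hα x₀ hy]
    exact extDeriv_cons_add_extDeriv_interior (hα.differentiableAt x₀ hy)
      (hX.differentiableAt_localField x₀ hy) u
  constructor
  · intro h
    refine ext_inChart fun x => ?_
    ext u
    have hy := mem_extChartAt_target (I := 𝓘(ℝ, E)) x
    have h1 := key x _ hy u
    rw [h x _ hy u] at h1
    exact eq_neg_of_add_eq_zero_left h1
  · intro h x₀ y hy u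
    rw [← key x₀ y hy u, h]
    exact neg_add_cancel _

theorem lieInv_zero_iff {X : ∀ x : M, TangentSpace 𝓘(ℝ, E) x}
    {α : Form E M 0} (hα : α.Smooth) :
    LieInv X α ↔ Form.contract X α.d = 0 := by
  have key : ∀ x₀ : M, ∀ y ∈ (extChartAt 𝓘(ℝ, E) x₀).target, ∀ u,
      (Form.contract X α.d).inChart x₀ y u =
        lieDeriv (localField X x₀) (α.inChart x₀) y u := by
    intro x₀ y hy u
    rw [inChart_contract X _ x₀ hy, interior_apply, inChart_d hα x₀ hy]
    exact extDeriv_cons_eq_lieDeriv _ u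
  constructor
  · intro h
    refine ext_inChart fun x => ?_
    ext u
    have hy := mem_extChartAt_target (I := 𝓘(ℝ, E)) x
    have h1 := key x _ hy u
    rw [h x _ hy u] at h1
    exact h1
  · intro h x₀ y hy u
    rw [← key x₀ y hy u, h]
    rfl

end Form

/-- The vector field on a chart domain which is constant in the chart. -/
theorem contMDiffAt_symm_const (x₀ : M) {x : M} (hx : x ∈ (extChartAt 𝓘(ℝ, E) x₀).source) (u : E) :
    ContMDiffAt 𝓘(ℝ, E) 𝓘(ℝ, E).tangent ∞ (fun x => (⟨x, diffAt E (extChartAt 𝓘(ℝ, E) x₀).symm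
      (extChartAt 𝓘(ℝ, E) x₀ x) u⟩ : TangentBundle 𝓘(ℝ, E) M)) x := by
  refine ((trivializationAt E (TangentSpace 𝓘(ℝ, E)) x₀).contMDiffAt_section_iff
    (n := ∞) (IB := 𝓘(ℝ, E)) (E := fun x : M => TangentSpace 𝓘(ℝ, E) x) (s := fun x => diffAt E (extChartAt 𝓘(ℝ, E) x₀).symm
      (extChartAt 𝓘(ℝ, E) x₀ x) u) (x₀ := x) (by simpa using hx)).2 ?_
  refine (contMDiffAt_const (c := u)).congr_of_eventuallyEq ?_
  filter_upwards [(isOpen_extChartAt_source x₀).mem_nhds hx] with z hz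
  refine (trivialization_snd x₀ hz _).trans ?_
  have h := diffAt_chart_comp_symm x₀ ((extChartAt 𝓘(ℝ, E) x₀).map_source hz) u
  rwa [(extChartAt 𝓘(ℝ, E) x₀).left_inv hz] at h

theorem MetricFStructure.fundamentalForm_smooth [FiniteDimensional ℝ E] {s : ℕ}
    (A : MetricFStructure E s M) : A.fundamentalForm.Smooth := by
  intro x₀
  refine contDiffOn_of_apply fun u y hy => ?_
  have hx := (extChartAt 𝓘(ℝ, E) x₀).map_target hy
  -- A chart coefficient of the fundamental form is `g(U₀, f U₁)` for the chart-constant fields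
  -- `U₀`, `U₁`.
  have h0 := contMDiffAt_symm_const x₀ hx (u 0)
  have h1 := contMDiffAt_symm_const x₀ hx (u 1)
  have h2 := (A.f_smooth _).clm_bundle_apply (E₁ := fun x : M => TangentSpace 𝓘(ℝ, E) x)
    (E₂ := fun x : M => TangentSpace 𝓘(ℝ, E) x) h1
  have h3 := ((A.g.contMDiff _).clm_bundle_apply₂
    (E₁ := fun x : M => TangentSpace 𝓘(ℝ, E) x) (E₂ := fun x : M => TangentSpace 𝓘(ℝ, E) x)
    (E₃ := fun _ : M => ℝ) (F₃ := ℝ) h0 h2)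
  have h4 := (Bundle.contMDiffAt_section _).1 h3
  have h5 := h4.comp y (Form.contMDiffAt_symm x₀ hy)
  refine (h5.contDiffAt.congr_of_eventuallyEq ?_).contDiffWithinAt
  filter_upwards [(isOpen_extChartAt_target x₀).mem_nhds hy] with z hz
  rw [Form.inChart_apply]
  simp only [Function.comp_apply, (extChartAt 𝓘(ℝ, E) x₀).right_inv hz]
  rfl

end AlmostK
end

/-! ### Flows on compact manifolds -/

noncomputable section
set_option maxSynthPendingDepth 3
namespace AlmostK
open FormCalculus
variable {E : Type*} [NormedAddCommGroup E] [NormedSpace ℝ E]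

theorem exists_local_flow_of_contDiffOn [FiniteDimensional ℝ E] {v : E → E} {T : Set E}
    (hT : IsOpen T) (hv : ContDiffOn ℝ ∞ v T) {y₁ : E} (hy₁ : y₁ ∈ T) :
    ∃ V : Set E, IsOpen V ∧ y₁ ∈ V ∧ V ⊆ T ∧ ∃ ε > 0, ∃ θ : ℝ → E → E,
      (∀ t, ContDiff ℝ ∞ (θ t)) ∧ (∀ y, θ 0 y = y) ∧ ∀ t ∈ Ioo (-ε) ε, ∀ y ∈ V,
        θ t y ∈ T ∧ HasDerivAt (fun t => θ t y) (v (θ t y)) t ∧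
        ∀ w, HasDerivAt (fun t => fderiv ℝ (θ t) y w)
          (fderiv ℝ v (θ t y) (fderiv ℝ (θ t) y w)) t := by
  have : CompleteSpace E := FiniteDimensional.complete ℝ E
  obtain ⟨R, hR, hRT⟩ := Metric.nhds_basis_closedBall.mem_iff.1 (hT.mem_nhds hy₁)
  -- The cutoff makes the field global with compact support and leaves it unchanged on the ball of
  -- radius `R / 2`.
  let χ : ContDiffBump y₁ := ⟨R / 2, R, by positivity, by linarith⟩
  have hsupp : tsupport (fun y => χ y • v y) ⊆ T :=
    (tsupport_smul_subset_left χ v).trans (by rw [χ.tsupport_eq]; exact hRT)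
  have hv' : ContDiff ℝ ∞ fun y => χ y • v y := by
    refine contDiff_iff_contDiffAt.2 fun y => ?_
    by_cases hy : y ∈ tsupport fun y => χ y • v y
    swap
    · exact contDiffAt_const.congr_of_eventuallyEq (notMem_tsupport_iff_eventuallyEq.1 hy)
    exact χ.contDiff.contDiffAt.smul (hv.contDiffAt (hT.mem_nhds (hsupp hy)))
  have hc : HasCompactSupport fun y => χ y • v y := χ.hasCompactSupport.smul_right
  have heq : ∀ y ∈ Metric.ball y₁ (R / 2), (fun y => χ y • v y) =ᶠ[𝓝 y] v := by
    intro y hy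
    filter_upwards [χ.eventuallyEq_one_of_mem_ball hy] with z hz
    simp [hz]
  obtain ⟨ε, hε, θ, hθs, hθ0, hθ⟩ := SmoothFlow.exists_flow hv' hc
  obtain ⟨C, hC⟩ := hc.exists_bound_of_continuous hv'.continuous
  have hC0 : 0 ≤ C := (norm_nonneg _).trans (hC y₁)
  -- The speed is at most `C`, so within time `R / 4 / (C + 1)` a curve starting in the ball of
  -- radius `R / 4` stays in the ball of radius `R / 2`, where the cutoff is `1`.
  refine ⟨Metric.ball y₁ (R / 4), Metric.isOpen_ball, Metric.mem_ball_self (by positivity), ?_,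
    min ε (R / 4 / (C + 1)), by positivity, θ, hθs, hθ0, ?_⟩
  · exact (Metric.ball_subset_closedBall.trans
      (Metric.closedBall_subset_closedBall (by linarith))).trans hRT
  intro t ht y hy
  have ht1 : |t| < ε := (abs_lt.2 ht).trans_le (min_le_left _ _)
  have ht2 : |t| < R / 4 / (C + 1) := (abs_lt.2 ht).trans_le (min_le_right _ _)
  have hconf : ‖θ t y - θ 0 y‖ ≤ C * ‖t - 0‖ := by
    refine (convex_Ioo (-ε) ε).norm_image_sub_le_of_norm_hasDerivWithin_le (f := fun t => θ t y)
      (fun u hu => ((hθ u hu y).1).hasDerivWithinAt) (fun u _ => hC (θ u y)) ?_ (abs_lt.1 ht1)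
    exact ⟨by linarith, hε⟩
  rw [hθ0, sub_zero, Real.norm_eq_abs] at hconf
  have hCt : C * |t| < R / 4 := by
    rw [lt_div_iff₀ (by positivity)] at ht2
    nlinarith [abs_nonneg t]
  have hball : θ t y ∈ Metric.ball y₁ (R / 2) := by
    rw [Metric.mem_ball] at hy ⊢
    have := dist_triangle (θ t y) y y₁
    rw [dist_eq_norm (θ t y) y] at this
    linarith
  obtain ⟨h1, h2⟩ := hθ t (abs_lt.1 ht1) y
  rw [(heq _ hball).fderiv_eq] at h2
  rw [(heq _ hball).eq_of_nhds] at h1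
  exact ⟨hRT (Metric.ball_subset_closedBall.trans
      (Metric.closedBall_subset_closedBall (by linarith)) hball), h1, h2⟩

variable {M : Type*} [TopologicalSpace M] [ChartedSpace E M]

/-- Compactness turns radii valid near each point into a common one; a union of two sets uses the
minimum of their radii. -/
theorem exists_uniform_radius [CompactSpace M] {P : M → ℝ → Prop}
    (hmono : ∀ x ε ε', ε' ≤ ε → P x ε → P x ε')
    (h : ∀ x, ∃ ε > 0, ∀ᶠ z in 𝓝 x, P z ε) : ∃ ε > 0, ∀ x, P x ε := by
  obtain ⟨ε, hε, hP⟩ : ∃ ε > 0, ∀ x ∈ (univ : Set M), P x ε := by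
    refine isCompact_univ.induction_on (p := fun s => ∃ ε > 0, ∀ x ∈ s, P x ε) ?_ ?_ ?_ ?_
    · exact ⟨1, one_pos, by simp⟩
    · rintro s t hst ⟨ε, hε, hP⟩
      exact ⟨ε, hε, fun x hx => hP x (hst hx)⟩
    · rintro s t ⟨ε, hε, hP⟩ ⟨ε', hε', hP'⟩
      refine ⟨min ε ε', lt_min hε hε', fun x hx => ?_⟩
      rcases hx with hx | hx
      · exact hmono _ _ _ (min_le_left _ _) (hP x hx)
      · exact hmono _ _ _ (min_le_right _ _) (hP' x hx)
    · intro x _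
      obtain ⟨ε, hε, hx⟩ := h x
      exact ⟨{z | P z ε}, mem_nhdsWithin_of_mem_nhds hx, ε, hε, fun z hz => hz⟩
  exact ⟨ε, hε, fun x => hP x (mem_univ x)⟩

variable [IsManifold 𝓘(ℝ, E) ∞ M]

theorem SmoothField.contMDiff_one {X : ∀ x : M, TangentSpace 𝓘(ℝ, E) x} (hX : SmoothField X) :
    ContMDiff 𝓘(ℝ, E) 𝓘(ℝ, E).tangent 1 fun x => (⟨x, X x⟩ : TangentBundle 𝓘(ℝ, E) M) :=
  ContMDiff.of_le hX (by norm_num)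

theorem isMIntegralCurveOn_symm_comp {X : ∀ x : M, TangentSpace 𝓘(ℝ, E) x} {x₀ : M} {c : ℝ → E}
    {I : Set ℝ} (hc : ∀ t ∈ I, c t ∈ (extChartAt 𝓘(ℝ, E) x₀).target ∧
      HasDerivAt c (localField X x₀ (c t)) t) :
    IsMIntegralCurveOn (fun t => (extChartAt 𝓘(ℝ, E) x₀).symm (c t)) X I := by
  intro t ht
  obtain ⟨h1, h2⟩ := hc t ht
  have h3 := (Form.mdiffAt_symm x₀ h1).hasMFDerivAt.comp t h2.hasFDerivAt.hasMFDerivAt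
  refine HasMFDerivAt.hasMFDerivWithinAt ?_
  refine HasMFDerivAt.congr_mfderiv h3 ?_
  have h4 : ∀ (L : E →L[ℝ] E) (w z : E), L w = z →
      L.comp (ContinuousLinearMap.toSpanSingleton ℝ w) = (1 : ℝ →L[ℝ] ℝ).smulRight z := by
    intro L w z h
    ext
    simp [h]
  exact h4 _ _ _ (diffAt_symm_localField X x₀ h1)

/-- `Fl` is the flow of `X`. -/
structure IsFlow (X : ∀ x : M, TangentSpace 𝓘(ℝ, E) x) (Fl : ℝ → M → M) : Prop where
  zero : ∀ x, Fl 0 x = x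
  curve : ∀ x, IsMIntegralCurve (I := 𝓘(ℝ, E)) (fun t => Fl t x) X

/-- The local flows give a uniform time of existence on the compact manifold, and a uniform time of
existence makes the field complete. -/
theorem exists_isFlow [FiniteDimensional ℝ E] [CompactSpace M] [T2Space M]
    {X : ∀ x : M, TangentSpace 𝓘(ℝ, E) x} (hX : SmoothField X) : ∃ Fl, IsFlow X Fl := by
  have : IsManifold 𝓘(ℝ, E) 1 M := IsManifold.of_le (n := ∞) (by norm_num)
  obtain ⟨ε, hε, h⟩ : ∃ ε > 0, ∀ x : M, ∃ γ : ℝ → M, γ 0 = x ∧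
      IsMIntegralCurveOn (I := 𝓘(ℝ, E)) γ X (Ioo (-ε) ε) := by
    refine exists_uniform_radius (P := fun x ε => ∃ γ : ℝ → M, γ 0 = x ∧
      IsMIntegralCurveOn (I := 𝓘(ℝ, E)) γ X (Ioo (-ε) ε)) ?_ fun x => ?_
    · rintro x ε ε' h ⟨γ, h0, hγ⟩
      exact ⟨γ, h0, hγ.mono (Ioo_subset_Ioo (by linarith) h)⟩
    · have hx := mem_extChartAt_source (I := 𝓘(ℝ, E)) x
      obtain ⟨V, hV, hxV, hVT, ε, hε, θ, -, hθ0, hθ⟩ := exists_local_flow_of_contDiffOn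
        (isOpen_extChartAt_target x) (hX.contDiffOn_localField x)
        ((extChartAt 𝓘(ℝ, E) x).map_source hx)
      refine ⟨ε, hε, ?_⟩
      filter_upwards [(isOpen_extChartAt_source x).mem_nhds hx,
        (continuousAt_extChartAt' hx).preimage_mem_nhds (hV.mem_nhds hxV)] with z hz hzV
      refine ⟨fun t => (extChartAt 𝓘(ℝ, E) x).symm (θ t (extChartAt 𝓘(ℝ, E) x z)), ?_,
        isMIntegralCurveOn_symm_comp fun t ht => ⟨(hθ t ht _ hzV).1, (hθ t ht _ hzV).2.1⟩⟩
      simp only [hθ0, (extChartAt 𝓘(ℝ, E) x).left_inv hz]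
  choose γ h0 hγ using fun x => exists_isMIntegralCurve_of_isMIntegralCurveOn
    hX.contMDiff_one hε h x
  exact ⟨fun t x => γ x t, h0, hγ⟩

namespace IsFlow
variable {X : ∀ x : M, TangentSpace 𝓘(ℝ, E) x} {Fl : ℝ → M → M}

theorem eq_of_curve [CompleteSpace E] [T2Space M] (hX : SmoothField X) (hFl : IsFlow X Fl)
    {γ : ℝ → M} (hγ : IsMIntegralCurve (I := 𝓘(ℝ, E)) γ X) (t : ℝ) : Fl t (γ 0) = γ t := by
  have : IsManifold 𝓘(ℝ, E) 1 M := IsManifold.of_le (n := ∞) (by norm_num)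
  exact congrFun (isMIntegralCurve_Ioo_eq_of_contMDiff_boundaryless (t₀ := 0) hX.contMDiff_one
    (hFl.curve (γ 0)) hγ (hFl.zero _)) t

theorem add [CompleteSpace E] [T2Space M] (hX : SmoothField X) (hFl : IsFlow X Fl) (s t : ℝ) (x : M) :
    Fl (s + t) x = Fl s (Fl t x) := by
  have h := eq_of_curve hX hFl ((hFl.curve x).comp_add t) s
  simp only [Function.comp_apply, zero_add] at h
  exact h.symm

variable [FiniteDimensional ℝ E] [T2Space M]

/-- Uniqueness of integral curves identifies the global flow, read in a chart, with the smooth local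
flow `θ`. -/
theorem exists_local (hX : SmoothField X) (hFl : IsFlow X Fl) (x₀ : M) {y₁ : E}
    (hy₁ : y₁ ∈ (extChartAt 𝓘(ℝ, E) x₀).target) :
    ∃ V : Set E, IsOpen V ∧ y₁ ∈ V ∧ V ⊆ (extChartAt 𝓘(ℝ, E) x₀).target ∧ ∃ ε > 0,
      ∃ θ : ℝ → E → E, (∀ t, ContDiff ℝ ∞ (θ t)) ∧ (∀ y, θ 0 y = y) ∧ ∀ t ∈ Ioo (-ε) ε, ∀ y ∈ V,
        θ t y ∈ (extChartAt 𝓘(ℝ, E) x₀).target ∧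
        HasDerivAt (fun t => θ t y) (localField X x₀ (θ t y)) t ∧
        (∀ w, HasDerivAt (fun t => fderiv ℝ (θ t) y w)
          (fderiv ℝ (localField X x₀) (θ t y) (fderiv ℝ (θ t) y w)) t) ∧
        Fl t ((extChartAt 𝓘(ℝ, E) x₀).symm y) = (extChartAt 𝓘(ℝ, E) x₀).symm (θ t y) := by
  have : IsManifold 𝓘(ℝ, E) 1 M := IsManifold.of_le (n := ∞) (by norm_num)
  have : CompleteSpace E := FiniteDimensional.complete ℝ E
  obtain ⟨V, hV, hyV, hVT, ε, hε, θ, hθs, hθ0, hθ⟩ := exists_local_flow_of_contDiffOn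
    (isOpen_extChartAt_target x₀) (hX.contDiffOn_localField x₀) hy₁
  refine ⟨V, hV, hyV, hVT, ε, hε, θ, hθs, hθ0, fun t ht y hy =>
    ⟨(hθ t ht y hy).1, (hθ t ht y hy).2.1, (hθ t ht y hy).2.2, ?_⟩⟩
  refine isMIntegralCurveOn_Ioo_eqOn_of_contMDiff_boundaryless (I := 𝓘(ℝ, E)) (t₀ := 0)
    ⟨by linarith, hε⟩ hX.contMDiff_one
    ((hFl.curve ((extChartAt 𝓘(ℝ, E) x₀).symm y)).isMIntegralCurveOn _)
    (isMIntegralCurveOn_symm_comp (c := fun t => θ t y)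
      fun t ht => ⟨(hθ t ht y hy).1, (hθ t ht y hy).2.1⟩) ?_ ht
  rw [hFl.zero, hθ0]

theorem exists_contMDiff [CompactSpace M] (hX : SmoothField X) (hFl : IsFlow X Fl) :
    ∃ ε > 0, ∀ t ∈ Ioo (-ε) ε, ContMDiff 𝓘(ℝ, E) 𝓘(ℝ, E) ∞ (Fl t) := by
  obtain ⟨ε, hε, h⟩ : ∃ ε > 0, ∀ x, ∀ t ∈ Ioo (-ε) ε, ContMDiffAt 𝓘(ℝ, E) 𝓘(ℝ, E) ∞ (Fl t) x := by
    refine exists_uniform_radius (P := fun x ε => ∀ t ∈ Ioo (-ε) ε,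
      ContMDiffAt 𝓘(ℝ, E) 𝓘(ℝ, E) ∞ (Fl t) x) ?_ fun x => ?_
    · intro x ε ε' h hP t ht
      exact hP t (Ioo_subset_Ioo (by linarith) h ht)
    · have hx := mem_extChartAt_source (I := 𝓘(ℝ, E)) x
      obtain ⟨V, hV, hxV, -, ε, hε, θ, hθs, -, hθ⟩ :=
        exists_local hX hFl x ((extChartAt 𝓘(ℝ, E) x).map_source hx)
      refine ⟨ε, hε, ?_⟩
      have hev : ∀ᶠ z in 𝓝 x, z ∈ (extChartAt 𝓘(ℝ, E) x).source ∧ extChartAt 𝓘(ℝ, E) x z ∈ V :=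
        (eventually_mem_set.2 ((isOpen_extChartAt_source x).mem_nhds hx)).and
          ((continuousAt_extChartAt' hx).preimage_mem_nhds (hV.mem_nhds hxV))
      filter_upwards [eventually_eventually_nhds.2 hev] with z hz t ht
      have hz' := hz.self_of_nhds
      have h1 : ContMDiffAt 𝓘(ℝ, E) 𝓘(ℝ, E) ∞ ((extChartAt 𝓘(ℝ, E) x).symm ∘ θ t ∘
          extChartAt 𝓘(ℝ, E) x) z :=
        ContMDiffAt.comp z (Form.contMDiffAt_symm x (hθ t ht _ hz'.2).1)
          ((hθs t).contMDiff.contMDiffAt.comp z (contMDiffAt_extChartAt' (by simpa using hz'.1)))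
      refine h1.congr_of_eventuallyEq ?_
      filter_upwards [hz] with w hw
      have h2 := (hθ t ht _ hw.2).2.2.2
      rw [(extChartAt 𝓘(ℝ, E) x).left_inv hw.1] at h2
      exact h2
  exact ⟨ε, hε, fun t ht x => h x t ht⟩

end IsFlow
end AlmostK
end

/-! ### Invariance under flows -/

noncomputable section
set_option maxSynthPendingDepth 3
namespace AlmostK
open FormCalculus
variable {E : Type*} [NormedAddCommGroup E] [NormedSpace ℝ E]
  {M : Type*} [TopologicalSpace M] [ChartedSpace E M]

theorem Form.pullback_congr {N : Type*} [TopologicalSpace N] [ChartedSpace E N] {k : ℕ}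
    {φ ψ : M → N} {x : M} (h : φ =ᶠ[𝓝 x] ψ) (α : Form E N k) :
    Form.pullback φ α x = Form.pullback ψ α x := by
  have hd : diffAt E φ x = diffAt E ψ x := h.mfderiv_eq
  simp only [Form.pullback, hd, h.eq_of_nhds]

variable [IsManifold 𝓘(ℝ, E) ∞ M]

theorem inChart_pullback_of_local {k : ℕ} (α : Form E M k) {φ : M → M} {τ : E → E} (x₀ : M) {y : E}
    (hy : y ∈ (extChartAt 𝓘(ℝ, E) x₀).target)
    (hφ : MDifferentiableAt 𝓘(ℝ, E) 𝓘(ℝ, E) φ ((extChartAt 𝓘(ℝ, E) x₀).symm y))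
    (hτ : DifferentiableAt ℝ τ y) (hτy : τ y ∈ (extChartAt 𝓘(ℝ, E) x₀).target)
    (h : ∀ᶠ z in 𝓝 y, φ ((extChartAt 𝓘(ℝ, E) x₀).symm z) = (extChartAt 𝓘(ℝ, E) x₀).symm (τ z))
    (u : Fin k → E) :
    (Form.pullback φ α).inChart x₀ y u = α.inChart x₀ (τ y) fun i => fderiv ℝ τ y (u i) := by
  have h1 : (Form.pullback φ α).inChart x₀ y = Form.pullback τ (α.inChart x₀) y := by
    unfold Form.inChart
    rw [← Form.pullback_comp_apply hφ (Form.mdiffAt_symm x₀ hy),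
      ← Form.pullback_comp_apply (Form.mdiffAt_symm x₀ hτy) hτ.mdifferentiableAt]
    exact Form.pullback_congr h α
  have hd : diffAt E τ y = fderiv ℝ τ y := mfderiv_eq_fderiv
  rw [h1, Form.pullback, hd]
  rfl

namespace IsFlow
variable {X : ∀ x : M, TangentSpace 𝓘(ℝ, E) x} {Fl : ℝ → M → M}
variable [FiniteDimensional ℝ E] [T2Space M]

/-- The derivative of `Fl_t^* α` is the Lie derivative evaluated at the moved point on the moved
vectors. In this form one statement gives both directions: at `t = 0` it recovers the Lie
derivative, and if that vanishes everywhere the pullback is constant in `t`. -/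
theorem hasDerivAt_pullback (hX : SmoothField X) (hFl : IsFlow X Fl) {ε₀ : ℝ} (hε₀ : 0 < ε₀)
    (hs : ∀ t ∈ Ioo (-ε₀) ε₀, ContMDiff 𝓘(ℝ, E) 𝓘(ℝ, E) ∞ (Fl t)) {k : ℕ} {α : Form E M k}
    (hα : α.Smooth) (x₀ : M) {y₁ : E} (hy₁ : y₁ ∈ (extChartAt 𝓘(ℝ, E) x₀).target) :
    ∃ V : Set E, IsOpen V ∧ y₁ ∈ V ∧ V ⊆ (extChartAt 𝓘(ℝ, E) x₀).target ∧ ∃ ε > 0,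
      ∃ θ : ℝ → E → E, (∀ y, θ 0 y = y) ∧ ∀ t ∈ Ioo (-ε) ε, ∀ y ∈ V,
        θ t y ∈ (extChartAt 𝓘(ℝ, E) x₀).target ∧ ∀ u,
        HasDerivAt (fun t => (Form.pullback (Fl t) α).inChart x₀ y u)
          (lieDeriv (localField X x₀) (α.inChart x₀) (θ t y) fun i => fderiv ℝ (θ t) y (u i)) t := by
  obtain ⟨V, hV, hyV, hVT, ε, hε, θ, hθs, hθ0, hθ⟩ := exists_local hX hFl x₀ hy₁
  have hlt : ∀ t, t ∈ Ioo (-(min ε ε₀)) (min ε ε₀) → t ∈ Ioo (-ε) ε ∧ t ∈ Ioo (-ε₀) ε₀ := fun t ht =>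
    ⟨Ioo_subset_Ioo (neg_le_neg (min_le_left _ _)) (min_le_left _ _) ht,
      Ioo_subset_Ioo (neg_le_neg (min_le_right _ _)) (min_le_right _ _) ht⟩
  refine ⟨V, hV, hyV, hVT, min ε ε₀, lt_min hε hε₀, θ, hθ0, fun t ht y hy => ?_⟩
  refine ⟨(hθ t (hlt t ht).1 y hy).1, fun u => ?_⟩
  obtain ⟨h1, h2, h3, -⟩ := hθ t (hlt t ht).1 y hy
  refine (hasDerivAt_apply (c := fun t => θ t y) (W := fun i t => fderiv ℝ (θ t) y (u i))
    (hα.differentiableAt x₀ h1) h2 fun i => h3 (u i)).congr_of_eventuallyEq ?_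
  filter_upwards [isOpen_Ioo.mem_nhds ht] with r hr
  refine inChart_pullback_of_local α x₀ (hVT hy) ((hs r (hlt r hr).2).mdifferentiable (by norm_num) _)
    ((hθs r).differentiable (by norm_num) y) (hθ r (hlt r hr).1 y hy).1 ?_ u
  filter_upwards [hV.mem_nhds hy] with z hz
  exact (hθ r (hlt r hr).1 z hz).2.2.2

theorem lieInv_of_pullback (hX : SmoothField X) (hFl : IsFlow X Fl) {ε₀ : ℝ} (hε₀ : 0 < ε₀)
    (hs : ∀ t ∈ Ioo (-ε₀) ε₀, ContMDiff 𝓘(ℝ, E) 𝓘(ℝ, E) ∞ (Fl t)) {k : ℕ} {α : Form E M k}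
    (hα : α.Smooth) (h : ∀ t ∈ Ioo (-ε₀) ε₀, Form.pullback (Fl t) α = α) : α.LieInv X := by
  intro x₀ y hy u
  obtain ⟨V, -, hyV, -, ε, hε, θ, hθ0, hθ⟩ := hasDerivAt_pullback hX hFl hε₀ hs hα x₀ hy
  have h1 := (hθ 0 ⟨by linarith, hε⟩ y hyV).2 u
  have h2 : HasDerivAt (fun t => (Form.pullback (Fl t) α).inChart x₀ y u) 0 0 := by
    refine (hasDerivAt_const (0 : ℝ) (α.inChart x₀ y u)).congr_of_eventuallyEq ?_
    filter_upwards [isOpen_Ioo.mem_nhds (show (0 : ℝ) ∈ Ioo (-ε₀) ε₀ from ⟨by linarith, hε₀⟩)] with t ht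
    rw [h t ht]
  have h3 := h1.unique h2
  have h4 : θ 0 = id := funext hθ0
  rw [h4] at h3
  simpa using h3

theorem pullback_of_lieInv [CompactSpace M] (hX : SmoothField X) (hFl : IsFlow X Fl) {k : ℕ}
    {α : Form E M k} (hα : α.Smooth) (h : α.LieInv X) :
    ∃ ε > 0, ∀ t ∈ Ioo (-ε) ε, ContMDiff 𝓘(ℝ, E) 𝓘(ℝ, E) ∞ (Fl t) ∧ Form.pullback (Fl t) α = α := by
  obtain ⟨ε₀, hε₀, hs⟩ := exists_contMDiff hX hFl
  obtain ⟨ε, hε, hP⟩ : ∃ ε > 0, ∀ x, ∀ t ∈ Ioo (-ε) ε, Form.pullback (Fl t) α x = α x := by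
    refine exists_uniform_radius (P := fun x ε => ∀ t ∈ Ioo (-ε) ε,
      Form.pullback (Fl t) α x = α x) ?_ fun x => ?_
    · intro x ε ε' h hP t ht
      exact hP t (Ioo_subset_Ioo (by linarith) h ht)
    · have hx := mem_extChartAt_source (I := 𝓘(ℝ, E)) x
      obtain ⟨V, hV, hxV, hVT, ε, hε, θ, hθ0, hθ⟩ := hasDerivAt_pullback hX hFl hε₀ hs hα x
        ((extChartAt 𝓘(ℝ, E) x).map_source hx)
      refine ⟨ε, hε, ?_⟩
      filter_upwards [(isOpen_extChartAt_source x).mem_nhds hx,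
        (continuousAt_extChartAt' hx).preimage_mem_nhds (hV.mem_nhds hxV)] with z hz hzV t ht
      ext v
      rw [Form.apply_eq_inChart _ x hz, Form.apply_eq_inChart α x hz]
      set u := fun i => diffAt E (extChartAt 𝓘(ℝ, E) x) z (v i)
      have h0 : (Form.pullback (Fl 0) α) = α := by
        have : Fl 0 = id := funext hFl.zero
        rw [this, Form.pullback_id]
      -- The mean value inequality with constant `0`: the derivative in `t` vanishes identically.
      have hbound := (convex_Ioo (-ε) ε).norm_image_sub_le_of_norm_hasDerivWithin_le (C := 0)
        (f := fun t => (Form.pullback (Fl t) α).inChart x (extChartAt 𝓘(ℝ, E) x z) u)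
        (fun r hr => ((hθ r hr _ hzV).2 u).hasDerivWithinAt)
        (fun r hr => by rw [h x _ (hθ r hr _ hzV).1, norm_zero])
        (show (0 : ℝ) ∈ Ioo (-ε) ε from ⟨by linarith, hε⟩) ht
      rw [zero_mul, h0] at hbound
      exact sub_eq_zero.1 (norm_le_zero_iff.1 hbound)
  refine ⟨min ε ε₀, lt_min hε hε₀, fun t ht => ⟨hs t ?_, funext fun x => hP x t ?_⟩⟩
  · exact Ioo_subset_Ioo (neg_le_neg (min_le_right _ _)) (min_le_right _ _) ht
  · exact Ioo_subset_Ioo (neg_le_neg (min_le_left _ _)) (min_le_left _ _) ht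

end IsFlow

variable [FiniteDimensional ℝ E] [T2Space M] [CompactSpace M]

/-- Invariance is known for short times. By uniqueness the time-one map is `Fl 1`, the `(N +
1)`-fold composite of `Fl (1 / (N + 1))` with `1 / (N + 1) < ε`. -/
theorem Form.LieInv.pullback_timeOneMap {X : ∀ x : M, TangentSpace 𝓘(ℝ, E) x} (hX : SmoothField X)
    {k : ℕ} {α : Form E M k} (hα : α.Smooth) (h : α.LieInv X) {φ : M → M} (hφ : IsTimeOneMap X φ) :
    Form.pullback φ α = α := by
  have : CompleteSpace E := FiniteDimensional.complete ℝ E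
  obtain ⟨Fl, hFl⟩ := exists_isFlow hX
  obtain ⟨ε, hε, hP⟩ := hFl.pullback_of_lieInv hX hα h
  have hφ1 : φ = Fl 1 := by
    funext x
    obtain ⟨γ, hγ, h0, h1⟩ := hφ x
    rw [← h1, ← h0]
    exact (hFl.eq_of_curve hX hγ 1).symm
  obtain ⟨N, hN⟩ := exists_nat_one_div_lt hε
  have hN' : (1 / ((N : ℝ) + 1)) ∈ Ioo (-ε) ε :=
    ⟨by have : 0 < 1 / ((N : ℝ) + 1) := by positivity
        linarith, hN⟩
  have key : ∀ j : ℕ, ContMDiff 𝓘(ℝ, E) 𝓘(ℝ, E) ∞ (Fl (j * (1 / ((N : ℝ) + 1)))) ∧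
      Form.pullback (Fl (j * (1 / ((N : ℝ) + 1)))) α = α := by
    intro j
    induction j with
    | zero => simpa using hP 0 ⟨by linarith, hε⟩
    | succ j ih =>
      obtain ⟨h1, h2⟩ := hP _ hN'
      have h3 : Fl ((j + 1 : ℕ) * (1 / ((N : ℝ) + 1))) =
          Fl (j * (1 / ((N : ℝ) + 1))) ∘ Fl (1 / ((N : ℝ) + 1)) := by
        funext x
        rw [Nat.cast_succ, add_mul, one_mul, hFl.add hX]
        rfl
      rw [h3]
      refine ⟨ih.1.comp h1, ?_⟩
      funext x
      rw [Form.pullback_comp_apply (ih.1.mdifferentiable (by norm_num) _)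
        (h1.mdifferentiable (by norm_num) _), ih.2, h2]
  have h1 := (key (N + 1)).2
  rwa [show ((N + 1 : ℕ) : ℝ) * (1 / ((N : ℝ) + 1)) = 1 by push_cast; field_simp, ← hφ1] at h1

omit [FiniteDimensional ℝ E] [T2Space M] [CompactSpace M] in
/-- Pulling back a given form is continuous in the `C¹` topology, so the diffeomorphisms which
preserve the form are a closed set. -/
theorem Form.pullback_eq_of_mem_closure {k : ℕ} {α : Form E M k} (hα : α.Smooth)
    {S : Set (M ≃ₘ⟮𝓘(ℝ, E), 𝓘(ℝ, E)⟯ M)} (hS : ∀ φ ∈ S, Form.pullback φ α = α)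
    {φ : M ≃ₘ⟮𝓘(ℝ, E), 𝓘(ℝ, E)⟯ M} (hφ : φ ∈ closure[diffeoTopology] S) :
    Form.pullback φ α = α := by
  let _ : TopologicalSpace (M ≃ₘ⟮𝓘(ℝ, E), 𝓘(ℝ, E)⟯ M) := diffeoTopology
  funext x
  ext v
  set e := trivializationAt E (TangentSpace 𝓘(ℝ, E)) (φ x) with he
  have hcont : ∀ w : E, Continuous fun ψ : M ≃ₘ⟮𝓘(ℝ, E), 𝓘(ℝ, E)⟯ M =>
      bundleMap ψ (⟨x, w⟩ : TangentBundle 𝓘(ℝ, E) M) := fun w =>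
    (continuous_eval_const _).comp continuous_induced_dom
  -- The base point `ψ x` is the projection of the image of the zero vector at `x`, so it varies
  -- continuously.
  have hbase : Continuous fun ψ : M ≃ₘ⟮𝓘(ℝ, E), 𝓘(ℝ, E)⟯ M => ψ x :=
    (FiberBundle.continuous_proj E (TangentSpace 𝓘(ℝ, E))).comp (hcont 0)
  have hsrc : φ x ∈ (extChartAt 𝓘(ℝ, E) (φ x)).source := mem_extChartAt_source _
  have hev : ∀ᶠ ψ in 𝓝 φ, ψ x ∈ (extChartAt 𝓘(ℝ, E) (φ x)).source :=
    hbase.continuousAt.preimage_mem_nhds ((isOpen_extChartAt_source (φ x)).mem_nhds hsrc)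
  have hmem : (⟨φ x, 0⟩ : TangentBundle 𝓘(ℝ, E) M).1 ∈ (extChartAt 𝓘(ℝ, E) (φ x)).source := hsrc
  have hv : ∀ w : E, ContinuousAt (fun ψ : M ≃ₘ⟮𝓘(ℝ, E), 𝓘(ℝ, E)⟯ M =>
      diffAt E (extChartAt 𝓘(ℝ, E) (φ x)) (ψ x) (diffAt E ψ x w)) φ := by
    intro w
    -- The trivialization at `φ x` makes image vectors in different tangent spaces comparable; its
    -- second component is the derivative of the chart applied to them.
    have h1 : ContinuousAt (fun ψ : M ≃ₘ⟮𝓘(ℝ, E), 𝓘(ℝ, E)⟯ M =>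
        (e (bundleMap ψ (⟨x, w⟩ : TangentBundle 𝓘(ℝ, E) M))).2) φ := by
      refine continuous_snd.continuousAt.comp
        (ContinuousAt.comp (f := fun ψ : M ≃ₘ⟮𝓘(ℝ, E), 𝓘(ℝ, E)⟯ M =>
          bundleMap ψ (⟨x, w⟩ : TangentBundle 𝓘(ℝ, E) M)) (g := e) ?_ (hcont w).continuousAt)
      refine e.continuousOn.continuousAt (e.open_source.mem_nhds ?_)
      rw [e.mem_source]
      exact mem_chart_source E (φ x)
    refine h1.congr_of_eventuallyEq ?_
    filter_upwards [hev] with ψ hψ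
    exact (trivialization_snd (φ x) hψ (diffAt E ψ x w)).symm
  have hchart : ContinuousAt (fun ψ : M ≃ₘ⟮𝓘(ℝ, E), 𝓘(ℝ, E)⟯ M =>
      extChartAt 𝓘(ℝ, E) (φ x) (ψ x)) φ :=
    ContinuousAt.comp (f := fun ψ : M ≃ₘ⟮𝓘(ℝ, E), 𝓘(ℝ, E)⟯ M => ψ x)
      (g := extChartAt 𝓘(ℝ, E) (φ x)) (continuousAt_extChartAt' hsrc) hbase.continuousAt
  have hα' : ContinuousAt (α.inChart (φ x)) (extChartAt 𝓘(ℝ, E) (φ x) (φ x)) :=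
    (hα.differentiableAt (φ x) ((extChartAt 𝓘(ℝ, E) (φ x)).map_source hsrc)).continuousAt
  have hlim : ContinuousAt (fun ψ : M ≃ₘ⟮𝓘(ℝ, E), 𝓘(ℝ, E)⟯ M => Form.pullback ψ α x v) φ := by
    have h1 : ContinuousAt (fun ψ : M ≃ₘ⟮𝓘(ℝ, E), 𝓘(ℝ, E)⟯ M =>
        α.inChart (φ x) (extChartAt 𝓘(ℝ, E) (φ x) (ψ x)) fun i =>
          diffAt E (extChartAt 𝓘(ℝ, E) (φ x)) (ψ x) (diffAt E ψ x (v i))) φ :=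
      ContinuousAt.eval
        (ContinuousAt.comp (f := fun ψ : M ≃ₘ⟮𝓘(ℝ, E), 𝓘(ℝ, E)⟯ M =>
          extChartAt 𝓘(ℝ, E) (φ x) (ψ x)) (g := α.inChart (φ x)) hα' hchart)
        (continuousAt_pi.2 fun i => hv (v i))
    refine h1.congr_of_eventuallyEq ?_
    filter_upwards [hev] with ψ hψ
    exact Form.apply_eq_inChart α (φ x) hψ _
  have hne : (𝓝[S] φ).NeBot := mem_closure_iff_nhdsWithin_neBot.1 hφ
  refine tendsto_nhds_unique (hlim.tendsto.mono_left nhdsWithin_le_nhds : Tendsto _ (𝓝[S] φ) _) ?_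
  refine tendsto_const_nhds.congr' ?_
  filter_upwards [self_mem_nhdsWithin] with ψ hψ
  rw [hS ψ hψ]

namespace MetricFStructure
variable {s : ℕ} (A : MetricFStructure E s M)

/-- The bridge from analysis to algebra: invariance under the closed group becomes an infinitesimal
condition on the generators. For the converse, flows of combinations of the `ξᵢ` preserve the form,
and this survives composition and `C¹` limits. -/
theorem mem_invariantForms_iff {k : ℕ} {α : Form E M k} :
    α ∈ A.invariantForms k ↔ α.Smooth ∧ ∀ i, α.LieInv (A.ξ i) := by
  constructor
  · rintro ⟨hα, h⟩
    refine ⟨hα, fun i => ?_⟩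
    have : CompleteSpace E := FiniteDimensional.complete ℝ E
    obtain ⟨Fl, hFl⟩ := exists_isFlow (A.ξ_smooth i)
    obtain ⟨ε, hε, hs⟩ := hFl.exists_contMDiff (A.ξ_smooth i)
    refine hFl.lieInv_of_pullback (A.ξ_smooth i) hε hs hα fun t ht => ?_
    have ht' : -t ∈ Ioo (-ε) ε := ⟨by linarith [ht.2], by linarith [ht.1]⟩
    have hinv : ∀ r x, Fl (-r) (Fl r x) = x := fun r x => by
      rw [← hFl.add (A.ξ_smooth i), neg_add_cancel, hFl.zero]
    let φ : M ≃ₘ⟮𝓘(ℝ, E), 𝓘(ℝ, E)⟯ M :=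
      { toFun := Fl t
        invFun := Fl (-t)
        left_inv := hinv t
        right_inv := fun x => by simpa using hinv (-t) x
        contMDiff_toFun := hs t ht
        contMDiff_invFun := hs (-t) ht' }
    let _ : TopologicalSpace (M ≃ₘ⟮𝓘(ℝ, E), 𝓘(ℝ, E)⟯ M) := diffeoTopology
    -- The flow of `ξᵢ` at a short time `t` is the time-one map of `t ξᵢ`; it is a diffeomorphism
    -- because time `-t` is smooth as well.
    refine h φ (subset_closure (FlowGroup.flow (Pi.single i t) φ fun x => ?_))
    refine ⟨fun r => Fl (r * t) x, ?_, ?_, ?_⟩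
    · have h1 := (hFl.curve x).comp_mul t
      have h2 : (fun x => ∑ j, (Pi.single i t : Fin s → ℝ) j • A.ξ j x) = t • A.ξ i := by
        funext x
        rw [Finset.sum_eq_single i (fun j _ hj => by rw [Pi.single_eq_of_ne hj, zero_smul])
          (fun hi => absurd (Finset.mem_univ i) hi), Pi.single_eq_same]
        rfl
      rw [h2]
      exact h1
    · simp [hFl.zero]
    · change Fl (1 * t) x = Fl t x
      rw [one_mul]
  · rintro ⟨hα, h⟩
    refine ⟨hα, fun φ hφ => Form.pullback_eq_of_mem_closure hα (fun ψ hψ => ?_) hφ⟩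
    induction hψ with
    | flow c ψ hψ =>
      exact Form.LieInv.pullback_timeOneMap (SmoothField.sum_smul A.ξ_smooth c) hα
        (Form.LieInv.congr_sum A.ξ_smooth h c) hψ
    | comp φ ψ _ _ h1 h2 =>
      funext x
      have h3 := Form.pullback_comp_apply (x := x) (ψ.contMDiff_toFun.mdifferentiable (by norm_num) _)
        (φ.contMDiff_toFun.mdifferentiable (by norm_num) _) α
      refine Eq.trans h3 ?_
      refine (congrArg (fun β => Form.pullback φ β x) h2).trans ?_
      exact congrFun h1 x

end MetricFStructure
end AlmostK
end

/-! ### Contractions and exterior products of invariant forms -/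

noncomputable section
set_option maxSynthPendingDepth 3
namespace AlmostK
open FormCalculus
variable {E : Type*} [NormedAddCommGroup E] [NormedSpace ℝ E]
  {M : Type*} [TopologicalSpace M] [ChartedSpace E M]

namespace Form

theorem contract_contract {k : ℕ} (X Y : ∀ x : M, TangentSpace 𝓘(ℝ, E) x) (α : Form E M (k + 2)) :
    contract X (contract Y α) = -contract Y (contract X α) := by
  funext x
  ext u
  have key : ∀ a b : E, α x (Fin.cons b (Fin.cons a u)) = -α x (Fin.cons a (Fin.cons b u)) := by
    intro a b
    have h := (α x).map_swap (Fin.cons a (Fin.cons b u) : Fin (k + 2) → E)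
      (i := 0) (j := 1) (by simp)
    refine Eq.trans (congrArg (α x) (funext fun i => ?_)) h
    refine Fin.cases ?_ (fun i => Fin.cases ?_ (fun i => ?_) i) i
    · simp
    · simp
    · rw [Function.comp_apply, Equiv.swap_apply_of_ne_of_ne]
      · rfl
      · exact Fin.succ_ne_zero _
      · exact fun h => Fin.succ_ne_zero _ (Fin.succ_injective _ h)
  exact key (X x) (Y x)

theorem wedge_cons {k : ℕ} (η : Form E M 1) (β : Form E M (k + 1)) (x : M) (a : E)
    (u : Fin (k + 1) → E) : wedge η β x (Fin.cons a u) = η x (fun _ => a) * β x u -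
      ∑ i : Fin (k + 1), (-1 : ℝ) ^ (i : ℕ) *
        (η x (fun _ => u i) * β x (Fin.cons a (i.removeNth u))) := by
  rw [wedge_apply, Fin.sum_univ_succ, sub_eq_add_neg, ← Finset.sum_neg_distrib]
  congr 1
  · simp
  · refine Finset.sum_congr rfl fun i _ => ?_
    have h2 : i.succ.removeNth (Fin.cons a u : Fin (k + 2) → E) =
        (Fin.cons a (i.removeNth u) : Fin (k + 1) → E) := by
      funext j
      refine Fin.cases ?_ (fun j => ?_) j <;> simp [Fin.removeNth]
    rw [h2, Fin.cons_succ, Fin.val_succ, pow_succ]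
    ring

theorem wedge_cons_zero (η : Form E M 1) (β : Form E M 0) (x : M) (a : E)
    (u : Fin 0 → E) : wedge η β x (Fin.cons a u) = η x (fun _ => a) * β x u := by
  rw [wedge_apply, Fin.sum_univ_succ]
  simp

theorem contract_wedge {k : ℕ} (X : ∀ x : M, TangentSpace 𝓘(ℝ, E) x) (η : Form E M 1)
    (β : Form E M (k + 1)) (c : ℝ) (hc : ∀ x, η x (fun _ => X x) = c) :
    contract X (wedge η β) = c • β - wedge η (contract X β) := by
  funext x
  ext u
  refine (wedge_cons η β x (X x) u).trans ?_
  rw [hc x]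
  change _ = c * β x u - wedge η (contract X β) x u
  rw [wedge_apply]
  rfl

theorem contract_wedge_zero (X : ∀ x : M, TangentSpace 𝓘(ℝ, E) x) (η : Form E M 1)
    (β : Form E M 0) (c : ℝ) (hc : ∀ x, η x (fun _ => X x) = c) :
    contract X (wedge η β) = c • β := by
  funext x
  ext u
  refine (wedge_cons_zero η β x (X x) u).trans ?_
  rw [hc x]
  rfl

theorem wedge_add {k : ℕ} (η : Form E M 1) (α β : Form E M k) :
    wedge η (α + β) = wedge η α + wedge η β := by
  funext x
  ext u
  change _ = wedge η α x u + wedge η β x u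
  simp only [wedge_apply, ← Finset.sum_add_distrib]
  refine Finset.sum_congr rfl fun i _ => ?_
  have h1 : (α + β) x (i.removeNth u) = α x (i.removeNth u) + β x (i.removeNth u) := rfl
  rw [h1]
  ring

theorem wedge_smul {k : ℕ} (η : Form E M 1) (c : ℝ) (β : Form E M k) :
    wedge η (c • β) = c • wedge η β := by
  funext x
  ext u
  change _ = c * wedge η β x u
  simp only [wedge_apply, Finset.mul_sum]
  refine Finset.sum_congr rfl fun i _ => ?_
  have h1 : (c • β) x (i.removeNth u) = c * β x (i.removeNth u) := rfl
  rw [h1]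
  ring

theorem d_zero {k : ℕ} : (0 : Form E M k).d = 0 := by
  simpa using Form.d_smul (0 : ℝ) (0 : Form E M k)

/-- The derivative of a constant function vanishes. -/
theorem d_const {α : Form E M 0} (c : ℝ) (h : ∀ x u, α x u = c) : α.d = 0 := by
  funext x
  have h1 : α.inChart x = fun _ => ContinuousAlternatingMap.constOfIsEmpty ℝ E (Fin 0) c := by
    funext y
    ext u
    exact h _ _
  have h2 : extDeriv (α.inChart x) = 0 := by
    funext y
    ext u
    rw [h1, extDeriv_eq_sum]
    simp
  simp only [d, h2]
  rfl

end Form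

variable [IsManifold 𝓘(ℝ, E) ∞ M]

namespace MetricFStructure
variable {s : ℕ} (A : MetricFStructure E s M)

theorem eq_sum_of_f_eq_zero {x : M} {v : TangentSpace 𝓘(ℝ, E) x} (hv : A.f x v = 0) :
    v = ∑ k, A.η k x (fun _ => v) • A.ξ k x := by
  have h := A.f_sq x v
  rw [hv, map_zero] at h
  exact (neg_add_eq_zero.1 h.symm)

theorem fundamentalForm_apply (x : M) (v : Fin 2 → E) :
    A.fundamentalForm x v = A.g.inner x (v 0) (A.f x (v 1)) := rfl

theorem fundamentalForm_horizontal : A.Horizontal A.fundamentalForm := by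
  intro x v i hi
  rw [fundamentalForm_apply]
  have key : ∀ a b : TangentSpace 𝓘(ℝ, E) x, A.f x a = 0 ∨ A.f x b = 0 →
      A.g.inner x a (A.f x b) = 0 := by
    rintro a b (h | h)
    · rw [A.compatible, h]
      simp [A.η_f]
    · rw [h, map_zero]
  refine key _ _ ?_
  fin_cases i
  · exact Or.inl hi
  · exact Or.inr hi

/-- Transverse nondegeneracy of `F`. Testing with `w = f v` gives `g(v, f² v) = g(f v, f³ v) = -g(f
v, f v)`, and the metric is positive. -/
theorem f_eq_zero_of_inner {x : M} {v : TangentSpace 𝓘(ℝ, E) x}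
    (h : ∀ w, A.g.inner x v (A.f x w) = 0) : A.f x v = 0 := by
  by_contra hne
  have h1 := h (A.f x v)
  rw [A.compatible, eq_neg_of_add_eq_zero_left (A.f_cube x v)] at h1
  simp only [A.η_f, mul_zero, Finset.sum_const_zero, add_zero, map_neg, neg_eq_zero] at h1
  exact (A.g.pos x _ hne).ne' h1

/-- The form vanishes when its first `j` arguments are tangent to the leaves; there is no condition
if `j` exceeds the degree. -/
def VanishesOnVertical {m : ℕ} (j : ℕ) (α : Form E M m) : Prop :=
  j ≤ m → ∀ (x : M) (v : Fin m → E), (∀ i : Fin m, (i : ℕ) < j → A.f x (v i) = 0) → α x v = 0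

variable {A}

namespace VanishesOnVertical

protected theorem zero {m j : ℕ} : A.VanishesOnVertical j (0 : Form E M m) := fun _ _ _ _ => rfl

theorem add {m j : ℕ} {α β : Form E M m} (hα : A.VanishesOnVertical j α)
    (hβ : A.VanishesOnVertical j β) : A.VanishesOnVertical j (α + β) := by
  intro hj x v hv
  have h1 : (α + β) x v = α x v + β x v := rfl
  rw [h1, hα hj x v hv, hβ hj x v hv, add_zero]

theorem smul {m j : ℕ} {α : Form E M m} (c : ℝ) (hα : A.VanishesOnVertical j α) :
    A.VanishesOnVertical j (c • α) := by
  intro hj x v hv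
  have h1 : (c • α) x v = c * α x v := rfl
  rw [h1, hα hj x v hv, mul_zero]

theorem neg {m j : ℕ} {α : Form E M m} (hα : A.VanishesOnVertical j α) :
    A.VanishesOnVertical j (-α) := by
  simpa using hα.smul (-1)

theorem sub {m j : ℕ} {α β : Form E M m} (hα : A.VanishesOnVertical j α)
    (hβ : A.VanishesOnVertical j β) : A.VanishesOnVertical j (α - β) := by
  rw [sub_eq_add_neg]
  exact hα.add hβ.neg

theorem of_lt {m j : ℕ} (h : m < j) (α : Form E M m) : A.VanishesOnVertical j α :=
  fun hj => absurd hj (by omega)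

end VanishesOnVertical

theorem vanishesOnVertical_zero_iff {m : ℕ} {α : Form E M m} :
    A.VanishesOnVertical 0 α ↔ α = 0 := by
  constructor
  · intro h
    funext x
    ext v
    exact h (Nat.zero_le _) x v fun i hi => absurd hi (Nat.not_lt_zero _)
  · rintro rfl
    exact VanishesOnVertical.zero

/-- A vertical vector is a combination of the `ξᵢ`, so it suffices to insert these in the first
slot. This reduces statements about the filtration to induction on `j` by contraction. -/
theorem vanishesOnVertical_succ_iff {m j : ℕ} {α : Form E M (m + 1)} :
    A.VanishesOnVertical (j + 1) α ↔ ∀ i, A.VanishesOnVertical j (Form.contract (A.ξ i) α) := by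
  constructor
  · intro h i hj x u hu
    refine h (by omega) x _ fun l => ?_
    refine Fin.cases ?_ (fun l => ?_) l
    · intro _
      exact A.f_ξ i x
    · intro hl
      exact hu l (by simpa using hl)
  · intro h hj x v hv
    have h0 := A.eq_sum_of_f_eq_zero (hv 0 (Nat.succ_pos j))
    rw [← Fin.cons_self_tail v]
    have h1 : ∀ (L : E →L[ℝ] E [⋀^Fin m]→L[ℝ] ℝ) (c : Fin s → ℝ) (w : Fin s → E) (z : E),
        z = ∑ k, c k • w k → (∀ k, L (w k) (Fin.tail v) = 0) → L z (Fin.tail v) = 0 := by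
      rintro L c w z rfl hw
      rw [map_sum, ContinuousAlternatingMap.sum_apply]
      refine Finset.sum_eq_zero fun k _ => ?_
      rw [map_smul, ContinuousAlternatingMap.smul_apply, hw, smul_zero]
    refine h1 (α x).curryLeft (fun k => A.η k x fun _ => v 0) (fun k => A.ξ k x) (v 0) h0 fun k => ?_
    exact h k (by omega) x (Fin.tail v) fun i hi => hv i.succ (by simpa using hi)

theorem vanishesOnVertical_one_iff {m : ℕ} {α : Form E M m} :
    A.VanishesOnVertical 1 α ↔ A.Horizontal α := by
  constructor
  · intro h x v i hi
    obtain ⟨m, rfl⟩ : ∃ k, m = k + 1 := ⟨m - 1, by have := i.2; omega⟩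
    rw [← Fin.insertNth_self_removeNth i v, ContinuousAlternatingMap.map_insertNth]
    have := h (by omega) x (Matrix.vecCons (v i) (i.removeNth v)) fun l hl => by
      have : l = 0 := Fin.ext (by simpa using hl)
      rw [this]
      exact hi
    rw [this, smul_zero]
  · intro h hj x v hv
    exact h x v ⟨0, by omega⟩ (hv _ (by simp))

theorem contract_eq_zero_of_horizontal {m : ℕ} {α : Form E M (m + 1)} (h : A.Horizontal α) (i : Fin s) :
    Form.contract (A.ξ i) α = 0 :=
  vanishesOnVertical_zero_iff.1 (vanishesOnVertical_succ_iff.1 (vanishesOnVertical_one_iff.2 h) i)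

/-- The truncation `toNat` encodes the boundary cases: for `k > m` it gives `0`, which forces the
form to vanish, and for `k ≤ 0` it exceeds the degree, so there is no condition. -/
theorem mem_filtration_iff {m : ℕ} {k : ℤ} {α : A.invariantForms m} :
    α ∈ A.filtration k m ↔ A.VanishesOnVertical (m - k + 1).toNat (α : Form E M m) := by
  constructor
  · intro h hj x v hv
    exact h (by omega) x v fun i hi => hv i (by omega)
  · intro h hk x v hv
    exact h (by omega) x v fun i hi => hv i (by omega)

variable (A)

/-- The fundamental form is closed and the `dηᵢ` vanish on the leaves. -/
structure HasHorizontalDifferentials : Prop where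
  closed : A.fundamentalForm.d = 0
  d_η : ∀ i, A.Horizontal (A.η i).d

variable {A}

theorem hasHorizontalDifferentials (hA : A.IsAlmostS ∨ (A.IsAlmostK ∧ ∀ i, A.IsBasic (A.η i).d)) :
    A.HasHorizontalDifferentials := by
  rcases hA with hA | hA
  · exact ⟨hA.closed, fun i => by rw [hA.d_η i]; exact A.fundamentalForm_horizontal⟩
  · exact ⟨hA.1.closed, fun i => (hA.2 i).1⟩

theorem d_contract_η (i j : Fin s) : (Form.contract (A.ξ j) (A.η i)).d = 0 := by
  refine Form.d_const (if i = j then 1 else 0) fun x u => ?_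
  rw [Form.contract_apply, ← A.η_ξ i j x]
  congr 1
  funext l
  rw [Subsingleton.elim (α := Fin 1) l 0]
  rfl

namespace HasHorizontalDifferentials

theorem lieInv_η (hA : A.HasHorizontalDifferentials) (i j : Fin s) :
    (A.η i).LieInv (A.ξ j) := by
  rw [Form.lieInv_iff (A.ξ_smooth j) (A.η_smooth i), d_contract_η,
    contract_eq_zero_of_horizontal (hA.d_η i), neg_zero]

variable [FiniteDimensional ℝ E]

theorem lieInv_fundamentalForm (hA : A.HasHorizontalDifferentials) (j : Fin s) :
    A.fundamentalForm.LieInv (A.ξ j) := by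
  rw [Form.lieInv_iff (A.ξ_smooth j) A.fundamentalForm_smooth,
    contract_eq_zero_of_horizontal A.fundamentalForm_horizontal, hA.closed, Form.d_zero, neg_zero]
  rfl

/-- The fields `ξᵢ` commute. -/
theorem localField_bracket (hA : A.HasHorizontalDifferentials) (i j : Fin s) (x₀ : M) {y : E}
    (hy : y ∈ (extChartAt 𝓘(ℝ, E) x₀).target) :
    fderiv ℝ (localField (A.ξ j) x₀) y (localField (A.ξ i) x₀ y) -
      fderiv ℝ (localField (A.ξ i) x₀) y (localField (A.ξ j) x₀ y) = 0 := by
  set z := fderiv ℝ (localField (A.ξ j) x₀) y (localField (A.ξ i) x₀ y) -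
      fderiv ℝ (localField (A.ξ i) x₀) y (localField (A.ξ j) x₀ y) with hz
  set x := (extChartAt 𝓘(ℝ, E) x₀).symm y
  set Z := diffAt E (extChartAt 𝓘(ℝ, E) x₀).symm y z with hZ
  -- Since `[L_{ξᵢ}, i_{ξⱼ}]` is contraction with the bracket, whose chart expression is `z`, that
  -- contraction kills `α` whenever `α` and `i_{ξⱼ} α` are both invariant along `ξᵢ`.
  have key : ∀ {k : ℕ} {α : Form E M (k + 1)}, α.Smooth → α.LieInv (A.ξ i) →
      (Form.contract (A.ξ j) α).LieInv (A.ξ i) → ∀ u,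
        α.inChart x₀ y (Fin.cons z u) = 0 := by
    intro k α hα h1 h2 u
    have h3 := lieDeriv_interior (v := localField (A.ξ i) x₀) (hα.differentiableAt x₀ hy)
      ((A.ξ_smooth j).differentiableAt_localField x₀ hy) u
    rw [h1 x₀ y hy, add_zero, ← lieDeriv_congr (EventuallyEq.refl _ _)
      (Form.eventuallyEq_inChart_contract (A.ξ j) α x₀ hy), h2 x₀ y hy] at h3
    exact h3.symm
  have hη : ∀ k, A.η k x (fun _ => Z) = 0 := by
    intro k
    have hs : (Form.contract (A.ξ j) (A.η k)).Smooth := (A.η_smooth k).contract (A.ξ_smooth j)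
    have h1 := key (A.η_smooth k) (hA.lieInv_η k i)
      ((Form.lieInv_zero_iff hs).2 (by rw [d_contract_η]; rfl)) 0
    refine Eq.trans ?_ h1
    rw [Form.inChart_apply]
    congr 1
    funext l
    rw [Subsingleton.elim (α := Fin 1) l 0]
    rfl
  have hF : ∀ w : TangentSpace 𝓘(ℝ, E) x, A.g.inner x Z (A.f x w) = 0 := by
    intro w
    have h0 : Form.contract (A.ξ j) A.fundamentalForm = 0 :=
      contract_eq_zero_of_horizontal A.fundamentalForm_horizontal j
    have h1 := key A.fundamentalForm_smooth (hA.lieInv_fundamentalForm i) (by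
      rw [h0, Form.lieInv_iff (A.ξ_smooth i) Form.smooth_zero, Form.d_zero]
      have : Form.contract (A.ξ i) (0 : Form E M 1) = 0 := rfl
      rw [this, Form.d_zero, neg_zero]
      rfl) (fun _ => diffAt E (extChartAt 𝓘(ℝ, E) x₀) x w)
    have h2 := diffAt_symm_comp_chart x₀ ((extChartAt 𝓘(ℝ, E) x₀).map_target hy) w
    rw [(extChartAt 𝓘(ℝ, E) x₀).right_inv hy] at h2
    have h3 : A.g.inner x Z (A.f x (diffAt E (extChartAt 𝓘(ℝ, E) x₀).symm y
      (diffAt E (extChartAt 𝓘(ℝ, E) x₀) x w))) = 0 := h1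
    exact (congrArg (fun w' => A.g.inner x Z (A.f x w')) h2).symm.trans h3
  -- Annihilated by `F`, the bracket is vertical; annihilated by every `η_k`, it has no component
  -- along any `ξ_k`.
  have hZ0 : Z = 0 := by
    refine (A.eq_sum_of_f_eq_zero (x := x) (v := Z) (A.f_eq_zero_of_inner hF)).trans ?_
    exact Finset.sum_eq_zero fun k _ => by rw [hη k, zero_smul]
  rw [← diffAt_chart_comp_symm x₀ hy z, ← hZ, hZ0, map_zero]

/-- As the fields commute, `L_{ξᵢ}` commutes with `i_{ξⱼ}`. -/
theorem lieInv_contract (hA : A.HasHorizontalDifferentials) {m : ℕ} {α : Form E M (m + 1)}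
    (hα : α.Smooth) (i j : Fin s) (h : α.LieInv (A.ξ i)) :
    (Form.contract (A.ξ j) α).LieInv (A.ξ i) := by
  intro x₀ y hy u
  rw [lieDeriv_congr (EventuallyEq.refl _ _) (Form.eventuallyEq_inChart_contract (A.ξ j) α x₀ hy),
    lieDeriv_interior (hα.differentiableAt x₀ hy) ((A.ξ_smooth j).differentiableAt_localField x₀ hy),
    hA.localField_bracket i j x₀ hy, h x₀ y hy, add_zero]
  exact (α.inChart x₀ y).map_coord_zero 0 (by simp)

end HasHorizontalDifferentials

/-- A smooth form is basic if and only if it is horizontal and invariant. -/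
theorem isBasic_iff {m : ℕ} {α : Form E M m} (hα : α.Smooth) :
    A.IsBasic α ↔ A.Horizontal α ∧ ∀ i, α.LieInv (A.ξ i) := by
  refine and_congr_right fun h => ?_
  have h1 : A.Horizontal α.d ↔ ∀ i, Form.contract (A.ξ i) α.d = 0 := by
    rw [← vanishesOnVertical_one_iff, vanishesOnVertical_succ_iff]
    simp only [vanishesOnVertical_zero_iff]
  rw [h1]
  refine forall_congr' fun i => ?_
  cases m with
  | zero => rw [Form.lieInv_zero_iff hα]
  | succ m =>
    rw [Form.lieInv_iff (A.ξ_smooth i) hα, contract_eq_zero_of_horizontal h, Form.d_zero, neg_zero]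

end MetricFStructure
end AlmostK
end

/-! ### The algebra of contractions, products and differentials on invariant forms. -/

noncomputable section
set_option maxSynthPendingDepth 3
namespace AlmostK
namespace MetricFStructure
variable {E : Type*} [NormedAddCommGroup E] [NormedSpace ℝ E] [FiniteDimensional ℝ E]
  {M : Type*} [TopologicalSpace M] [ChartedSpace E M] [IsManifold 𝓘(ℝ, E) ∞ M]
  [T2Space M] [CompactSpace M] {s : ℕ} {A : MetricFStructure E s M}

namespace HasHorizontalDifferentials
variable (hA : A.HasHorizontalDifferentials)

/-- Contraction with `ξᵢ` on invariant forms. -/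
def contr (i : Fin s) (m : ℕ) : A.invariantForms (m + 1) →ₗ[ℝ] A.invariantForms m where
  toFun α := ⟨Form.contract (A.ξ i) α, (A.mem_invariantForms_iff).2
    ⟨α.2.1.contract (A.ξ_smooth i), fun j =>
      hA.lieInv_contract α.2.1 j i ((A.mem_invariantForms_iff.1 α.2).2 j)⟩⟩
  map_add' _ _ := rfl
  map_smul' _ _ := rfl

/-- The exterior product with `ηᵢ` on invariant forms. -/
def wedgeEta (i : Fin s) (m : ℕ) : A.invariantForms m →ₗ[ℝ] A.invariantForms (m + 1) where
  toFun α := ⟨Form.wedge (A.η i) α, (A.η_smooth i).wedge α.2.1, fun φ hφ => by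
    have hη : A.η i ∈ A.invariantForms 1 :=
      A.mem_invariantForms_iff.2 ⟨A.η_smooth i, fun j => hA.lieInv_η i j⟩
    rw [Form.wedge_pullback_apply, hη.2 φ hφ, α.2.2 φ hφ]⟩
  map_add' α β := Subtype.ext (Form.wedge_add _ _ _)
  map_smul' c α := Subtype.ext (Form.wedge_smul _ _ _)

/-- Cartan's formula with vanishing Lie derivative. -/
theorem contr_d (i : Fin s) {m : ℕ} (α : A.invariantForms (m + 1)) :
    hA.contr i (m + 1) (A.invariantD (m + 1) α) = -A.invariantD m (hA.contr i m α) :=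
  Subtype.ext ((Form.lieInv_iff (A.ξ_smooth i) α.2.1).1 ((A.mem_invariantForms_iff.1 α.2).2 i))

theorem contr_d_zero (i : Fin s) (α : A.invariantForms 0) :
    hA.contr i 0 (A.invariantD 0 α) = 0 :=
  Subtype.ext ((Form.lieInv_zero_iff α.2.1).1 ((A.mem_invariantForms_iff.1 α.2).2 i))

theorem contr_contr (i j : Fin s) {m : ℕ} (α : A.invariantForms (m + 2)) :
    hA.contr i m (hA.contr j (m + 1) α) = -hA.contr j m (hA.contr i (m + 1) α) :=
  Subtype.ext (Form.contract_contract (A.ξ i) (A.ξ j) (α : Form E M (m + 2)))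

theorem contr_wedgeEta (i j : Fin s) {m : ℕ} (α : A.invariantForms (m + 1)) :
    hA.contr i (m + 1) (hA.wedgeEta j (m + 1) α) =
      (if j = i then (1 : ℝ) else 0) • α - hA.wedgeEta j m (hA.contr i m α) :=
  Subtype.ext (Form.contract_wedge (A.ξ i) (A.η j) (α : Form E M (m + 1)) _ fun x => A.η_ξ j i x)

theorem contr_wedgeEta_zero (i j : Fin s) (α : A.invariantForms 0) :
    hA.contr i 0 (hA.wedgeEta j 0 α) = (if j = i then (1 : ℝ) else 0) • α :=
  Subtype.ext (Form.contract_wedge_zero (A.ξ i) (A.η j) (α : Form E M 0) _ fun x => A.η_ξ j i x)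

-- Since `d` anticommutes with contractions, it does not increase the number of vertical arguments
-- that a form admits.
include hA in
theorem vanishes_d {j : ℕ} : ∀ {m : ℕ} {α : A.invariantForms m},
    A.VanishesOnVertical j (α : Form E M m) →
      A.VanishesOnVertical j (A.invariantD m α : Form E M (m + 1)) := by
  induction j with
  | zero =>
    intro m α h
    have h0 : α = 0 := Subtype.ext (vanishesOnVertical_zero_iff.1 h)
    rw [h0, map_zero]
    exact VanishesOnVertical.zero
  | succ j ih =>
    intro m α h
    refine vanishesOnVertical_succ_iff.2 fun i => ?_
    cases m with
    | zero =>
      change A.VanishesOnVertical j (hA.contr i 0 (A.invariantD 0 α) : Form E M 0)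
      rw [contr_d_zero]
      exact VanishesOnVertical.zero
    | succ m =>
      change A.VanishesOnVertical j (hA.contr i (m + 1) (A.invariantD (m + 1) α) : Form E M (m + 1))
      rw [contr_d]
      exact (ih (α := hA.contr i m α) (vanishesOnVertical_succ_iff.1 h i)).neg

theorem vanishes_wedgeEta {j : ℕ} (k : Fin s) : ∀ {m : ℕ} {α : A.invariantForms m},
    A.VanishesOnVertical j (α : Form E M m) →
      A.VanishesOnVertical (j + 1) (hA.wedgeEta k m α : Form E M (m + 1)) := by
  induction j with
  | zero =>
    intro m α h
    have h0 : α = 0 := Subtype.ext (vanishesOnVertical_zero_iff.1 h)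
    rw [h0, map_zero]
    exact VanishesOnVertical.zero
  | succ j ih =>
    intro m α h
    refine vanishesOnVertical_succ_iff.2 fun i => ?_
    cases m with
    | zero =>
      change A.VanishesOnVertical (j + 1) (hA.contr i 0 (hA.wedgeEta k 0 α) : Form E M 0)
      rw [contr_wedgeEta_zero]
      exact h.smul _
    | succ m =>
      change A.VanishesOnVertical (j + 1)
        (hA.contr i (m + 1) (hA.wedgeEta k (m + 1) α) : Form E M (m + 1))
      rw [contr_wedgeEta]
      exact (h.smul _).sub (ih (α := hA.contr i m α) (vanishesOnVertical_succ_iff.1 h i))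

/-- The form `dηₖ ∧ α = d(ηₖ ∧ α) + ηₖ ∧ dα`. -/
def wedgeDEta (k : Fin s) (m : ℕ) : A.invariantForms m →ₗ[ℝ] A.invariantForms (m + 2) :=
  A.invariantD (m + 1) ∘ₗ hA.wedgeEta k m + hA.wedgeEta k (m + 1) ∘ₗ A.invariantD m

theorem wedgeDEta_apply (k : Fin s) (m : ℕ) (α : A.invariantForms m) : hA.wedgeDEta k m α =
    A.invariantD (m + 1) (hA.wedgeEta k m α) + hA.wedgeEta k (m + 1) (A.invariantD m α) := rfl

/-- This expresses that `dηₖ` is horizontal. Expanding with the anticommutation rules, the two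
Kronecker terms cancel because `ηₖ(ξᵢ)` is constant. -/
theorem contr_wedgeDEta (i k : Fin s) {m : ℕ} (α : A.invariantForms (m + 1)) :
    hA.contr i (m + 2) (hA.wedgeDEta k (m + 1) α) = hA.wedgeDEta k m (hA.contr i m α) := by
  simp only [wedgeDEta_apply, map_add, contr_d, contr_wedgeEta, map_sub, map_smul, map_neg]
  abel

theorem contr_wedgeDEta_zero (i k : Fin s) (α : A.invariantForms 0) :
    hA.contr i 1 (hA.wedgeDEta k 0 α) = 0 := by
  simp only [wedgeDEta_apply, map_add, contr_d, contr_wedgeEta, contr_wedgeEta_zero, contr_d_zero,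
    map_smul, map_zero]
  abel

/-- In contrast to `vanishes_wedgeEta`, the index `j` does not grow while the degree grows by two;
this becomes the shift of the filtration by `2`. -/
theorem vanishes_wedgeDEta {j : ℕ} (k : Fin s) : ∀ {m : ℕ} {α : A.invariantForms m},
    A.VanishesOnVertical j (α : Form E M m) →
      A.VanishesOnVertical j (hA.wedgeDEta k m α : Form E M (m + 2)) := by
  induction j with
  | zero =>
    intro m α h
    have h0 : α = 0 := Subtype.ext (vanishesOnVertical_zero_iff.1 h)
    rw [h0, map_zero]
    exact VanishesOnVertical.zero
  | succ j ih =>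
    intro m α h
    refine vanishesOnVertical_succ_iff.2 fun i => ?_
    cases m with
    | zero =>
      change A.VanishesOnVertical j (hA.contr i 1 (hA.wedgeDEta k 0 α) : Form E M 1)
      rw [contr_wedgeDEta_zero]
      exact VanishesOnVertical.zero
    | succ m =>
      change A.VanishesOnVertical j
        (hA.contr i (m + 2) (hA.wedgeDEta k (m + 1) α) : Form E M (m + 2))
      rw [contr_wedgeDEta]
      exact ih (α := hA.contr i m α) (vanishesOnVertical_succ_iff.1 h i)

/-- The operator `∑ ηᵢ ∧ i_{ξᵢ}`. -/
def number : ∀ m, A.invariantForms m →ₗ[ℝ] A.invariantForms m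
  | 0 => 0
  | m + 1 => ∑ i, hA.wedgeEta i m ∘ₗ hA.contr i m

theorem number_succ_apply {m : ℕ} (α : A.invariantForms (m + 1)) :
    hA.number (m + 1) α = ∑ i, hA.wedgeEta i m (hA.contr i m α) := by
  simp [number]

/-- The ladder relation of a number operator with its annihilation operators, `i_{ξⱼ} N = (N + 1)
i_{ξⱼ}`. -/
theorem contr_number (j : Fin s) {m : ℕ} (α : A.invariantForms (m + 1)) :
    hA.contr j m (hA.number (m + 1) α) = hA.contr j m α + hA.number m (hA.contr j m α) := by
  rw [number_succ_apply, map_sum]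
  cases m with
  | zero =>
    simp only [contr_wedgeEta_zero, number, ite_smul, one_smul, zero_smul, LinearMap.zero_apply,
      add_zero]
    rw [Finset.sum_ite_eq']
    simp
  | succ m =>
    simp only [contr_wedgeEta, number_succ_apply, Finset.sum_sub_distrib, ite_smul, one_smul, zero_smul]
    rw [Finset.sum_ite_eq', if_pos (Finset.mem_univ j), sub_eq_add_neg, ← Finset.sum_neg_distrib]
    congr 1
    refine Finset.sum_congr rfl fun i _ => ?_
    rw [contr_contr, map_neg, neg_neg]

/-- On forms with at most `q` vertical arguments, `∑ ηᵢ ∧ i_{ξᵢ}` is multiplication by `q` up to forms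
with fewer than `q` vertical arguments. -/
theorem vanishes_number_sub {q : ℕ} : ∀ {m : ℕ} {α : A.invariantForms m},
    A.VanishesOnVertical (q + 1) (α : Form E M m) →
      A.VanishesOnVertical q (hA.number m α - (q : ℝ) • α : A.invariantForms m).1 := by
  induction q with
  | zero =>
    intro m α h
    refine vanishesOnVertical_zero_iff.2 (congrArg Subtype.val (?_ : _ = (0 : A.invariantForms m)))
    rw [Nat.cast_zero, zero_smul, sub_zero]
    cases m with
    | zero => rfl
    | succ m =>
      rw [number_succ_apply]
      refine Finset.sum_eq_zero fun i _ => ?_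
      have h0 : hA.contr i m α = 0 :=
        Subtype.ext (vanishesOnVertical_zero_iff.1 (vanishesOnVertical_succ_iff.1 h i))
      rw [h0, map_zero]
  | succ q ih =>
    intro m α h
    cases m with
    | zero => exact VanishesOnVertical.of_lt (Nat.succ_pos q) _
    | succ m =>
      refine vanishesOnVertical_succ_iff.2 fun i => ?_
      change A.VanishesOnVertical q
        (hA.contr i m (hA.number (m + 1) α - ((q + 1 : ℕ) : ℝ) • α) : A.invariantForms m).1
      -- By the ladder relation, `i_ξ (N - (q + 1)) = (N - q) i_ξ`, which is the induction
      -- hypothesis on the contraction.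
      have h1 : hA.contr i m (hA.number (m + 1) α - ((q + 1 : ℕ) : ℝ) • α) =
          hA.number m (hA.contr i m α) - (q : ℝ) • hA.contr i m α := by
        rw [map_sub, contr_number, map_smul]
        push_cast
        rw [add_smul, one_smul]
        abel
      rw [h1]
      exact ih (vanishesOnVertical_succ_iff.1 h i)

/-! #### The filtration -/

end HasHorizontalDifferentials

variable (A) in
/-- The space `d (F^k)` of invariant forms. -/
def exactForms (k : ℤ) : ∀ m, Submodule ℝ (A.invariantForms m)
  | 0 => ⊥
  | m + 1 => (A.filtration k m).map (A.invariantD m)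

variable (A) in
/-- The space `Z_2` of the spectral sequence of invariant forms. -/
def cyclesTwo (p : ℤ) (m : ℕ) : Submodule ℝ (A.invariantForms m) :=
  A.filtration p m ⊓ (A.filtration (p + (2 : ℕ)) (m + 1)).comap (A.invariantD m)

variable (A) in
/-- The space of boundaries in the second page of the spectral sequence of invariant forms. -/
def boundariesTwo (p : ℤ) (m : ℕ) : Submodule ℝ (A.invariantForms m) :=
  A.filtration (p + 1) m ⊔ A.exactForms (p - (2 : ℕ) + 1) m

omit [FiniteDimensional ℝ E] [T2Space M] [CompactSpace M] in
theorem boundariesTwo_eq (p : ℤ) (m : ℕ) :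
    A.invariantComplex.boundaries 2 p m = A.boundariesTwo p m := by
  cases m <;> rfl

namespace HasHorizontalDifferentials
variable (hA : A.HasHorizontalDifferentials)

-- The degree rises by one with the same bound on vertical arguments, hence the filtration index
-- rises by one. This is why `d₀` vanishes.
include hA in
theorem d_mem_filtration {p : ℤ} {m : ℕ} {α : A.invariantForms m} (h : α ∈ A.filtration p m) :
    A.invariantD m α ∈ A.filtration (p + 1) (m + 1) := by
  rw [mem_filtration_iff] at h ⊢
  have := hA.vanishes_d h
  rwa [show (((m + 1 : ℕ) : ℤ) - (p + 1) + 1).toNat = ((m : ℤ) - p + 1).toNat by congr 1; push_cast; ring]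

theorem contr_mem_filtration (i : Fin s) {p : ℤ} {m : ℕ} {α : A.invariantForms (m + 1)}
    (h : α ∈ A.filtration p (m + 1)) : hA.contr i m α ∈ A.filtration p m := by
  rw [mem_filtration_iff] at h ⊢
  -- Contraction lowers `toNat` by one except for `p > m + 1`, where it is already `0` and the form
  -- is zero.
  rcases le_or_gt 0 ((m : ℤ) - p + 1) with h0 | h0
  · rw [show (((m + 1 : ℕ) : ℤ) - p + 1).toNat = ((m : ℤ) - p + 1).toNat + 1 by omega] at h
    exact vanishesOnVertical_succ_iff.1 h i
  · rw [show (((m + 1 : ℕ) : ℤ) - p + 1).toNat = 0 by omega] at h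
    have h1 : α = 0 := Subtype.ext (vanishesOnVertical_zero_iff.1 h)
    rw [h1, map_zero]
    exact VanishesOnVertical.zero

theorem wedgeEta_mem_filtration (i : Fin s) {p : ℤ} {m : ℕ} {α : A.invariantForms m}
    (h : α ∈ A.filtration p m) : hA.wedgeEta i m α ∈ A.filtration p (m + 1) := by
  rw [mem_filtration_iff] at h ⊢
  rcases le_or_gt 0 ((m : ℤ) - p + 1) with h0 | h0
  · rw [show (((m + 1 : ℕ) : ℤ) - p + 1).toNat = ((m : ℤ) - p + 1).toNat + 1 by omega]
    exact hA.vanishes_wedgeEta i h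
  · rw [show ((m : ℤ) - p + 1).toNat = 0 by omega] at h
    have h1 : α = 0 := Subtype.ext (vanishesOnVertical_zero_iff.1 h)
    rw [h1, map_zero]
    exact VanishesOnVertical.zero

theorem wedgeDEta_mem_filtration (i : Fin s) {p : ℤ} {m : ℕ} {α : A.invariantForms m}
    (h : α ∈ A.filtration p m) : hA.wedgeDEta i m α ∈ A.filtration (p + 2) (m + 2) := by
  rw [mem_filtration_iff] at h ⊢
  rw [show (((m + 2 : ℕ) : ℤ) - (p + 2) + 1).toNat = ((m : ℤ) - p + 1).toNat by
    congr 1; push_cast; ring]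
  exact hA.vanishes_wedgeDEta i h

theorem contr_mem_cycles (i : Fin s) {p : ℤ} {m : ℕ} {α : A.invariantForms (m + 1)}
    (h : α ∈ A.cyclesTwo p (m + 1)) :
    hA.contr i m α ∈ A.cyclesTwo p m := by
  refine ⟨hA.contr_mem_filtration i h.1, ?_⟩
  have h2 : A.invariantD (m + 1) α ∈ A.filtration (p + (2 : ℕ)) (m + 2) := h.2
  have h3 := hA.contr_mem_filtration i h2
  rw [contr_d] at h3
  exact Submodule.neg_mem_iff (p := A.filtration (p + (2 : ℕ)) (m + 1)) |>.1 h3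

/-- In `d(η ∧ α) = dη ∧ α - η ∧ dα` both terms lie in `F^{p+2}`: the first because `dη` is
horizontal, the second because `dα` does. -/
theorem wedgeEta_mem_cycles (i : Fin s) {p : ℤ} {m : ℕ} {α : A.invariantForms m}
    (h : α ∈ A.cyclesTwo p m) :
    hA.wedgeEta i m α ∈ A.cyclesTwo p (m + 1) := by
  refine ⟨hA.wedgeEta_mem_filtration i h.1, ?_⟩
  have h2 : A.invariantD m α ∈ A.filtration (p + (2 : ℕ)) (m + 1) := h.2
  have h3 := hA.wedgeEta_mem_filtration i h2
  have h4 : hA.wedgeDEta i m α ∈ A.filtration (p + (2 : ℕ)) (m + 2) :=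
    hA.wedgeDEta_mem_filtration i h.1
  have h5 := Submodule.sub_mem _ h4 h3
  rw [wedgeDEta_apply, add_sub_cancel_right] at h5
  exact h5

theorem contr_mem_exactPart (i : Fin s) {k : ℤ} {m : ℕ} {α : A.invariantForms (m + 1)}
    (h : α ∈ A.exactForms k (m + 1)) :
    hA.contr i m α ∈ A.exactForms k m := by
  obtain ⟨γ, hγ, rfl⟩ := h
  cases m with
  | zero => exact (Submodule.mem_bot ℝ).2 (hA.contr_d_zero i γ)
  | succ m =>
    refine ⟨-hA.contr i m γ, Submodule.neg_mem _ (hA.contr_mem_filtration i hγ), ?_⟩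
    rw [map_neg]
    exact (hA.contr_d i γ).symm

theorem contr_mem_boundaries (i : Fin s) {p : ℤ} {m : ℕ} {α : A.invariantForms (m + 1)}
    (h : α ∈ A.boundariesTwo p (m + 1)) :
    hA.contr i m α ∈ A.boundariesTwo p m := by
  obtain ⟨β, hβ, γ, hγ, rfl⟩ := Submodule.mem_sup.1 h
  rw [map_add]
  exact Submodule.add_mem_sup (hA.contr_mem_filtration i hβ) (hA.contr_mem_exactPart i hγ)

/-- For `δ` in `F^{p-1}` one has `η ∧ dδ = dη ∧ δ - d(η ∧ δ)`, where `dη ∧ δ` lies in `F^{p+1}` and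
`η ∧ δ` in `F^{p-1}`. -/
theorem wedgeEta_mem_boundaries (i : Fin s) {p : ℤ} {m : ℕ} {α : A.invariantForms m}
    (h : α ∈ A.boundariesTwo p m) :
    hA.wedgeEta i m α ∈ A.boundariesTwo p (m + 1) := by
  obtain ⟨β, hβ, γ, hγ, rfl⟩ := Submodule.mem_sup.1 h
  rw [map_add]
  refine Submodule.add_mem _ (Submodule.mem_sup_left (hA.wedgeEta_mem_filtration i hβ)) ?_
  cases m with
  | zero =>
    have h0 : γ = 0 := (Submodule.mem_bot ℝ).1 hγ
    rw [h0, map_zero]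
    exact Submodule.zero_mem _
  | succ m =>
    obtain ⟨δ, hδ, rfl⟩ := hγ
    have h1 : hA.wedgeEta i (m + 1) (A.invariantD m δ) =
        hA.wedgeDEta i m δ + A.invariantD (m + 1) (-hA.wedgeEta i m δ) := by
      rw [wedgeDEta_apply, map_neg]
      abel
    refine Submodule.mem_sup.2 ⟨hA.wedgeDEta i m δ, ?_, A.invariantD (m + 1) (-hA.wedgeEta i m δ), ?_,
      h1.symm⟩
    · have h2 := hA.wedgeDEta_mem_filtration i hδ
      rwa [show p - ((2 : ℕ) : ℤ) + 1 + 2 = p + 1 by push_cast; ring] at h2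
    · exact ⟨_, Submodule.neg_mem _ (hA.wedgeEta_mem_filtration i hδ), rfl⟩

/-- An element of `F^p` is a boundary if all its contractions are. -/
theorem mem_boundaries_of_contr {p q : ℕ} {α : A.invariantForms (p + q + 1)}
    (hα : α ∈ A.cyclesTwo p (p + q + 1))
    (h : ∀ i, hA.contr i (p + q) α ∈ A.boundariesTwo p (p + q)) :
    α ∈ A.boundariesTwo p (p + q + 1) := by
  have h1 : hA.number (p + q + 1) α ∈ A.boundariesTwo p (p + q + 1) := by
    rw [number_succ_apply]
    exact Submodule.sum_mem _ fun i _ => hA.wedgeEta_mem_boundaries i (h i)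
  -- In bidegree `(p, q + 1)` the number operator is `q + 1` modulo `F^{p+1}`, so the nonzero factor
  -- `q + 1` can be divided out.
  have h2 : hA.number (p + q + 1) α - ((q + 1 : ℕ) : ℝ) • α ∈
      A.boundariesTwo p (p + q + 1) := by
    refine Submodule.mem_sup_left (mem_filtration_iff.2 ?_)
    rw [show (((p + q + 1 : ℕ) : ℤ) - (p + 1) + 1).toNat = q + 1 by omega]
    refine hA.vanishes_number_sub ?_
    have h3 := mem_filtration_iff.1 hα.1
    rwa [show (((p + q + 1 : ℕ) : ℤ) - p + 1).toNat = q + 1 + 1 by omega] at h3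
  have h3 := Submodule.sub_mem _ h1 h2
  rw [sub_sub_cancel] at h3
  exact (Submodule.smul_mem_iff _ (by positivity)).1 h3

end HasHorizontalDifferentials
end MetricFStructure
end AlmostK
end

/-! ### Exterior products and contractions on exterior powers -/

noncomputable section
set_option maxSynthPendingDepth 3
namespace exteriorPower
variable {R V : Type*} [CommRing R] [AddCommGroup V] [Module R V] {n : ℕ}

/-- Exterior multiplication by a vector. -/
def wedgeLeft (n : ℕ) (x : V) : ⋀[R]^n V →ₗ[R] ⋀[R]^(n + 1) V :=
  alternatingMapLinearEquiv ((ιMulti R (n + 1)).curryLeft x)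

/-- Contraction by a linear functional. -/
def contractLeft (n : ℕ) (e : V →ₗ[R] R) : ⋀[R]^(n + 1) V →ₗ[R] ⋀[R]^n V :=
  alternatingMapLinearEquiv (AlternatingMap.alternatizeUncurryFin (e.smulRight (ιMulti R n)))

theorem wedgeLeft_ιMulti (x : V) (v : Fin n → V) :
    wedgeLeft n x (ιMulti R n v) = ιMulti R (n + 1) (Matrix.vecCons x v) := by
  rw [wedgeLeft, alternatingMapLinearEquiv_apply_ιMulti, AlternatingMap.curryLeft_apply_apply]

theorem contractLeft_ιMulti (e : V →ₗ[R] R) (v : Fin (n + 1) → V) :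
    contractLeft n e (ιMulti R (n + 1) v) =
      ∑ i : Fin (n + 1), (-1) ^ (i : ℕ) • e (v i) • ιMulti R n (i.removeNth v) := by
  rw [contractLeft, alternatingMapLinearEquiv_apply_ιMulti,
    AlternatingMap.alternatizeUncurryFin_apply]
  rfl

theorem induction_ιMulti {p : ⋀[R]^n V → Prop} (w : ⋀[R]^n V) (h : ∀ v, p (ιMulti R n v))
    (h0 : p 0) (hadd : ∀ x y, p x → p y → p (x + y)) (hsmul : ∀ (c : R) x, p x → p (c • x)) : p w := by
  have hw : w ∈ Submodule.span R (Set.range (ιMulti R n)) := by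
    rw [ιMulti_span]
    exact Submodule.mem_top
  induction hw using Submodule.span_induction with
  | mem x hx =>
    obtain ⟨v, rfl⟩ := hx
    exact h v
  | zero => exact h0
  | add x y _ _ hx hy => exact hadd x y hx hy
  | smul c x _ hx => exact hsmul c x hx

theorem wedgeLeft_wedgeLeft (x y : V) (w : ⋀[R]^n V) :
    wedgeLeft (n + 1) x (wedgeLeft n y w) = -wedgeLeft (n + 1) y (wedgeLeft n x w) := by
  refine induction_ιMulti (p := fun w => wedgeLeft (n + 1) x (wedgeLeft n y w) = -wedgeLeft (n + 1) y (wedgeLeft n x w)) w (fun v => ?_) (by simp) (fun a b ha hb => by rw [map_add, map_add, map_add, map_add, ha, hb, neg_add])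
    (fun c a ha => by rw [map_smul, map_smul, map_smul, map_smul, ha, smul_neg])
  simp only [wedgeLeft_ιMulti]
  have h := (ιMulti R (n + 2)).map_swap (Matrix.vecCons y (Matrix.vecCons x v))
    (i := 0) (j := 1) (by simp)
  refine Eq.trans (congrArg _ (funext fun i => ?_)) h
  refine Fin.cases ?_ (fun i => Fin.cases ?_ (fun i => ?_) i) i
  · simp
  · simp
  · rw [Function.comp_apply, Equiv.swap_apply_of_ne_of_ne]
    · rfl
    · exact Fin.succ_ne_zero _
    · exact fun h => Fin.succ_ne_zero _ (Fin.succ_injective _ h)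

theorem contractLeft_wedgeLeft (e : V →ₗ[R] R) (x : V) (w : ⋀[R]^(n + 1) V) :
    contractLeft (n + 1) e (wedgeLeft (n + 1) x w) =
      e x • w - wedgeLeft n x (contractLeft n e w) := by
  refine induction_ιMulti (p := fun w => contractLeft (n + 1) e (wedgeLeft (n + 1) x w) =
      e x • w - wedgeLeft n x (contractLeft n e w)) w (fun v => ?_) (by simp) (fun a b ha hb => ?_) (fun c a ha => ?_)
  · rw [wedgeLeft_ιMulti, contractLeft_ιMulti, contractLeft_ιMulti, Fin.sum_univ_succ, sub_eq_add_neg,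
      map_sum, ← Finset.sum_neg_distrib]
    congr 1
    · simp
    · refine Finset.sum_congr rfl fun i _ => ?_
      have h2 : i.succ.removeNth (Matrix.vecCons x v) = Matrix.vecCons x (i.removeNth v) := by
        funext j
        refine Fin.cases ?_ (fun j => ?_) j <;> simp [Fin.removeNth]
      rw [h2, Matrix.cons_val_succ, Fin.val_succ, pow_succ, map_zsmul, map_smul, wedgeLeft_ιMulti]
      simp
  · simp only [map_add, ha, hb, smul_add]
    abel
  · simp only [map_smul, ha, smul_sub]
    rw [smul_comm]

theorem contractLeft_wedgeLeft_zero (e : V →ₗ[R] R) (x : V) (w : ⋀[R]^0 V) :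
    contractLeft 0 e (wedgeLeft 0 x w) = e x • w := by
  refine induction_ιMulti (p := fun w => contractLeft 0 e (wedgeLeft 0 x w) = e x • w) w (fun v => ?_) (by simp) (fun a b ha hb => ?_) (fun c a ha => ?_)
  · rw [wedgeLeft_ιMulti, contractLeft_ιMulti]
    simp
  · simp only [map_add, ha, hb, smul_add]
  · simp only [map_smul, ha]
    rw [smul_comm]

/-- The constant alternating map `1` identifies `⋀⁰` with `R` and sends the empty product to `1`. -/
theorem tmul_ιMulti_zero_injective {H : Type*} [AddCommGroup H] [Module R H] (v : Fin 0 → V) {x : H}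
    (h : x ⊗ₜ[R] ιMulti R 0 v = 0) : x = 0 := by
  have h1 := congrArg ((TensorProduct.rid R H).toLinearMap ∘ₗ LinearMap.lTensor H
    (alternatingMapLinearEquiv (AlternatingMap.constOfIsEmpty R V (Fin 0) (1 : R)))) h
  simpa using h1

section TensorProduct
variable {H : Type*} [AddCommGroup H] [Module R H]

theorem lTensor_wedgeLeft_comm (x y : V) (w : H ⊗[R] ⋀[R]^n V) :
    LinearMap.lTensor H (wedgeLeft (n + 1) x) (LinearMap.lTensor H (wedgeLeft n y) w) =
      -LinearMap.lTensor H (wedgeLeft (n + 1) y) (LinearMap.lTensor H (wedgeLeft n x) w) := by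
  induction w using TensorProduct.induction_on with
  | zero => simp
  | tmul h w =>
    simp only [LinearMap.lTensor_tmul]
    rw [wedgeLeft_wedgeLeft, TensorProduct.tmul_neg]
  | add a b ha hb => simp only [map_add, ha, hb, neg_add]

theorem lTensor_contractLeft_wedgeLeft (e : V →ₗ[R] R) (x : V) (w : H ⊗[R] ⋀[R]^(n + 1) V) :
    LinearMap.lTensor H (contractLeft (n + 1) e) (LinearMap.lTensor H (wedgeLeft (n + 1) x) w) =
      e x • w - LinearMap.lTensor H (wedgeLeft n x) (LinearMap.lTensor H (contractLeft n e) w) := by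
  induction w using TensorProduct.induction_on with
  | zero => simp
  | tmul h w =>
    simp only [LinearMap.lTensor_tmul]
    rw [contractLeft_wedgeLeft, TensorProduct.tmul_sub, TensorProduct.tmul_smul]
  | add a b ha hb =>
    simp only [map_add, ha, hb, smul_add]
    abel

theorem lTensor_contractLeft_wedgeLeft_zero (e : V →ₗ[R] R) (x : V) (w : H ⊗[R] ⋀[R]^0 V) :
    LinearMap.lTensor H (contractLeft 0 e) (LinearMap.lTensor H (wedgeLeft 0 x) w) = e x • w := by
  induction w using TensorProduct.induction_on with
  | zero => simp
  | tmul h w =>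
    simp only [LinearMap.lTensor_tmul]
    rw [contractLeft_wedgeLeft_zero, TensorProduct.tmul_smul]
  | add a b ha hb => simp only [map_add, ha, hb, smul_add]

end TensorProduct
end exteriorPower

/-! ### Contraction systems and their symbol maps. -/

/-- Anticommuting contractions on a graded space, with wedge operators dual to them. -/
structure ContractionSystem (s : ℕ) (Z : ℕ → Type*) [∀ q, AddCommGroup (Z q)]
    [∀ q, Module ℝ (Z q)] where
  /-- The contractions. -/
  contr : Fin s → ∀ q, Z (q + 1) →ₗ[ℝ] Z q
  /-- The wedge operators. -/
  wedge : Fin s → ∀ q, Z q →ₗ[ℝ] Z (q + 1)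
  contr_contr : ∀ i j q z, contr i q (contr j (q + 1) z) = -contr j q (contr i (q + 1) z)
  contr_wedge : ∀ i j q z, contr i (q + 1) (wedge j (q + 1) z) =
    (if j = i then (1 : ℝ) else 0) • z - wedge j q (contr i q z)
  contr_wedge_zero : ∀ i j z, contr i 0 (wedge j 0 z) = (if j = i then (1 : ℝ) else 0) • z

namespace ContractionSystem
open exteriorPower
variable {s : ℕ} {Z : ℕ → Type*} [∀ q, AddCommGroup (Z q)] [∀ q, Module ℝ (Z q)]
  {H V : Type*} [AddCommGroup H] [Module ℝ H] [AddCommGroup V] [Module ℝ V]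
  (T : ContractionSystem s Z) (b : Z 0 →ₗ[ℝ] H) (η : Fin s → V)

/-- The class of the full contraction of `z` along `I` tensor `η_I`, summed over `I`. -/
def symbol : ∀ q, Z q →ₗ[ℝ] H ⊗[ℝ] ⋀[ℝ]^q V
  | 0 => (TensorProduct.mk ℝ H (⋀[ℝ]^0 V)).flip (ιMulti ℝ 0 ![]) ∘ₗ b
  -- The factor compensates for the `q + 1` choices of the index that is contracted first.
  | q + 1 => ((q : ℝ) + 1)⁻¹ • ∑ i, LinearMap.lTensor H (wedgeLeft q (η i)) ∘ₗ
      symbol q ∘ₗ T.contr i q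

theorem symbol_succ (q : ℕ) (z : Z (q + 1)) :
    T.symbol b η (q + 1) z = ((q : ℝ) + 1)⁻¹ • ∑ i, LinearMap.lTensor H (wedgeLeft q (η i))
      (T.symbol b η q (T.contr i q z)) := by
  simp [symbol]

theorem symbol_one (z : Z (0 + 1)) :
    T.symbol b η (0 + 1) z = ∑ i, LinearMap.lTensor H (wedgeLeft 0 (η i))
      (T.symbol b η 0 (T.contr i 0 z)) := by
  simp [symbol]

theorem sum_symbol (q : ℕ) (z : Z (q + 1)) :
    ∑ i, LinearMap.lTensor H (wedgeLeft q (η i)) (T.symbol b η q (T.contr i q z)) =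
      ((q : ℝ) + 1) • T.symbol b η (q + 1) z := by
  rw [symbol_succ, smul_smul, mul_inv_cancel₀ (by positivity), one_smul]

theorem inv_smul_add_smul {W : Type*} [AddCommGroup W] [Module ℝ W] (q : ℕ) (w : W) :
    (((q + 1 : ℕ) : ℝ) + 1)⁻¹ • (w + ((q : ℝ) + 1) • w) = w := by
  have h : w + ((q : ℝ) + 1) • w = (((q + 1 : ℕ) : ℝ) + 1) • w := by
    push_cast
    rw [add_smul ((q : ℝ) + 1) (1 : ℝ), one_smul, add_comm]
  rw [h, smul_smul, inv_mul_cancel₀ (by positivity), one_smul]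

/-- Contracting `η_j ∧ z` gives `z` for `i = j` and otherwise terms whose sign is absorbed by moving
`η_j` to the front. The sum is `1 + (q + 1)` times the result, and the normalization removes this
factor. -/
theorem symbol_wedge (j : Fin s) : ∀ {q : ℕ} (z : Z q),
    T.symbol b η (q + 1) (T.wedge j q z) =
      LinearMap.lTensor H (wedgeLeft q (η j)) (T.symbol b η q z) := by
  intro q
  induction q with
  | zero =>
    intro z
    rw [symbol_one]
    simp only [T.contr_wedge_zero, map_smul]
    simp only [ite_smul, one_smul, zero_smul]
    rw [Finset.sum_ite_eq, if_pos (Finset.mem_univ j)]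
  | succ q ih =>
    intro z
    have h : ∀ i, LinearMap.lTensor H (wedgeLeft (q + 1) (η i))
        (T.symbol b η (q + 1) (T.contr i (q + 1) (T.wedge j (q + 1) z))) =
        (if j = i then LinearMap.lTensor H (wedgeLeft (q + 1) (η i)) (T.symbol b η (q + 1) z)
          else 0) + LinearMap.lTensor H (wedgeLeft (q + 1) (η j))
          (LinearMap.lTensor H (wedgeLeft q (η i)) (T.symbol b η q (T.contr i q z))) := by
      intro i
      rw [T.contr_wedge, map_sub, map_smul, map_sub, map_smul, ih, lTensor_wedgeLeft_comm,
        sub_neg_eq_add]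
      simp only [ite_smul, one_smul, zero_smul]
    rw [symbol_succ]
    simp only [h]
    rw [Finset.sum_add_distrib, Finset.sum_ite_eq, if_pos (Finset.mem_univ j), ← map_sum,
      sum_symbol, map_smul, inv_smul_add_smul]

/-- The symbol intertwines contraction in the exterior power with contraction on `Z`, by the
computation dual to `symbol_wedge`. Hence a vanishing symbol passes to all contractions. -/
theorem contractLeft_symbol {e : V →ₗ[ℝ] ℝ} {j : Fin s} (he : ∀ i, e (η i) = if i = j then 1 else 0) :
    ∀ {q : ℕ} (z : Z (q + 1)), LinearMap.lTensor H (contractLeft q e) (T.symbol b η (q + 1) z) =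
      T.symbol b η q (T.contr j q z) := by
  intro q
  induction q with
  | zero =>
    intro z
    rw [symbol_one, map_sum]
    simp only [lTensor_contractLeft_wedgeLeft_zero, he, ite_smul, one_smul, zero_smul]
    rw [Finset.sum_ite_eq', if_pos (Finset.mem_univ j)]
  | succ q ih =>
    intro z
    have h : ∀ i, LinearMap.lTensor H (contractLeft (q + 1) e)
        (LinearMap.lTensor H (wedgeLeft (q + 1) (η i))
          (T.symbol b η (q + 1) (T.contr i (q + 1) z))) =
        (if i = j then T.symbol b η (q + 1) (T.contr i (q + 1) z) else 0) +
        LinearMap.lTensor H (wedgeLeft q (η i))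
          (T.symbol b η q (T.contr i q (T.contr j (q + 1) z))) := by
      intro i
      rw [lTensor_contractLeft_wedgeLeft, ih, T.contr_contr j i, map_neg, map_neg, sub_neg_eq_add, he]
      simp only [ite_smul, one_smul, zero_smul]
    rw [symbol_succ, map_smul, map_sum]
    simp only [h]
    rw [Finset.sum_add_distrib, Finset.sum_ite_eq', if_pos (Finset.mem_univ j), sum_symbol,
      inv_smul_add_smul]

end ContractionSystem
end

/-! ### The second page -/

noncomputable section
set_option maxSynthPendingDepth 3

namespace AlmostK
namespace MetricFStructure
open exteriorPower
variable {E : Type*} [NormedAddCommGroup E] [NormedSpace ℝ E] [FiniteDimensional ℝ E]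
  {M : Type*} [TopologicalSpace M] [ChartedSpace E M] [IsManifold 𝓘(ℝ, E) ∞ M]
  [T2Space M] [CompactSpace M] {s : ℕ} {A : MetricFStructure E s M}

theorem basicForms_le_invariantForms {p : ℕ} {a : Form E M p} (ha : a ∈ A.basicForms p) :
    a ∈ A.invariantForms p :=
  A.mem_invariantForms_iff.2 ⟨ha.1, ((isBasic_iff ha.1).1 ha.2).2⟩

theorem mem_basicForms_of_filtration {p : ℕ} {α : A.invariantForms p} (h : α ∈ A.filtration p p) :
    (α : Form E M p) ∈ A.basicForms p := by
  rw [mem_filtration_iff, show ((p : ℤ) - p + 1).toNat = 1 by simp,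
    vanishesOnVertical_one_iff] at h
  exact ⟨α.2.1, (isBasic_iff α.2.1).2 ⟨h, (A.mem_invariantForms_iff.1 α.2).2⟩⟩

omit [FiniteDimensional ℝ E] [T2Space M] [CompactSpace M] in
theorem mem_filtration_of_basicForms {p : ℕ} {α : A.invariantForms p}
    (h : (α : Form E M p) ∈ A.basicForms p) : α ∈ A.filtration p p := by
  rw [mem_filtration_iff, show ((p : ℤ) - p + 1).toNat = 1 by simp, vanishesOnVertical_one_iff]
  exact h.2.1

omit [FiniteDimensional ℝ E] [T2Space M] [CompactSpace M] in
theorem eq_zero_of_mem_filtration {m : ℕ} {k : ℤ} (hk : (m : ℤ) < k) {α : A.invariantForms m}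
    (h : α ∈ A.filtration k m) : α = 0 := by
  rw [mem_filtration_iff, show ((m : ℤ) - k + 1).toNat = 0 by omega, vanishesOnVertical_zero_iff] at h
  exact Subtype.ext h

/-- A cycle of bidegree `(p, 0)` as a closed basic form. -/
def cyclesToCocycles (p : ℕ) : A.cyclesTwo p p →ₗ[ℝ] A.basicComplex.cocycles p where
  toFun α := ⟨⟨(α : A.invariantForms p), mem_basicForms_of_filtration α.2.1⟩,
    -- The differential lies in `F^{p+2}` in degree `p + 1`, hence it is zero.
    Subtype.ext (congrArg (Subtype.val : A.invariantForms (p + 1) → Form E M (p + 1))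
      (eq_zero_of_mem_filtration (by push_cast; omega) α.2.2) :)⟩
  map_add' _ _ := rfl
  map_smul' _ _ := rfl

/-- The basic cohomology class of a cycle of bidegree `(p, 0)`. -/
def baseClass (p : ℕ) : A.cyclesTwo p p →ₗ[ℝ] A.basicComplex.Cohomology p :=
  A.basicComplex.classOf p ∘ₗ cyclesToCocycles p

/-- In bidegree `(p, 0)` the term `F^{p+1}` is zero, and the other part of the boundaries is `d` of
`F^{p-1}` in degree `p - 1`, that is, `d` of basic forms. -/
theorem baseClass_eq_zero_iff {p : ℕ} (α : A.cyclesTwo p p) :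
    baseClass p α = 0 ↔ (α : A.invariantForms p) ∈ A.boundariesTwo p p := by
  have h1 : baseClass p α = 0 ↔
      (cyclesToCocycles p α : A.basicComplex.C p) ∈ A.basicComplex.coboundaries p :=
    Submodule.Quotient.mk_eq_zero _
  rw [h1]
  constructor
  · intro h
    refine Submodule.mem_sup_right ?_
    cases p with
    | zero =>
      have h0 : (cyclesToCocycles 0 α : A.basicComplex.C 0) = 0 := (Submodule.mem_bot ℝ).1 h
      exact (Submodule.mem_bot ℝ).2 (Subtype.ext
        (congrArg (Subtype.val : A.basicForms 0 → Form E M 0) h0 :))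
    | succ p =>
      obtain ⟨b, hb⟩ := h
      let b' : A.basicForms p := b
      refine ⟨⟨b'.1, basicForms_le_invariantForms b'.2⟩, ?_,
        Subtype.ext (congrArg (Subtype.val : A.basicForms (p + 1) → Form E M (p + 1)) hb :)⟩
      have h2 := mem_filtration_of_basicForms (A := A)
        (α := ⟨b'.1, basicForms_le_invariantForms b'.2⟩) b'.2
      rwa [show ((p + 1 : ℕ) : ℤ) - (2 : ℕ) + 1 = (p : ℤ) by push_cast; ring]
  · intro h
    obtain ⟨β, hβ, γ, hγ, hβγ⟩ := Submodule.mem_sup.1 h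
    rw [eq_zero_of_mem_filtration (by omega) hβ, zero_add] at hβγ
    cases p with
    | zero =>
      refine (Submodule.mem_bot ℝ).2 (Subtype.ext ?_)
      have h0 : γ = 0 := (Submodule.mem_bot ℝ).1 hγ
      rw [h0] at hβγ
      exact (congrArg (Subtype.val : A.invariantForms 0 → Form E M 0) hβγ.symm :)
    | succ p =>
      obtain ⟨b, hb, rfl⟩ := hγ
      rw [show ((p + 1 : ℕ) : ℤ) - (2 : ℕ) + 1 = (p : ℤ) by push_cast; ring] at hb
      exact ⟨(⟨b.1, mem_basicForms_of_filtration hb⟩ : A.basicForms p),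
        Subtype.ext (congrArg (Subtype.val : A.invariantForms (p + 1) → Form E M (p + 1)) hβγ :)⟩

/-- A closed basic form as a cycle of bidegree `(p, 0)`. -/
def basicToCycles {p : ℕ} (a : A.basicForms p) (ha : A.basicD p a = 0) : A.cyclesTwo p p :=
  ⟨⟨a.1, basicForms_le_invariantForms a.2⟩, mem_filtration_of_basicForms a.2, by
    have h : A.invariantD p ⟨a.1, basicForms_le_invariantForms a.2⟩ = 0 :=
      Subtype.ext (congrArg (Subtype.val : A.basicForms (p + 1) → Form E M (p + 1)) ha :)
    refine Submodule.mem_comap.2 ?_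
    rw [h]
    exact Submodule.zero_mem _⟩

theorem baseClass_basicToCycles {p : ℕ} (a : A.basicForms p) (ha : A.basicD p a = 0) :
    baseClass p (basicToCycles a ha) = A.basicComplex.classOf p ⟨a, ha⟩ := rfl

/-- Evaluation of the forms `ηᵢ` on `ξⱼ` at a point. -/
def evalXi (A : MetricFStructure E s M) (x : M) (j : Fin s) : A.etaSpan →ₗ[ℝ] ℝ where
  toFun w := (w : Form E M 1) x fun _ => A.ξ j x
  map_add' _ _ := rfl
  map_smul' _ _ := rfl

omit [FiniteDimensional ℝ E] [T2Space M] [CompactSpace M] in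
theorem evalXi_eta (x : M) (i j : Fin s) : A.evalXi x j (A.eta i) = if i = j then 1 else 0 :=
  A.η_ξ i j x

namespace HasHorizontalDifferentials
variable (hA : A.HasHorizontalDifferentials)

/-- Contraction with `ξᵢ` on cycles. -/
def contrCycles (i : Fin s) (p : ℤ) (m : ℕ) : A.cyclesTwo p (m + 1) →ₗ[ℝ] A.cyclesTwo p m :=
  (hA.contr i m).restrict fun _ h => hA.contr_mem_cycles i h

/-- The exterior product with `ηᵢ` on cycles. -/
def wedgeCycles (i : Fin s) (p : ℤ) (m : ℕ) : A.cyclesTwo p m →ₗ[ℝ] A.cyclesTwo p (m + 1) :=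
  (hA.wedgeEta i m).restrict fun _ h => hA.wedgeEta_mem_cycles i h

theorem contrCycles_contrCycles (i j : Fin s) {p : ℤ} {m : ℕ} (α : A.cyclesTwo p (m + 2)) :
    hA.contrCycles i p m (hA.contrCycles j p (m + 1) α) =
      -hA.contrCycles j p m (hA.contrCycles i p (m + 1) α) :=
  Subtype.ext (hA.contr_contr i j α.1)

theorem contrCycles_wedgeCycles (i j : Fin s) {p : ℤ} {m : ℕ} (α : A.cyclesTwo p (m + 1)) :
    hA.contrCycles i p (m + 1) (hA.wedgeCycles j p (m + 1) α) =
      (if j = i then (1 : ℝ) else 0) • α - hA.wedgeCycles j p m (hA.contrCycles i p m α) :=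
  Subtype.ext (hA.contr_wedgeEta i j α.1)

theorem contrCycles_wedgeCycles_base (i j : Fin s) {p : ℕ} (α : A.cyclesTwo p p) :
    hA.contrCycles i p p (hA.wedgeCycles j p p α) = (if j = i then (1 : ℝ) else 0) • α := by
  cases p with
  | zero => exact Subtype.ext (hA.contr_wedgeEta_zero i j α.1)
  | succ p =>
    -- The contraction has degree `p` and filtration index `p + 1`, so it vanishes.
    have h0 : hA.contrCycles i (p + 1 : ℕ) p α = 0 :=
      Subtype.ext (eq_zero_of_mem_filtration (by push_cast; omega) (hA.contr_mem_filtration i α.2.1))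
    rw [contrCycles_wedgeCycles, h0, map_zero, sub_zero]

/-- Contractions with `ξᵢ` and products with `ηᵢ` on the cycles of the second page. -/
def contractionSystem (p : ℕ) : ContractionSystem s fun q => A.cyclesTwo p (p + q) where
  contr i q := hA.contrCycles i p (p + q)
  wedge i q := hA.wedgeCycles i p (p + q)
  contr_contr i j _ z := hA.contrCycles_contrCycles i j z
  contr_wedge i j _ z := hA.contrCycles_wedgeCycles i j z
  contr_wedge_zero i j z := hA.contrCycles_wedgeCycles_base i j z

/-- The map from the cycles of the second page that induces its isomorphism with the tensor
product. -/
def pageMap (p q : ℕ) : A.cyclesTwo p (p + q) →ₗ[ℝ]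
    A.basicComplex.Cohomology p ⊗[ℝ] ⋀[ℝ]^q A.etaSpan :=
  (hA.contractionSystem p).symbol (baseClass p) A.eta q

theorem pageMap_zero (p : ℕ) (α : A.cyclesTwo p p) :
    hA.pageMap p 0 α = baseClass p α ⊗ₜ ιMulti ℝ 0 ![] := rfl

theorem pageMap_succ (p q : ℕ) (α : A.cyclesTwo p (p + q + 1)) :
    hA.pageMap p (q + 1) α = ((q : ℝ) + 1)⁻¹ • ∑ i, LinearMap.lTensor _ (wedgeLeft q (A.eta i))
      (hA.pageMap p q (hA.contrCycles i p (p + q) α)) :=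
  (hA.contractionSystem p).symbol_succ (baseClass p) A.eta q α

theorem pageMap_wedgeCycles (j : Fin s) {p q : ℕ} (β : A.cyclesTwo p (p + q)) :
    hA.pageMap p (q + 1) (hA.wedgeCycles j p (p + q) β) =
      LinearMap.lTensor _ (wedgeLeft q (A.eta j)) (hA.pageMap p q β) :=
  (hA.contractionSystem p).symbol_wedge (baseClass p) A.eta j β

theorem contractLeft_pageMap (x : M) (j : Fin s) {p q : ℕ} (α : A.cyclesTwo p (p + q + 1)) :
    LinearMap.lTensor _ (contractLeft q (A.evalXi x j)) (hA.pageMap p (q + 1) α) =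
      hA.pageMap p q (hA.contrCycles j p (p + q) α) :=
  (hA.contractionSystem p).contractLeft_symbol (baseClass p) A.eta
    (fun i => evalXi_eta x i j) α

/-- Induction on `q`: the functionals dual to the `ηᵢ` show that `pageMap` kills all contractions of
`α`, and `mem_boundaries_of_contr` lifts the conclusion back to `α`. -/
theorem pageMap_eq_zero_iff {p : ℕ} : ∀ {q : ℕ} (α : A.cyclesTwo p (p + q)),
    hA.pageMap p q α = 0 ↔ (α : A.invariantForms (p + q)) ∈ A.boundariesTwo p (p + q) := by
  intro q
  induction q with
  | zero =>
    intro α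
    refine Iff.trans ?_ (baseClass_eq_zero_iff α)
    constructor
    · exact fun h => tmul_ιMulti_zero_injective _ h
    · intro h
      rw [pageMap_zero]
      exact (congrArg (fun c => c ⊗ₜ[ℝ] ιMulti ℝ 0 ![]) h).trans (TensorProduct.zero_tmul _ _)
  | succ q ih =>
    intro α
    constructor
    · intro h
      -- The dual functionals evaluate at a point of `M`; without points all forms are zero.
      rcases isEmpty_or_nonempty M with hM | ⟨⟨x⟩⟩
      · have h0 : (α : A.invariantForms (p + (q + 1))) = 0 := Subtype.ext (funext fun x => hM.elim x)
        rw [h0]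
        exact Submodule.zero_mem _
      · refine hA.mem_boundaries_of_contr α.2 fun i => ?_
        refine (ih (hA.contrCycles i p (p + q) α)).1 ?_
        rw [← hA.contractLeft_pageMap x i α, h, map_zero]
    · intro h
      rw [pageMap_succ, Finset.sum_eq_zero, smul_zero]
      intro i _
      rw [(ih (hA.contrCycles i p (p + q) α)).2 (hA.contr_mem_boundaries i h), map_zero]

/-- Each factor `ηᵢ` preserves cycles and acts on the symbol by exterior multiplication. This
computes the isomorphism on explicit representatives and gives surjectivity. -/
theorem exists_cycle_wedgeProd {p : ℕ} (a : A.basicForms p) (ha : A.basicD p a = 0) :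
    ∀ {q : ℕ} (I : Fin q → Fin s), ∃ z : A.cyclesTwo p (p + q),
      ((z : A.invariantForms (p + q)) : Form E M (p + q)) =
        Form.wedgeProd (a : Form E M p) (fun j => A.η (I j)) ∧
      hA.pageMap p q z = A.basicComplex.classOf p ⟨a, ha⟩ ⊗ₜ ιMulti ℝ q fun j => A.eta (I j) := by
  intro q
  induction q with
  | zero =>
    intro I
    refine ⟨basicToCycles a ha, rfl, ?_⟩
    rw [pageMap_zero, baseClass_basicToCycles]
    congr 2
    exact Subsingleton.elim _ _
  | succ q ih =>
    intro I
    obtain ⟨z, hz, hz'⟩ := ih fun j => I j.succ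
    refine ⟨hA.wedgeCycles (I 0) p (p + q) z, ?_, ?_⟩
    · change Form.wedge (A.η (I 0)) z.1.1 = _
      rw [hz]
      rfl
    · refine (hA.pageMap_wedgeCycles (I 0) z).trans ?_
      rw [hz', LinearMap.lTensor_tmul, wedgeLeft_ιMulti]
      congr 2
      funext j
      refine Fin.cases ?_ (fun j => ?_) j <;> rfl

theorem pageMap_surjective (p q : ℕ) : Function.Surjective (hA.pageMap p q) := by
  rw [← LinearMap.range_eq_top, eq_top_iff]
  intro x hx
  clear hx
  induction x using TensorProduct.induction_on with
  | zero => exact Submodule.zero_mem _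
  | add x y hx hy => exact Submodule.add_mem _ hx hy
  | tmul c w =>
    obtain ⟨⟨a, ha⟩, rfl⟩ := Submodule.mkQ_surjective _ c
    have hspan : Submodule.span ℝ (Set.range A.eta) = ⊤ := by
      refine Submodule.map_injective_of_injective A.etaSpan.subtype_injective ?_
      rw [Submodule.map_span, Submodule.map_top, Submodule.range_subtype, ← Set.range_comp]
      rfl
    have hw : w ∈ Submodule.span ℝ (ιMulti ℝ q '' {v | Set.range v ⊆ Set.range A.eta}) := by
      rw [ιMulti_span_of_span ℝ q _ hspan]
      exact Submodule.mem_top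
    induction hw using Submodule.span_induction with
    | mem w hw =>
      obtain ⟨v, hv, rfl⟩ := hw
      choose I hI using fun j => hv ⟨j, rfl⟩
      obtain ⟨z, -, hz⟩ := hA.exists_cycle_wedgeProd a ha I
      refine ⟨z, hz.trans ?_⟩
      rw [funext hI]
      rfl
    | zero =>
      rw [TensorProduct.tmul_zero]
      exact Submodule.zero_mem _
    | add x y _ _ hx hy =>
      rw [TensorProduct.tmul_add]
      exact Submodule.add_mem _ hx hy
    | smul r x _ hx =>
      rw [TensorProduct.tmul_smul]
      exact Submodule.smul_mem _ _ hx

end HasHorizontalDifferentials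
end MetricFStructure
end AlmostK
end

/-! ### Passage to the pages of the spectral sequence. -/

noncomputable section
namespace AlmostK
namespace MetricFStructure
namespace HasHorizontalDifferentials
variable {E : Type*} [NormedAddCommGroup E] [NormedSpace ℝ E] [FiniteDimensional ℝ E]
  {M : Type*} [TopologicalSpace M] [ChartedSpace E M] [IsManifold 𝓘(ℝ, E) ∞ M]
  [T2Space M] [CompactSpace M] {s : ℕ} {A : MetricFStructure E s M}
  (hA : A.HasHorizontalDifferentials)

include hA in
theorem invariantComplex_d_mem {p : ℤ} {m : ℕ} {α : A.invariantComplex.C m}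
    (h : α ∈ A.invariantComplex.F p m) :
    A.invariantComplex.d m α ∈ A.invariantComplex.F p (m + 1) :=
  A.invariantComplex.F_succ_le p (m + 1) (hA.d_mem_filtration h)

include hA in
theorem pageD_zero (p : ℤ) (m : ℕ) : A.invariantComplex.pageD 0 p m = 0 := by
  refine Submodule.linearMap_qext _ (LinearMap.ext fun z => ?_)
  refine (Submodule.Quotient.mk_eq_zero _).2 (Submodule.mem_sup_left ?_)
  have h : A.invariantComplex.d m z ∈ A.invariantComplex.F (p + 1) (m + 1) :=
    hA.d_mem_filtration z.2.1
  -- The target of `pageD 0` is indexed by `p + 0`, so the filtration index is rewritten.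
  have h0 : p + ((0 : ℕ) : ℤ) + 1 = p + 1 := by simp
  exact h0 ▸ h

/-- The page map on the cycles of the spectral sequence of invariant forms. -/
def cyclesToTensor (p q : ℕ) : A.invariantComplex.cycles 2 p (p + q) →ₗ[ℝ]
    A.basicComplex.Cohomology p ⊗[ℝ] ⋀[ℝ]^q A.etaSpan := hA.pageMap p q

theorem cyclesToTensor_surjective (p q : ℕ) : Function.Surjective (hA.cyclesToTensor p q) :=
  hA.pageMap_surjective p q

theorem ker_cyclesToTensor (p q : ℕ) : LinearMap.ker (hA.cyclesToTensor p q) =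
    (A.invariantComplex.boundaries 2 p (p + q)).submoduleOf
      (A.invariantComplex.cycles 2 p (p + q)) := by
  ext z
  rw [LinearMap.mem_ker]
  change _ ↔ (z : A.invariantComplex.C (p + q)) ∈ A.invariantComplex.boundaries 2 p (p + q)
  rw [boundariesTwo_eq]
  exact hA.pageMap_eq_zero_iff z

/-- The second page is the tensor product of basic cohomology and the exterior algebra of the
`ηᵢ`. -/
def pageTwoEquiv (p q : ℕ) : A.invariantComplex.Page 2 p (p + q) ≃ₗ[ℝ]
    A.basicComplex.Cohomology p ⊗[ℝ] ⋀[ℝ]^q A.etaSpan :=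
  (Submodule.quotEquivOfEq _ _ (hA.ker_cyclesToTensor p q).symm).trans
    ((hA.cyclesToTensor p q).quotKerEquivOfSurjective (hA.cyclesToTensor_surjective p q))

theorem pageTwoEquiv_pageMk (p q : ℕ) (z : A.invariantComplex.cycles 2 p (p + q)) :
    hA.pageTwoEquiv p q (A.invariantComplex.pageMk 2 p (p + q) z) = hA.cyclesToTensor p q z := rfl

theorem exists_pageTwoEquiv_pageMk {p : ℕ} (q : ℕ) (a : A.basicForms p) (ha : A.basicD p a = 0)
    (I : Fin q → Fin s) :
    ∃ (z : A.invariantForms (p + q)) (hz : z ∈ A.invariantComplex.cycles 2 p (p + q)),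
      (z : Form E M (p + q)) = Form.wedgeProd (a : Form E M p) (fun j => A.η (I j)) ∧
      hA.pageTwoEquiv p q (A.invariantComplex.pageMk 2 p (p + q) ⟨z, hz⟩) =
        A.basicComplex.classOf p ⟨a, ha⟩ ⊗ₜ exteriorPower.ιMulti ℝ q fun j => A.eta (I j) := by
  obtain ⟨z, hz, hz'⟩ := hA.exists_cycle_wedgeProd a ha I
  exact ⟨z.1, z.2, hz, (hA.pageTwoEquiv_pageMk p q z).trans hz'⟩

end HasHorizontalDifferentials
end MetricFStructure
end AlmostK
end

theorem theorem3 (n s : ℕ) {M : Type*} [TopologicalSpace M] [T2Space M] [CompactSpace M]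
    [ChartedSpace (EuclideanSpace ℝ (Fin (2 * n + s))) M]
    [IsManifold (𝓡 (2 * n + s)) ∞ M]
    (A : MetricFStructure (EuclideanSpace ℝ (Fin (2 * n + s))) s M)
    (hA : A.IsAlmostS ∨ (A.IsAlmostK ∧ ∀ i, A.IsBasic (A.η i).d)) :
    (∀ (p : ℤ) (m : ℕ), ∀ α ∈ A.invariantComplex.F p m,
      A.invariantComplex.d m α ∈ A.invariantComplex.F p (m + 1)) ∧
    (∀ (p : ℤ) (m : ℕ), A.invariantComplex.pageD 0 p m = 0) ∧
    ∀ p q : ℕ, ∃ e : A.invariantComplex.Page 2 p (p + q) ≃ₗ[ℝ]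
        A.basicComplex.Cohomology p ⊗[ℝ] ⋀[ℝ]^q A.etaSpan,
      ∀ (a : A.basicForms p) (ha : A.basicD p a = 0) (I : Fin q → Fin s),
        ∃ (z : A.invariantForms (p + q)) (hz : z ∈ A.invariantComplex.cycles 2 p (p + q)),
          (z : Form _ M (p + q)) = Form.wedgeProd (a : Form _ M p) (fun j => A.η (I j)) ∧
          e (A.invariantComplex.pageMk 2 p (p + q) ⟨z, hz⟩) =
            A.basicComplex.classOf p ⟨a, ha⟩ ⊗ₜ exteriorPower.ιMulti ℝ q fun j => A.eta (I j) := by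
  have h : A.HasHorizontalDifferentials := MetricFStructure.hasHorizontalDifferentials hA
  refine ⟨?_, ?_, ?_⟩
  · intro p m α hα
    exact h.invariantComplex_d_mem hα
  · exact h.pageD_zero
  · intro p q
    exact ⟨h.pageTwoEquiv p q, h.exists_pageTwoEquiv_pageMk q⟩
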